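/- **Setting.** Let $\mathcal C$ be an abelian, $\mathbf C$-linear, semisimple, rigid, braided tensor category with braiding $c$ and a balancing $\theta$ (a natural automorphism of the identity with $\theta_{X\otimes Y}=c_{Y,X}c_{X,Y}(\theta_X\otimes\theta_Y)$, compatible with duals). Assume that it has only finitely many isomorphism classes of irreducible objects, with representatives $j\in\mathcal I$, that $End(j)=\mathbf C$ for these, and that the unit object $1$ is irreducible. Let $tr_X:End(X)\to End(1)=\mathbf C$ be the canonical trace, and $S_{i,j}=tr_{i\otimes j}(c_{j,i}c_{i,j})$. Let $\hat d:\mathcal I\to\mathbf C$ satisfy $\sum_j\hat d(j)S_{j,i}=\delta_{i,1}$ for all $i$, and $\hat d(1)\neq 0$; put $d(j)=\hat d(j)/\hat d(1)$. For every object $X$ choose bases $\{f^X_\alpha\}_{\alpha\in\Lambda_X}$ of $Hom(X,1)$ and $\{e^X_\alpha\}_{\alpha\in\Lambda_X}$ of $Hom(1,X)$ with $f^X_\alpha\circ e^X_\beta=\delta_{\alpha\beta}$. **Bridged links.** A bridged link $\mathcal L$ in a disjoint union of $r$ three-spheres is presented by blackboard-framed directed ribbon diagrams, one for each sphere, composed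 of crossings, maxima, minima and pairs of coupons $(j,+),(j,-)$. A list of ribbons enters the coupon $(j,+)$, and the same list, in the same order and with the same directions, leaves the coupon $(j,-)$; the ribbons are continued from $(j,+)$ to $(j,-)$. A coloration $C$ assigns to each closed ribbon $L$ a colour $C(L)\in\mathcal I$ and to each pair of coupons an index in $\Lambda_X$, where $X=l_1\otimes\cdots\otimes l_n$ is the product of the colours of the ribbons that enter $(j,+)$ (with the dual for ribbons of the opposite direction). Replacing crossings by braid isomorphisms, extrema by the (opposite) rigidity morphisms, $(j,+)$ by $f^X_\alpha$ and $(j,-)$ by $e^X_\alpha$ gives in the sphere $\omega$ a morphism $1\to1$, that is, a number $F(\mathcal L,C,\omega)$. Define $$\{\mathcal L\}=\sum_C\prod_{\omega=1}^rF(\mathcal L,C,\omega)\prod_L d(C(L)).$$ Let $C_2,C_1,C_0$ be the real vector spaces with bases the ribbons, the pairs of coupons and the spheres, and let $\partial:C_2\to C_1$ count, with signs for directions, how often a ribbon passes through a pair of coupons. Put $\chi(\mathcal L)=\dim C_2-\dim C_1+\dim C_0$, and let $\sigma(\mathcal L)$ be the signature of the restriction to $\ker\partial\subset C_2$ of the linking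 matrix of $\mathcal L$ (off the diagonal, half the signed number of crossings of two ribbons; on the diagonal, the framing number, i.e. the signed number of self-crossings). **Moves.** Let $\mathcal L\cup\mathsf c$ be $\mathcal L$ with an additional isolated cancellation diagram, that is, a new pair of coupons joined by one new ribbon that runs directly from $(j,-)$ to $(j,+)$. Let $\mathcal L\cup\bigcirc_{-1}$ be $\mathcal L$ with an additional isolated unknot of framing number $-1$. If the coupons of one pair of $\mathcal L$ face each other, so that a list of ribbons enters $(j,+)$ and leaves $(j,-)$ directly behind it, let $\mathcal L\cup\eta$ be the bridged link in which these two coupons are removed, the ribbons are joined by parallel straight strands, and a new unknotted annulus of framing number $0$ (with either direction) encircles these strands. **Claim.** For every bridged link $\mathcal L$, in every place where the respective move can be carried out, $$\begin{array}{lll} \{\mathcal L\cup\mathsf c\}=\{\mathcal L\},&\chi(\mathcal L\cup\mathsf c)=\chi(\mathcal L),&\sigma(\mathcal L\cup\mathsf c)=\sigma(\mathcal L);\\[2pt] \{\mathcal L\cup\eta\}=\frac1{\hat d(1)}\{\mathcal L\},&\chi(\mathcal L\cup\eta)=\chi(\mathcal L)+2,&\sigma(\mathcal L\cup\eta)=\sigma(\mathcal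 L);\\[2pt] \{\mathcal L\cup\bigcirc_{-1}\}=\{\mathcal L\}\{\bigcirc_{-1}\},&\chi(\mathcal L\cup\bigcirc_{-1})=\chi(\mathcal L)+1,&\sigma(\mathcal L\cup\bigcirc_{-1})=\sigma(\mathcal L)-1. \end{array}$$ -/

import Mathlib

open CategoryTheory MonoidalCategory CategoryTheory.Limits

noncomputable section

namespace BridgedLinks

/-! ## Semisimple ribbon categories -/

section Category

universe v u w

variable (C : Type u) [Category.{v} C] [MonoidalCategory C] [BraidedCategory C]
  [RightRigidCategory C]

/-- A balancing (twist) of a rigid braided category: a natural automorphism of the identity with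
`θ_{X ⊗ Y} = c_{Y,X} c_{X,Y} (θ_X ⊗ θ_Y)` that is compatible with duality. -/
class Balancing where
  twist : ∀ X : C, X ≅ X
  twist_naturality : ∀ {X Y : C} (f : X ⟶ Y), f ≫ (twist Y).hom = (twist X).hom ≫ f
  twist_tensor : ∀ X Y : C,
    (twist (X ⊗ Y)).hom = (β_ X Y).hom ≫ (β_ Y X).hom ≫ ((twist X).hom ⊗ₘ (twist Y).hom)
  twist_dual : ∀ X : C,
    η_ X Xᘁ ≫ (twist X).hom ▷ Xᘁ = η_ X Xᘁ ≫ X ◁ (twist Xᘁ).hom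

variable {C} [Balancing C]

/-- The coevaluation for the opposite tensor product, `1 → Xᘁ ⊗ X`. -/
def coev' (X : C) : 𝟙_ C ⟶ Xᘁ ⊗ X :=
  η_ X Xᘁ ≫ (β_ X Xᘁ).hom ≫ (Balancing.twist Xᘁ).hom ▷ X

/-- The evaluation for the opposite tensor product, `X ⊗ Xᘁ → 1`. -/
def ev' (X : C) : X ⊗ Xᘁ ⟶ 𝟙_ C :=
  (Balancing.twist X).hom ▷ Xᘁ ≫ (β_ X Xᘁ).hom ≫ ε_ X Xᘁ

/-- The canonical trace `tr_X : End X → End 1`: an annulus coloured by `X` with `f` inserted. -/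
def trace {X : C} (f : X ⟶ X) : 𝟙_ C ⟶ 𝟙_ C :=
  η_ X Xᘁ ≫ f ▷ Xᘁ ≫ ev' X

variable [Abelian C] [Linear ℂ C]

attribute [local instance] Abelian.hasFiniteBiproducts

variable (C) in
/-- A finite set `I` that indexes representatives of the isomorphism classes of irreducible
objects of a semisimple category with `End j = ℂ` for `j` irreducible. The unit object is
irreducible, with index `one`. -/
structure Irreducibles (I : Type w) where
  obj : I → C
  simple : ∀ i, Simple (obj i)
  eq_of_iso : ∀ i j, Nonempty (obj i ≅ obj j) → i = j
  end_scalar : ∀ i (f : obj i ⟶ obj i), ∃ z : ℂ, f = z • 𝟙 (obj i)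
  semisimple : ∀ X : C, ∃ (n : ℕ) (k : Fin n → I), Nonempty (X ≅ ⨁ fun t => obj (k t))
  one : I
  unit_iso : Nonempty (obj one ≅ 𝟙_ C)

/-- The complex number by which an endomorphism of the unit object acts (`End 1 = ℂ`). -/
def scalar (f : 𝟙_ C ⟶ 𝟙_ C) : ℂ :=
  open Classical in if h : ∃ z : ℂ, f = z • 𝟙 (𝟙_ C) then h.choose else 0

/-- The matrix `S i j = tr_{i ⊗ j} (c_{j,i} c_{i,j})`. -/
def Smatrix {I : Type w} (S : Irreducibles C I) (i j : I) : ℂ :=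
  scalar (trace ((β_ (S.obj i) (S.obj j)).hom ≫ (β_ (S.obj j) (S.obj i)).hom))

variable (C) in
/-- For every object `X`, bases `f_α` of `Hom(X, 1)` and `e_α` of `Hom(1, X)` with
`f_α ∘ e_β = δ_{αβ}`. -/
structure DualBases where
  Index : C → Type
  fintype : ∀ X, Fintype (Index X)
  f : ∀ X, Module.Basis (Index X) ℂ (X ⟶ 𝟙_ C)
  e : ∀ X, Module.Basis (Index X) ℂ (𝟙_ C ⟶ X)
  dual_same : ∀ X (α : Index X), e X α ≫ f X α = 𝟙 (𝟙_ C)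
  dual_ne : ∀ X (α β : Index X), α ≠ β → e X β ≫ f X α = 0

attribute [instance] DualBases.fintype

end Category

/-! ## Bridged links in plat position

A diagram is read as a list of horizontal layers. Every strand that crosses a level carries the
name of the ribbon to which it belongs and its direction. -/

/-- A strand at some level: the name of its ribbon, and `true` if the ribbon is directed the way
the diagram is read, `false` if it is directed against it. -/
abbrev Strand := ℕ × Bool

/-- The elementary pieces of a bridged ribbon diagram (with blackboard framing): the two kinds of
crossing, the directed extrema, and the two coupons `(j,+)` and `(j,-)` of the `j`-th pair. At
`(j,+)` the strands `w` enter the coupon; at `(j,-)` they leave it. -/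
inductive Piece
  | cross (positive : Bool) (x y : Strand)
  | cup (a : ℕ) (d : Bool)
  | cap (a : ℕ) (d : Bool)
  | couponIn (j : ℕ) (w : List Strand)
  | couponOut (j : ℕ) (w : List Strand)

/-- The strands at the start of a piece, from left to right. -/
def Piece.src : Piece → List Strand
  | .cross _ x y => [x, y]
  | .cup _ _ => []
  | .cap a d => [(a, d), (a, !d)]
  | .couponIn _ w => w
  | .couponOut _ _ => []

/-- The strands at the end of a piece, from left to right. -/
def Piece.tgt : Piece → List Strand
  | .cross _ x y => [y, x]
  | .cup a d => [(a, d), (a, !d)]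
  | .cap _ _ => []
  | .couponIn _ _ => []
  | .couponOut _ w => w

/-- A layer: one elementary piece, with straight strands to its left and to its right. -/
structure Layer where
  left : List Strand
  piece : Piece
  right : List Strand

def Layer.src (x : Layer) : List Strand := x.left ++ (x.piece.src ++ x.right)

def Layer.tgt (x : Layer) : List Strand := x.left ++ (x.piece.tgt ++ x.right)

/-- The layers can be stacked, starting from the strands `s` and ending in the strands `t`. -/
def IsTangle : List Strand → List Layer → List Strand → Prop
  | s, [], t => s = t
  | s, x :: l, t => s = x.src ∧ IsTangle x.tgt l t

/-- A diagram in a disjoint union of `r` three-spheres. -/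
abbrev Diagram (r : ℕ) := Fin r → List Layer

variable {r : ℕ}

def Diagram.layers (L : Diagram r) : List Layer := (List.ofFn L).flatten

/-- The names of the ribbons of a diagram. -/
def Diagram.ribbons (L : Diagram r) : Finset ℕ :=
  (L.layers.flatMap fun x => (x.src ++ x.tgt).map Prod.fst).toFinset

/-- The coupons `(j,+)` of a diagram, with the strands that enter them. -/
def Diagram.couponsIn (L : Diagram r) : List (ℕ × List Strand) :=
  L.layers.filterMap fun x => match x.piece with
    | .couponIn j w => some (j, w)
    | _ => none

/-- The coupons `(j,-)` of a diagram, with the strands that leave them. -/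
def Diagram.couponsOut (L : Diagram r) : List (ℕ × List Strand) :=
  L.layers.filterMap fun x => match x.piece with
    | .couponOut j w => some (j, w)
    | _ => none

/-- A point of the diagram: the `k`-th strand at level `t` in the sphere `ω`, or the point at which
the `k`-th strand passes from the coupon `(j,+)` to the coupon `(j,-)`. -/
inductive Site (r : ℕ)
  | strand (ω : Fin r) (t k : ℕ)
  | port (j k : ℕ)

/-- Two points that are the two ends of one strand of a layer, or of one passage to a coupon. -/
inductive Diagram.Adj (L : Diagram r) : Site r → Site r → Prop
  | left {ω : Fin r} {t k : ℕ} {x : Layer} : (L ω)[t]? = some x → k < x.left.length →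
      Adj L (.strand ω t k) (.strand ω (t + 1) k)
  | right {ω : Fin r} {t k : ℕ} {x : Layer} : (L ω)[t]? = some x → k < x.right.length →
      Adj L (.strand ω t (x.left.length + x.piece.src.length + k))
        (.strand ω (t + 1) (x.left.length + x.piece.tgt.length + k))
  | cross_first {ω : Fin r} {t : ℕ} {u v : List Strand} {p : Bool} {y z : Strand} :
      (L ω)[t]? = some ⟨u, .cross p y z, v⟩ →
      Adj L (.strand ω t u.length) (.strand ω (t + 1) (u.length + 1))
  | cross_second {ω : Fin r} {t : ℕ} {u v : List Strand} {p : Bool} {y z : Strand} :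
      (L ω)[t]? = some ⟨u, .cross p y z, v⟩ →
      Adj L (.strand ω t (u.length + 1)) (.strand ω (t + 1) u.length)
  | cup {ω : Fin r} {t : ℕ} {u v : List Strand} {a : ℕ} {d : Bool} :
      (L ω)[t]? = some ⟨u, .cup a d, v⟩ →
      Adj L (.strand ω (t + 1) u.length) (.strand ω (t + 1) (u.length + 1))
  | cap {ω : Fin r} {t : ℕ} {u v : List Strand} {a : ℕ} {d : Bool} :
      (L ω)[t]? = some ⟨u, .cap a d, v⟩ →
      Adj L (.strand ω t u.length) (.strand ω t (u.length + 1))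
  | couponIn {ω : Fin r} {t k j : ℕ} {u v w : List Strand} :
      (L ω)[t]? = some ⟨u, .couponIn j w, v⟩ → k < w.length →
      Adj L (.strand ω t (u.length + k)) (.port j k)
  | couponOut {ω : Fin r} {t k j : ℕ} {u v w : List Strand} :
      (L ω)[t]? = some ⟨u, .couponOut j w, v⟩ → k < w.length →
      Adj L (.strand ω (t + 1) (u.length + k)) (.port j k)

/-- The strand at a point, if there is one. -/
def Diagram.strandAt (L : Diagram r) (ω : Fin r) (t k : ℕ) : Option Strand :=
  (L ω)[t]?.bind fun x => x.src[k]?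

/-- A diagram presents a closed, directed bridged link whose ribbons carry distinct names. -/
structure Diagram.IsBridgedLink (L : Diagram r) : Prop where
  /-- In every sphere the layers compose to a diagram without free ends. -/
  closed : ∀ ω, IsTangle [] (L ω) []
  /-- Every coupon `(j,+)` has exactly one partner `(j,-)`, with the same strands. -/
  paired : L.couponsIn.Perm L.couponsOut
  distinct : (L.couponsIn.map Prod.fst).Nodup
  /-- Strands with the same name belong to the same component. -/
  connected : ∀ (ω ω' : Fin r) (t k t' k' a : ℕ) (d d' : Bool),
    L.strandAt ω t k = some (a, d) → L.strandAt ω' t' k' = some (a, d') →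
      Relation.EqvGen L.Adj (.strand ω t k) (.strand ω' t' k')

/-! ## Euler number and signature -/

/-- The coupon pairs, that is, the one-handles. -/
def Diagram.coupons (L : Diagram r) : Finset (ℕ × List Strand) := L.couponsIn.toFinset

/-- `χ = dim C₂ - dim C₁ + dim C₀`. -/
def Diagram.eulerNumber (L : Diagram r) : ℤ := (L.ribbons.card : ℤ) - L.coupons.card + r

/-- How often, counted with direction, the ribbon `a` occurs among the strands `w` that pass
through a coupon pair. -/
def passages (w : List Strand) (a : ℕ) : ℤ :=
  (w.map fun x => if x.1 = a then (if x.2 then 1 else -1) else 0).sum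

/-- The kernel of the boundary operator `C₂ → C₁` (with real coefficients). -/
def Diagram.cycles (L : Diagram r) : Submodule ℝ (L.ribbons → ℝ) where
  carrier := {x | ∀ c ∈ L.coupons, ∑ a : L.ribbons, (passages c.2 a.1 : ℝ) * x a = 0}
  add_mem' := by
    intro x y hx hy c hc
    simp only [Pi.add_apply, mul_add, Finset.sum_add_distrib]
    rw [hx c hc, hy c hc, add_zero]
  zero_mem' := by intro c _; simp
  smul_mem' := by
    intro z x hx c hc
    simp only [Pi.smul_apply, smul_eq_mul, mul_left_comm _ z, ← Finset.mul_sum]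
    rw [hx c hc, mul_zero]

/-- The contribution of a layer to the linking number of the ribbons `a` and `b`, and for `a = b`
to the framing number: half the signed number of crossings, each crossing counted both as
`(a, b)` and as `(b, a)`. A crossing of strands in the same direction has the sign of the piece,
one of strands in opposite directions the opposite sign. -/
def Layer.linking (x : Layer) (a b : ℕ) : ℝ :=
  match x.piece with
  | .cross p y z =>
      (if p then 1 else -1) * (if y.2 = z.2 then 1 else -1) *
        ((if y.1 = a ∧ z.1 = b then 1 else 0) + (if y.1 = b ∧ z.1 = a then 1 else 0)) / 2
  | _ => 0

/-- The linking matrix, with the (blackboard) framing numbers on the diagonal. -/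
def Diagram.linkingMatrix (L : Diagram r) : Matrix L.ribbons L.ribbons ℝ :=
  Matrix.of fun a b => (L.layers.map fun x => x.linking a b).sum

/-- The linking form on the cycles. -/
def Diagram.linkingForm (L : Diagram r) : QuadraticForm ℝ L.cycles :=
  QuadraticMap.restrict L.linkingMatrix.toQuadraticForm' L.cycles

/-- The signature of the linking form on the cycles. -/
def Diagram.signature (L : Diagram r) : ℤ :=
  (_root_.sigPos L.linkingForm : ℤ) - _root_.sigNeg L.linkingForm

/-! ## The functional `{ }` -/

section Functional

universe v u w

variable {C : Type u} [Category.{v} C] [MonoidalCategory C] [BraidedCategory C]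
  [RightRigidCategory C] [Balancing C] [Abelian C] [Linear ℂ C]
  {I : Type w} (S : Irreducibles C I)

/-- The object of a strand whose ribbon is coloured by `col`. -/
def strandObj (col : ℕ → I) (x : Strand) : C :=
  if x.2 then S.obj (col x.1) else (S.obj (col x.1))ᘁ

/-- The tensor product of the objects of a row of strands. -/
def rowObj (col : ℕ → I) : List Strand → C
  | [] => 𝟙_ C
  | x :: s => strandObj S col x ⊗ rowObj col s

/-- The canonical isomorphism that takes a row of strands apart. -/
def rowAppend (col : ℕ → I) :
    ∀ s t : List Strand, rowObj S col (s ++ t) ≅ rowObj S col s ⊗ rowObj S col t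
  | [], t => (λ_ (rowObj S col t)).symm
  | x :: s, t => whiskerLeftIso (strandObj S col x) (rowAppend col s t) ≪≫
      (α_ (strandObj S col x) (rowObj S col s) (rowObj S col t)).symm

/-- `1 → x ⊗ y` for the strands `x = (a, d)`, `y = (a, !d)` that leave an extremum. -/
def cupHom (col : ℕ → I) (a : ℕ) :
    ∀ d : Bool, 𝟙_ C ⟶ strandObj S col (a, d) ⊗ strandObj S col (a, !d)
  | true => η_ (S.obj (col a)) (S.obj (col a))ᘁ
  | false => coev' (S.obj (col a))

/-- `x ⊗ y → 1` for the strands `x = (a, d)`, `y = (a, !d)` that meet in an extremum. -/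
def capHom (col : ℕ → I) (a : ℕ) :
    ∀ d : Bool, strandObj S col (a, d) ⊗ strandObj S col (a, !d) ⟶ 𝟙_ C
  | true => ev' (S.obj (col a))
  | false => ε_ (S.obj (col a)) (S.obj (col a))ᘁ

/-- The braid isomorphism of a crossing. -/
def crossHom (X Y : C) : Bool → (X ⊗ Y ⟶ Y ⊗ X)
  | true => (β_ X Y).hom
  | false => (β_ Y X).inv

/-- The morphism of an elementary piece, where `f` and `e` are the morphisms inserted in the
coupons. -/
def pieceHom (col : ℕ → I) (f : ∀ c : ℕ × List Strand, rowObj S col c.2 ⟶ 𝟙_ C)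
    (e : ∀ c : ℕ × List Strand, 𝟙_ C ⟶ rowObj S col c.2) :
    ∀ p : Piece, rowObj S col p.src ⟶ rowObj S col p.tgt
  | .cross p x y =>
      (α_ (strandObj S col x) (strandObj S col y) (𝟙_ C)).inv ≫
        crossHom (strandObj S col x) (strandObj S col y) p ▷ 𝟙_ C ≫
          (α_ (strandObj S col y) (strandObj S col x) (𝟙_ C)).hom
  | .cup a d => cupHom S col a d ≫ strandObj S col (a, d) ◁ (ρ_ (strandObj S col (a, !d))).inv
  | .cap a d => strandObj S col (a, d) ◁ (ρ_ (strandObj S col (a, !d))).hom ≫ capHom S col a d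
  | .couponIn j w => f (j, w)
  | .couponOut j w => e (j, w)

def layerHom (col : ℕ → I) (f : ∀ c : ℕ × List Strand, rowObj S col c.2 ⟶ 𝟙_ C)
    (e : ∀ c : ℕ × List Strand, 𝟙_ C ⟶ rowObj S col c.2) (x : Layer) :
    rowObj S col x.src ⟶ rowObj S col x.tgt :=
  (rowAppend S col x.left (x.piece.src ++ x.right)).hom ≫
    rowObj S col x.left ◁ ((rowAppend S col x.piece.src x.right).hom ≫
      pieceHom S col f e x.piece ▷ rowObj S col x.right ≫
        (rowAppend S col x.piece.tgt x.right).inv) ≫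
      (rowAppend S col x.left (x.piece.tgt ++ x.right)).inv

/-- The composite of the morphisms of a stack of layers (zero if the layers do not fit). -/
def tangleHom (col : ℕ → I) (f : ∀ c : ℕ × List Strand, rowObj S col c.2 ⟶ 𝟙_ C)
    (e : ∀ c : ℕ × List Strand, 𝟙_ C ⟶ rowObj S col c.2) :
    ∀ (s : List Strand) (_ : List Layer) (t : List Strand), rowObj S col s ⟶ rowObj S col t
  | s, [], t => if h : s = t then eqToHom (congrArg (rowObj S col) h) else 0
  | s, x :: l, t =>
      if h : s = x.src then
        eqToHom (congrArg (rowObj S col) h) ≫ layerHom S col f e x ≫ tangleHom col f e x.tgt l t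
      else 0

/-- A colouring of the ribbons of `L`, extended to all names. -/
def Diagram.extend (L : Diagram r) (col : L.ribbons → I) (a : ℕ) : I :=
  if h : a ∈ L.ribbons then col ⟨a, h⟩ else S.one

/-- `f_α` for the coupons `(j,+)` of `L` coloured by `lab`. -/
def Diagram.couponF (B : DualBases C) (L : Diagram r) (col : ℕ → I)
    (lab : ∀ c : L.coupons, B.Index (rowObj S col c.1.2)) (c : ℕ × List Strand) :
    rowObj S col c.2 ⟶ 𝟙_ C :=
  if h : c ∈ L.coupons then B.f _ (lab ⟨c, h⟩) else 0

/-- `e_α` for the coupons `(j,-)` of `L` coloured by `lab`. -/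
def Diagram.couponE (B : DualBases C) (L : Diagram r) (col : ℕ → I)
    (lab : ∀ c : L.coupons, B.Index (rowObj S col c.1.2)) (c : ℕ × List Strand) :
    𝟙_ C ⟶ rowObj S col c.2 :=
  if h : c ∈ L.coupons then B.e _ (lab ⟨c, h⟩) else 0

/-- The number `F(L, C, ω)` of the coloured diagram in the sphere `ω`. -/
def Diagram.evaluate (B : DualBases C) (L : Diagram r) (col : ℕ → I)
    (lab : ∀ c : L.coupons, B.Index (rowObj S col c.1.2)) (ω : Fin r) : ℂ :=
  scalar (tangleHom S col (L.couponF S B col lab) (L.couponE S B col lab) [] (L ω) [])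

/-- `{L} = ∑_C ∏_ω F(L, C, ω) ∏_a d(C(a))` with `d(j) = d̂(j) / d̂(1)`. A coloration `C` consists of
a colour in `I` for every ribbon and of an index in `Λ_X` for every pair of coupons. -/
def Diagram.bracket [Fintype I] (B : DualBases C) (dhat : I → ℂ) (L : Diagram r) : ℂ :=
  ∑ col : L.ribbons → I,
    ∑ lab : (∀ c : L.coupons, B.Index (rowObj S (L.extend S col) c.1.2)),
      (∏ ω, L.evaluate S B (L.extend S col) lab ω) * ∏ a, dhat (col a) / dhat S.one

end Functional

/-! ## The moves -/

/-- An isolated cancellation diagram, placed between the strands `u` and `v`: a pair of coupons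
that are joined by one ribbon `a`. -/
def cancellation (u v : List Strand) (j a : ℕ) (d : Bool) : List Layer :=
  [⟨u, .couponOut j [(a, d)], v⟩, ⟨u, .couponIn j [(a, d)], v⟩]

/-- An isolated unknot `a` with framing number `-1` (the closure of a negative crossing), placed
between the strands `u` and `v`. -/
def negUnknot (u v : List Strand) (a : ℕ) (d : Bool) : List Layer :=
  [⟨u, .cup a d, v⟩,
   ⟨u ++ [(a, d)], .cup a d, (a, !d) :: v⟩,
   ⟨u, .cross false (a, d) (a, d), (a, !d) :: (a, !d) :: v⟩,
   ⟨u ++ [(a, d)], .cap a d, (a, !d) :: v⟩,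
   ⟨u, .cap a d, v⟩]

/-- Two coupons of one pair that face each other: the strands `w` enter the coupon `(j,+)`, and
directly behind it they leave the coupon `(j,-)`. -/
def facingCoupons (u w v : List Strand) (j : ℕ) : List Layer :=
  [⟨u, .couponIn j w, v⟩, ⟨u, .couponOut j w, v⟩]

/-- The strand `x` moves to the right across the strands `w`. -/
def passRight (u : List Strand) (x : Strand) : List Strand → List Strand → List Layer
  | [], _ => []
  | y :: w, v => ⟨u, .cross true x y, w ++ v⟩ :: passRight (u ++ [y]) x w v

/-- The strand `x` moves back to the left across the strands `w`. -/
def passLeft (u : List Strand) (x : Strand) : List Strand → List Strand → List Layer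
  | [], _ => []
  | y :: w, v => passLeft (u ++ [y]) x w v ++ [⟨u, .cross true y x, w ++ v⟩]

/-- The strands `w`, encircled by an unknotted annulus `a` of framing number zero. -/
def encircled (u w v : List Strand) (a : ℕ) (d : Bool) : List Layer :=
  [⟨u, .cup a d, w ++ v⟩] ++ passRight (u ++ [(a, d)]) (a, !d) w v ++
    passLeft (u ++ [(a, d)]) (a, !d) w v ++ [⟨u, .cap a d, w ++ v⟩]

end BridgedLinks

end

open BridgedLinks

/-! Each move changes the diagram inside one sphere. So it suffices to know the morphism of the
inserted layers, how the sum over colours and labels splits off the new ribbon or coupon pair, and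
how the linking form on the cycles changes.

The modification carries the main content. The sum over all colours `i` of annuli around an object
`Z`, weighted by `dhat i`, is a natural endomorphism, so by semisimplicity it is determined on the
irreducible objects `k`. To find the scalar there, close the strand `k` with one crossing. This
closure is the trace of the balancing (`trace_twist`). On `i ⊗ k` it can be computed in two ways: as
the closure of `k` with an annulus `i` inserted (`closedCurl_tensor`), and as θ_i θ_k S_{ik}
(`closedCurl_tensor_obj`). The hypothesis on `dhat` then makes the closure of the weighted annulus
equal to θ_k δ_{k,1}. The closure of `k` alone is nonzero (`closedCurl_ne_zero`), so the weighted
annulus vanishes on `k ≠ 1` and is the identity on `1`. Hence it is the sum of the `f_α ≫ e_α`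
(`sum_annulus`), which is precisely what two facing coupons contribute once their label is summed.
Since the weights of the state sum are `dhat i / dhat S.one`, a factor `1 / dhat S.one` remains. For
the other direction of the annulus the computation is carried over to the dual of `k`.

In a cancellation diagram the coupons of a strand coloured `i` have exactly one label if `i` is the
unit and none otherwise; for the unit both the inserted morphism and the weight are trivial. An
isolated unknot evaluates to a scalar that depends only on its colour (`cupHom_curl_capHom`), so its
colour sum factors out.

For the signature, the unknot adds an orthogonal summand `-t²`, and the cancellation ribbon a
coordinate that the new cycle condition forces to be zero. The annulus adds a coordinate `t` and a
term `t * l x`, where `l` is a nonzero multiple of the boundary component of the removed coupons. If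
`l ≠ 0`, a hyperbolic plane splits off, and in every case the signature is that of the restriction
to `l = 0` (`formSignature_of_pairing`), which is the form on the original cycles. -/

noncomputable section

namespace BridgedLinks

/-! ### Closed curls and encircling annuli in a braided category. -/

section Pairings

universe v u

variable {C : Type u} [Category.{v} C] [MonoidalCategory C]

/-- Every morphism between objects with right duals has a mate. -/
theorem exists_mate {X Y Z W : C} [ExactPairing X Y] [ExactPairing Z W] (f : X ⟶ Z) :
    ∃ j : W ⟶ Y, η_ Z W ≫ Z ◁ j = η_ X Y ≫ f ▷ Y ∧ j ▷ X ≫ ε_ X Y = W ◁ f ≫ ε_ Z W := by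
  let _ : HasRightDual X := ⟨Y⟩
  let _ : HasRightDual Z := ⟨W⟩
  exact ⟨fᘁ, coevaluation_comp_rightAdjointMate f, rightAdjointMate_comp_evaluation f⟩

variable [BraidedCategory C]

/-- The closure of an untwisted strand with one crossing. -/
def closedCurl (X Y : C) [ExactPairing X Y] : 𝟙_ C ⟶ 𝟙_ C :=
  η_ X Y ≫ (β_ Y X).inv ≫ ε_ X Y

/-- The mate of the isomorphism transports one coevaluation to the other; it then slides through the
crossing and is absorbed by the evaluation. In particular the choice of the dual does not matter. -/
theorem closedCurl_eq_of_iso {X Y Z W : C} [ExactPairing X Y] [ExactPairing Z W] (φ : X ≅ Z) :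
    closedCurl X Y = closedCurl Z W := by
  obtain ⟨j, h₁, h₂⟩ := exists_mate (X := X) (Y := Y) (Z := Z) (W := W) φ.hom
  have h₃ : η_ X Y = η_ Z W ≫ Z ◁ j ≫ φ.inv ▷ Y := by
    rw [reassoc_of% h₁, ← comp_whiskerRight, Iso.hom_inv_id, id_whiskerRight, Category.comp_id]
  unfold closedCurl
  rw [h₃]
  simp only [Category.assoc, BraidedCategory.braiding_inv_naturality_left_assoc,
    BraidedCategory.braiding_inv_naturality_right_assoc]
  rw [← whisker_exchange_assoc, h₂, ← MonoidalCategory.whiskerLeft_comp_assoc, Iso.inv_hom_id,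
    MonoidalCategory.whiskerLeft_id, Category.id_comp]

theorem closedCurl_swap (X Y : C) [ExactPairing X Y] :
    @closedCurl _ _ _ _ Y X (BraidedCategory.exactPairing_swap X Y) = closedCurl X Y := by
  change (η_ X Y ≫ (β_ Y X).inv) ≫ (β_ X Y).inv ≫ ((β_ X Y).hom ≫ ε_ X Y) = _
  simp [closedCurl]

/-- The endomorphism of `Z` given by an annulus coloured by `X` that encircles `Z`. -/
def encircle (X Y Z : C) [ExactPairing X Y] : Z ⟶ Z :=
  (λ_ Z).inv ≫ (η_ X Y ≫ (β_ Y X).inv) ▷ Z ≫ (α_ Y X Z).hom ≫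
    Y ◁ ((β_ X Z).hom ≫ (β_ Z X).hom) ≫ (α_ Y X Z).inv ≫ ε_ X Y ▷ Z ≫ (λ_ Z).hom

theorem encircle_naturality (X Y : C) [ExactPairing X Y] {Z W : C} (f : Z ⟶ W) :
    encircle X Y Z ≫ f = f ≫ encircle X Y W := by
  have h : Y ◁ X ◁ f ≫ Y ◁ ((β_ X W).hom ≫ (β_ W X).hom) =
      Y ◁ ((β_ X Z).hom ≫ (β_ Z X).hom) ≫ Y ◁ X ◁ f := by
    simp only [← MonoidalCategory.whiskerLeft_comp]; simp
  unfold encircle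
  simp only [Category.assoc]
  rw [← leftUnitor_naturality, ← whisker_exchange_assoc, ← associator_inv_naturality_right_assoc,
    ← reassoc_of% h, ← associator_naturality_right_assoc, ← whisker_exchange_assoc,
    ← leftUnitor_inv_naturality_assoc]

/-- Naturality of the braiding for the crossing of `X` and `Z`. It produces the order of strands in
which `X` can be slid around `Z` in `closedCurl_tensor`. -/
theorem braiding_tensor_right_inv_eq (V X Z : C) :
    (β_ V (X ⊗ Z)).inv = (β_ Z X).inv ▷ V ≫ (β_ V (Z ⊗ X)).inv ≫ V ◁ (β_ Z X).hom := by
  rw [← BraidedCategory.braiding_inv_naturality_left, ← comp_whiskerRight_assoc]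
  simp

/-- In the closed curl of two parallel strands, the curl of `X` can be contracted until only a ring
around `Z` is left, by isotopy alone. No balancing is involved, so the result holds for any choice
of pairings, including swapped ones. -/
theorem closedCurl_tensor (X Y Z W : C) [ExactPairing X Y] [ExactPairing Z W] :
    closedCurl (X ⊗ Z) (W ⊗ Y) =
      η_ Z W ≫ (β_ W Z).inv ≫ W ◁ encircle X Y Z ≫ ε_ Z W := by
  -- Naturality frees a coevaluation from the strand that crosses it, because the braiding with the
  -- unit object is trivial.
  have h₁ : X ◁ η_ Z W ≫ (β_ (Z ⊗ W) X).inv = (ρ_ X).hom ≫ (λ_ X).inv ≫ η_ Z W ▷ X := by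
    rw [BraidedCategory.braiding_inv_naturality_right]; simp
  have h₂ : Z ◁ (η_ X Y ≫ (β_ Y X).inv) ≫ (β_ (Y ⊗ X) Z).inv =
      (ρ_ Z).hom ≫ (λ_ Z).inv ≫ (η_ X Y ≫ (β_ Y X).inv) ▷ Z := by
    rw [BraidedCategory.braiding_inv_naturality_right]; simp
  calc closedCurl (X ⊗ Z) (W ⊗ Y)
      = η_ X Y ⊗≫ (X ◁ η_ Z W ≫ (β_ (Z ⊗ W) X).inv) ▷ Y ⊗≫ (Z ⊗ W) ◁ (β_ Y X).inv ⊗≫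
          (β_ (W ⊗ Y) Z).inv ▷ X ⊗≫ W ◁ Y ◁ (β_ Z X).hom ⊗≫ ε_ (X ⊗ Z) (W ⊗ Y) := by
        rw [closedCurl, braiding_tensor_right_inv_eq, BraidedCategory.braiding_tensor_right_inv,
          BraidedCategory.braiding_tensor_left_inv W Y X,
          BraidedCategory.braiding_tensor_left_inv Z W X, ExactPairing.tensor_coevaluation]
        monoidal
    _ = η_ X Y ⊗≫ (𝟙_ C ◁ (β_ Y X).inv ≫ η_ Z W ▷ (Y ⊗ X)) ⊗≫
          (β_ (W ⊗ Y) Z).inv ▷ X ⊗≫ W ◁ Y ◁ (β_ Z X).hom ⊗≫ ε_ (X ⊗ Z) (W ⊗ Y) := by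
        rw [h₁, whisker_exchange]; monoidal
    _ = η_ Z W ⊗≫ (β_ W Z).inv ⊗≫ W ◁ (Z ◁ (η_ X Y ≫ (β_ Y X).inv) ≫ (β_ (Y ⊗ X) Z).inv) ⊗≫
          W ◁ Y ◁ ((β_ X Z).hom ≫ (β_ Z X).hom) ⊗≫ ε_ (X ⊗ Z) (W ⊗ Y) := by
        have h₃ : (𝟙_ C ◁ (η_ X Y ≫ (β_ Y X).inv) ≫ η_ Z W ▷ (Y ⊗ X)) ≫ (β_ W Z).inv ▷ (Y ⊗ X) =
            η_ Z W ▷ 𝟙_ C ≫ (β_ W Z).inv ▷ 𝟙_ C ≫ (W ⊗ Z) ◁ (η_ X Y ≫ (β_ Y X).inv) := by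
          rw [whisker_exchange, Category.assoc, whisker_exchange]
        -- Inserting the crossing of `X` with `Z` and its inverse lets `Z` pass the whole pair `Y ⊗
        -- X`; what is left is the double braiding that defines the annulus.
        have h₄ : (β_ (W ⊗ Y) Z).inv ▷ X ⊗≫ W ◁ Y ◁ (β_ Z X).hom =
            𝟙 _ ⊗≫ (β_ W Z).inv ▷ (Y ⊗ X) ⊗≫ W ◁ (β_ (Y ⊗ X) Z).inv ⊗≫
              W ◁ Y ◁ ((β_ X Z).hom ≫ (β_ Z X).hom) := by
          have h₅ : (β_ (Y ⊗ X) Z).inv ≫ (α_ Y X Z).hom ≫ Y ◁ ((β_ X Z).hom ≫ (β_ Z X).hom) =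
              (α_ Z Y X).inv ≫ (β_ Y Z).inv ▷ X ≫ (α_ Y Z X).hom ≫
                Y ◁ (β_ Z X).hom := by
            simp [← MonoidalCategory.whiskerLeft_comp]
          calc _ = 𝟙 _ ⊗≫ (β_ W Z).inv ▷ (Y ⊗ X) ⊗≫ W ◁ ((α_ Z Y X).inv ≫ (β_ Y Z).inv ▷ X ≫
                (α_ Y Z X).hom ≫ Y ◁ (β_ Z X).hom) := by
                rw [BraidedCategory.braiding_tensor_left_inv]; monoidal
            _ = _ := by rw [← h₅]; monoidal
        calc _ = 𝟙 _ ⊗≫ (𝟙_ C ◁ (η_ X Y ≫ (β_ Y X).inv) ≫ η_ Z W ▷ (Y ⊗ X)) ⊗≫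
              ((β_ (W ⊗ Y) Z).inv ▷ X ⊗≫ W ◁ Y ◁ (β_ Z X).hom) ⊗≫ ε_ (X ⊗ Z) (W ⊗ Y) := by
              monoidal
          _ = 𝟙 _ ⊗≫ ((𝟙_ C ◁ (η_ X Y ≫ (β_ Y X).inv) ≫ η_ Z W ▷ (Y ⊗ X)) ≫
                (β_ W Z).inv ▷ (Y ⊗ X)) ⊗≫ W ◁ (β_ (Y ⊗ X) Z).inv ⊗≫
              W ◁ Y ◁ ((β_ X Z).hom ≫ (β_ Z X).hom) ⊗≫ ε_ (X ⊗ Z) (W ⊗ Y) := by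
              rw [h₄]; monoidal
          _ = _ := by rw [h₃]; monoidal
    _ = _ := by
        rw [h₂, ExactPairing.tensor_evaluation, encircle]; monoidal

-- The double braiding of the unit object is trivial, so naturality along the left unitor says that
-- the twist equals its own square; being invertible, it is the identity.
variable (C) in
theorem twist_unit [RightRigidCategory C] [Balancing C] :
    (Balancing.twist (𝟙_ C)).hom = 𝟙 (𝟙_ C) := by
  have h := Balancing.twist_naturality (λ_ (𝟙_ C)).hom
  have h₁ : (β_ (𝟙_ C) (𝟙_ C)).hom ≫ (β_ (𝟙_ C) (𝟙_ C)).hom = 𝟙 _ := by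
    simp [unitors_inv_equal]
  rw [Balancing.twist_tensor, reassoc_of% h₁, MonoidalCategory.tensorHom_def, Category.assoc, leftUnitor_naturality,
    unitors_equal, rightUnitor_naturality_assoc, cancel_epi] at h
  rw [← cancel_epi (Balancing.twist (𝟙_ C)).hom, ← h, Category.comp_id]

section

variable [RightRigidCategory C] [Balancing C]

/-- By naturality along the coevaluation, the double braiding and the two twists on `X ⊗ Xᘁ` cancel
there. Compatibility with duals moves the twist of `Xᘁ` onto `X`, where it then occurs twice. -/
theorem coev_twist_twist (X : C) :
    η_ X Xᘁ ≫ (Balancing.twist X).hom ▷ Xᘁ ≫ (Balancing.twist X).hom ▷ Xᘁ ≫ (β_ X Xᘁ).hom =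
      η_ X Xᘁ ≫ (β_ Xᘁ X).inv := by
  have h := Balancing.twist_naturality (η_ X Xᘁ)
  rw [twist_unit, Category.id_comp, Balancing.twist_tensor, tensorHom_def',
    ← BraidedCategory.braiding_naturality_left_assoc,
    ← BraidedCategory.braiding_naturality_right_assoc,
    ← BraidedCategory.braiding_naturality_right,
    ← BraidedCategory.braiding_naturality_left_assoc,
    ← reassoc_of% (Balancing.twist_dual X)] at h
  rw [← cancel_mono (β_ Xᘁ X).hom]
  simpa using h

/-- One twist is the argument of the trace, the other is part of `ev'`; together they turn the
crossing into its inverse. This links the trace in the definition of `S` to a picture without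
balancing. -/
theorem trace_twist (X : C) : trace (Balancing.twist X).hom = closedCurl X Xᘁ := by
  rw [trace, ev', reassoc_of% coev_twist_twist, closedCurl]

end

/-- A negative curl in a ribbon whose framing can be scaled away. -/
theorem curl_eq [Preadditive C] [Linear ℂ C] [MonoidalPreadditive C] [MonoidalLinear ℂ C]
    (Y Z : C) [ExactPairing Y Z] {m : ℂ}
    (h : (β_ Z Y).hom ≫ (β_ Y Z).hom ≫ ε_ Y Z = m • ε_ Y Z) :
    (ρ_ Y).inv ≫ Y ◁ η_ Y Z ≫ (α_ Y Y Z).inv ≫ (β_ Y Y).inv ▷ Z ≫ (α_ Y Y Z).hom ≫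
      Y ◁ ((β_ Y Z).hom ≫ ε_ Y Z) ≫ (ρ_ Y).hom = m • 𝟙 Y := by
  -- Sliding the strand off the coevaluation replaces its inverse crossing with `Y` by a crossing
  -- with `Z`. After `h` has removed the double crossing at the evaluation, a snake remains.
  have h₁ : Y ◁ η_ Y Z ≫ (α_ Y Y Z).inv ≫ (β_ Y Y).inv ▷ Z ≫ (α_ Y Y Z).hom =
      (ρ_ Y).hom ≫ (λ_ Y).inv ≫ η_ Y Z ▷ Y ≫ (α_ Y Z Y).hom ≫ Y ◁ (β_ Z Y).hom := by
    have h₂ := BraidedCategory.braiding_inv_naturality_right Y (η_ Y Z)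
    rw [BraidedCategory.braiding_tensor_left_inv, braiding_inv_tensorUnit_left,
      Category.assoc] at h₂
    rw [← reassoc_of% h₂]
    simp [← MonoidalCategory.whiskerLeft_comp]
  rw [reassoc_of% h₁]
  rw [← MonoidalCategory.whiskerLeft_comp_assoc, h, MonoidalLinear.whiskerLeft_smul,
    Linear.smul_comp]
  simp

end Pairings

/-! ### Scalars, twists and Hom spaces of irreducible objects. -/

section Semisimple

universe v u w

variable {C : Type u} [Category.{v} C] [MonoidalCategory C] [BraidedCategory C]
  [RightRigidCategory C] [Balancing C] [Abelian C] [Linear ℂ C] {I : Type w}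

set_option linter.unusedSectionVars false

attribute [local instance] Abelian.hasFiniteBiproducts

namespace Irreducibles

variable (S : Irreducibles C I)

theorem simple_unit (S : Irreducibles C I) : Simple (𝟙_ C) :=
  have := S.simple S.one
  Simple.of_iso S.unit_iso.some.symm

theorem id_unit_ne_zero (S : Irreducibles C I) : 𝟙 (𝟙_ C) ≠ 0 :=
  have := S.simple_unit
  id_nonzero _

theorem smul_id_unit_injective (S : Irreducibles C I) : Function.Injective fun z : ℂ => z • 𝟙 (𝟙_ C) :=
  smul_left_injective ℂ S.id_unit_ne_zero

theorem scalar_smul_id (S : Irreducibles C I) (z : ℂ) : scalar (z • 𝟙 (𝟙_ C)) = z := by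
  have h : ∃ y : ℂ, z • 𝟙 (𝟙_ C) = y • 𝟙 (𝟙_ C) := ⟨z, rfl⟩
  rw [scalar, dif_pos h]
  exact (S.smul_id_unit_injective h.choose_spec).symm

theorem scalar_smul_id_eq (S : Irreducibles C I) (f : 𝟙_ C ⟶ 𝟙_ C) : scalar f • 𝟙 (𝟙_ C) = f := by
  let φ := S.unit_iso.some
  obtain ⟨z, hz⟩ := S.end_scalar S.one (φ.hom ≫ f ≫ φ.inv)
  have h : f = z • 𝟙 (𝟙_ C) := by
    have := congrArg (fun g => φ.inv ≫ g ≫ φ.hom) hz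
    simpa using this
  rw [h, S.scalar_smul_id]

theorem scalar_smul (S : Irreducibles C I) (z : ℂ) (f : 𝟙_ C ⟶ 𝟙_ C) : scalar (z • f) = z * scalar f := by
  rw [← S.scalar_smul_id_eq f, smul_smul, S.scalar_smul_id, S.scalar_smul_id]

theorem scalar_add (S : Irreducibles C I) (f g : 𝟙_ C ⟶ 𝟙_ C) : scalar (f + g) = scalar f + scalar g := by
  rw [← S.scalar_smul_id_eq f, ← S.scalar_smul_id_eq g, ← add_smul]
  simp only [S.scalar_smul_id]

theorem hom_unit_eq_zero {k : I} (hk : k ≠ S.one) (f : S.obj k ⟶ 𝟙_ C) : f = 0 := by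
  have := S.simple k
  have := S.simple_unit
  by_contra h
  have := isIso_of_hom_simple h
  exact hk (S.eq_of_iso _ _ ⟨asIso f ≪≫ S.unit_iso.some.symm⟩)

theorem unit_hom_eq_zero {k : I} (hk : k ≠ S.one) (f : 𝟙_ C ⟶ S.obj k) : f = 0 := by
  have := S.simple k
  have := S.simple_unit
  by_contra h
  have := isIso_of_hom_simple h
  exact hk (S.eq_of_iso _ _ ⟨(asIso f).symm ≪≫ S.unit_iso.some.symm⟩)

theorem hom_ext_of_simple {Y Z : C} {f g : Y ⟶ Z} (h : ∀ k (i : S.obj k ⟶ Y), i ≫ f = i ≫ g) :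
    f = g := by
  obtain ⟨n, k, ⟨φ⟩⟩ := S.semisimple Y
  rw [← cancel_epi φ.inv]
  refine biproduct.hom_ext' _ _ fun t => ?_
  simpa using h (k t) (biproduct.ι (fun t => S.obj (k t)) t ≫ φ.inv)

theorem exists_twist (i : I) : ∃ z : ℂ, (Balancing.twist (S.obj i)).hom = z • 𝟙 (S.obj i) :=
  S.end_scalar i _

/-- The scalar by which the balancing acts on an irreducible object. -/
def twistScalar (i : I) : ℂ := (S.exists_twist i).choose

theorem twist_obj (i : I) : (Balancing.twist (S.obj i)).hom = S.twistScalar i • 𝟙 (S.obj i) :=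
  (S.exists_twist i).choose_spec

theorem twistScalar_ne_zero (i : I) : S.twistScalar i ≠ 0 := by
  have := S.simple i
  intro h
  have h₁ := S.twist_obj i
  rw [h, zero_smul] at h₁
  have h₂ := (Balancing.twist (S.obj i)).hom_inv_id
  rw [h₁, zero_comp] at h₂
  exact id_nonzero _ h₂.symm

theorem twistScalar_one : S.twistScalar S.one = 1 := by
  let φ := S.unit_iso.some
  have h := Balancing.twist_naturality φ.hom
  rw [twist_unit, S.twist_obj, Category.comp_id, Linear.smul_comp, Category.id_comp] at h
  have h₁ := congrArg (fun f => φ.inv ≫ f) h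
  simp only [Linear.comp_smul, Iso.inv_hom_id] at h₁
  exact (S.smul_id_unit_injective (by simpa using h₁)).symm

variable [MonoidalPreadditive C] [MonoidalLinear ℂ C]

theorem twist_dual_obj (i : I) :
    η_ (S.obj i) (S.obj i)ᘁ ≫ S.obj i ◁ (Balancing.twist (S.obj i)ᘁ).hom =
      S.twistScalar i • η_ (S.obj i) (S.obj i)ᘁ := by
  rw [← Balancing.twist_dual, S.twist_obj, MonoidalLinear.smul_whiskerRight, Linear.comp_smul,
    id_whiskerRight, Category.comp_id]

theorem coev_braiding (i : I) :
    η_ (S.obj i) (S.obj i)ᘁ ≫ (β_ (S.obj i)ᘁ (S.obj i)).inv =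
      S.twistScalar i ^ 2 • (η_ (S.obj i) (S.obj i)ᘁ ≫ (β_ (S.obj i) (S.obj i)ᘁ).hom) := by
  rw [← coev_twist_twist, S.twist_obj]
  simp [smul_smul, sq]

/-- A twist on an irreducible object is a scalar, so up to that scalar the opposite coevaluation is
the one of the swapped pairing, which is the cup used in `encircle`. -/
theorem coev'_obj (i : I) :
    coev' (S.obj i) = (S.twistScalar i)⁻¹ •
      (η_ (S.obj i) (S.obj i)ᘁ ≫ (β_ (S.obj i)ᘁ (S.obj i)).inv) := by
  rw [coev', S.coev_braiding, ← BraidedCategory.braiding_naturality_right,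
    ← Category.assoc, S.twist_dual_obj, smul_smul, Linear.smul_comp, sq,
    inv_mul_cancel_left₀ (S.twistScalar_ne_zero i)]

theorem ev'_obj (i : I) :
    ev' (S.obj i) = S.twistScalar i •
      ((β_ (S.obj i) (S.obj i)ᘁ).hom ≫ ε_ (S.obj i) (S.obj i)ᘁ) := by
  rw [ev', S.twist_obj, MonoidalLinear.smul_whiskerRight, id_whiskerRight, Linear.smul_comp,
    Category.id_comp]

/-- The closed curl is the trace of the balancing, and on the product of two irreducible objects the
balancing is the double braiding times two scalars. This is where the matrix `S` enters. -/
theorem closedCurl_tensor_obj (i k : I) :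
    closedCurl (S.obj i ⊗ S.obj k) (S.obj i ⊗ S.obj k)ᘁ =
      (S.twistScalar i * S.twistScalar k * Smatrix S i k) • 𝟙 (𝟙_ C) := by
  have h : (Balancing.twist (S.obj i ⊗ S.obj k)).hom = (S.twistScalar i * S.twistScalar k) •
      ((β_ (S.obj i) (S.obj k)).hom ≫ (β_ (S.obj k) (S.obj i)).hom) := by
    rw [Balancing.twist_tensor, S.twist_obj, S.twist_obj, MonoidalCategory.tensorHom_def]
    simp [smul_smul, mul_comm]
  rw [← trace_twist, h, mul_smul _ (Smatrix S i k), Smatrix, S.scalar_smul_id_eq, trace,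
    MonoidalLinear.smul_whiskerRight, Linear.smul_comp, Linear.comp_smul, trace]

/-- Duality identifies these morphisms with endomorphisms of the irreducible object, which are
scalars. -/
theorem evaluation_eq_smul (i : I) (f : (S.obj i)ᘁ ⊗ S.obj i ⟶ 𝟙_ C) :
    ∃ z : ℂ, f = z • ε_ (S.obj i) (S.obj i)ᘁ := by
  let E := tensorLeftHomEquiv (S.obj i) (S.obj i) (S.obj i)ᘁ (𝟙_ C)
  obtain ⟨z, hz⟩ := S.end_scalar i (E f ≫ (ρ_ _).hom)
  refine ⟨z, E.injective ?_⟩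
  rw [← cancel_mono (ρ_ _).hom, hz]
  simp [E, tensorLeftHomEquiv]

/-- Bending the strand turns such a morphism into one from the unit to `S.obj k`, which Schur's
lemma excludes. -/
theorem dual_hom_unit_eq_zero {k : I} (hk : k ≠ S.one) (f : (S.obj k)ᘁ ⟶ 𝟙_ C) : f = 0 := by
  let E := tensorLeftHomEquiv (𝟙_ C) (S.obj k) (S.obj k)ᘁ (𝟙_ C)
  have h : E ((ρ_ _).hom ≫ f) = E 0 := by
    rw [← cancel_mono (ρ_ _).hom, S.unit_hom_eq_zero hk (E ((ρ_ _).hom ≫ f) ≫ (ρ_ _).hom),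
      S.unit_hom_eq_zero hk (E 0 ≫ (ρ_ _).hom)]
  have := E.injective h
  rwa [← cancel_epi (ρ_ _).hom, comp_zero]

theorem unit_hom_dual_eq_zero {k : I} (hk : k ≠ S.one) (f : 𝟙_ C ⟶ (S.obj k)ᘁ) : f = 0 := by
  let E := tensorRightHomEquiv (𝟙_ C) (S.obj k) (S.obj k)ᘁ (𝟙_ C)
  have h : E.symm (f ≫ (λ_ _).inv) = E.symm 0 := by
    rw [← cancel_epi (λ_ _).inv, S.hom_unit_eq_zero hk ((λ_ _).inv ≫ E.symm (f ≫ (λ_ _).inv)),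
      S.hom_unit_eq_zero hk ((λ_ _).inv ≫ E.symm 0)]
  have := E.symm.injective h
  rwa [← cancel_mono (λ_ _).inv, zero_comp]

end Irreducibles

/-! ### Counting labels and splitting off the unit object. -/

namespace DualBases

variable (B : DualBases C)

/-- By linearity it is enough to check the basis vectors `e_β`, where biorthogonality leaves a
single term. -/
theorem comp_projection {Z : C} (g : 𝟙_ C ⟶ Z) :
    g ≫ ∑ α, B.f Z α ≫ B.e Z α = g := by
  have h (β : B.Index Z) : B.e Z β ≫ ∑ α, B.f Z α ≫ B.e Z α = B.e Z β := by
    classical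
    rw [Preadditive.comp_sum, Finset.sum_eq_single β]
    · rw [reassoc_of% B.dual_same Z β]
    · intro α _ hα
      rw [reassoc_of% B.dual_ne Z α β hα, zero_comp]
    · simp
  conv_lhs => rw [← (B.e Z).sum_repr g]
  conv_rhs => rw [← (B.e Z).sum_repr g]
  simp only [Preadditive.sum_comp, Linear.smul_comp, h]

theorem card_index_eq_finrank (Z : C) :
    Fintype.card (B.Index Z) = Module.finrank ℂ (Z ⟶ 𝟙_ C) :=
  (Module.finrank_eq_card_basis (B.f Z)).symm

theorem card_index_of_iso (S : Irreducibles C I) {Z : C} (φ : Z ≅ 𝟙_ C) :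
    Fintype.card (B.Index Z) = 1 := by
  rw [card_index_eq_finrank]
  refine finrank_eq_one φ.hom (fun h => S.id_unit_ne_zero ?_) fun f => ⟨scalar (φ.inv ≫ f), ?_⟩
  · rw [← φ.inv_hom_id, h, comp_zero]
  · rw [← cancel_epi φ.inv, Linear.comp_smul, φ.inv_hom_id, S.scalar_smul_id_eq]

theorem card_index_of_eq_zero {Z : C} (h : ∀ f : Z ⟶ 𝟙_ C, f = 0) :
    Fintype.card (B.Index Z) = 0 := by
  rw [card_index_eq_finrank]
  have : Subsingleton (Z ⟶ 𝟙_ C) := ⟨fun f g => by rw [h f, h g]⟩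
  exact Module.finrank_zero_of_subsingleton

/-- The labels of a coupon are a basis of a Hom space, so Schur's lemma counts them. In the
cancellation move this count selects the unit colour. The factor `𝟙_ C` is the empty tail of a row
with one strand. -/
theorem card_index_obj [DecidableEq I] (S : Irreducibles C I) (i : I) :
    Fintype.card (B.Index (S.obj i ⊗ 𝟙_ C)) = if i = S.one then 1 else 0 := by
  split_ifs with h
  · subst h
    exact B.card_index_of_iso S (ρ_ _ ≪≫ S.unit_iso.some)
  · refine B.card_index_of_eq_zero fun f => ?_
    rw [← cancel_epi (ρ_ _).inv, S.hom_unit_eq_zero h ((ρ_ _).inv ≫ f), comp_zero]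

theorem card_index_dual_obj [MonoidalPreadditive C] [MonoidalLinear ℂ C] [DecidableEq I] (S : Irreducibles C I) (i : I) :
    Fintype.card (B.Index ((S.obj i)ᘁ ⊗ 𝟙_ C)) = if i = S.one then 1 else 0 := by
  split_ifs with h
  · subst h
    exact B.card_index_of_iso S (ρ_ _ ≪≫ rightDualIso (X := S.obj S.one) HasRightDual.exact
      (exactPairingCongrLeft S.unit_iso.some))
  · refine B.card_index_of_eq_zero fun f => ?_
    rw [← cancel_epi (ρ_ _).inv, S.dual_hom_unit_eq_zero h ((ρ_ _).inv ≫ f), comp_zero]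

/-- A nonzero morphism has a nonzero component along some `f_α`, by the expansion of
`comp_projection`; rescaling this `f_α` makes the component equal to one. -/
theorem exists_retraction (B : DualBases C) (S : Irreducibles C I) {Z : C} {g : 𝟙_ C ⟶ Z} (hg : g ≠ 0) :
    ∃ f : Z ⟶ 𝟙_ C, g ≫ f = 𝟙 (𝟙_ C) := by
  have h : ∃ α, g ≫ B.f Z α ≠ 0 := by
    by_contra! h
    refine hg ?_
    rw [← B.comp_projection g, Preadditive.comp_sum]
    exact Finset.sum_eq_zero fun α _ => by rw [reassoc_of% h α, zero_comp]
  obtain ⟨α, hα⟩ := h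
  rw [← S.scalar_smul_id_eq (g ≫ B.f Z α)] at hα
  have hs : scalar (g ≫ B.f Z α) ≠ 0 := fun h => hα (by rw [h, zero_smul])
  refine ⟨(scalar (g ≫ B.f Z α))⁻¹ • B.f Z α, ?_⟩
  rw [Linear.comp_smul]
  nth_rw 2 [← S.scalar_smul_id_eq (g ≫ B.f Z α)]
  rw [smul_smul, inv_mul_cancel₀ hs, one_smul]

end DualBases

/-! ### The weighted annulus is the projection to the unit summands. -/

section Encircling

variable (S : Irreducibles C I) [MonoidalPreadditive C] [MonoidalLinear ℂ C]

/-- Otherwise the snake identity would make the identity of an irreducible object zero. -/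
theorem Irreducibles.coevaluation_ne_zero (i : I) : η_ (S.obj i) (S.obj i)ᘁ ≠ 0 := by
  have := S.simple i
  intro h
  have h₁ := ExactPairing.evaluation_coevaluation (S.obj i) (S.obj i)ᘁ
  rw [h, MonoidalPreadditive.zero_whiskerRight, zero_comp] at h₁
  refine id_nonzero (S.obj i) ?_
  rw [← cancel_epi (λ_ (S.obj i)).hom, ← cancel_mono (ρ_ (S.obj i)).inv]
  simpa using h₁.symm

/-- The coevaluation has a retraction. Since the morphisms `Xᘁ ⊗ X → 1` form a line spanned by the
evaluation, this retraction is a multiple of the inverse crossing followed by the evaluation. If the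
curl vanished, so would the identity of the unit. -/
theorem Irreducibles.closedCurl_ne_zero (B : DualBases C) (i : I) :
    closedCurl (S.obj i) (S.obj i)ᘁ ≠ 0 := by
  obtain ⟨f, hf⟩ := B.exists_retraction S (S.coevaluation_ne_zero i)
  obtain ⟨z, hz⟩ := S.evaluation_eq_smul i ((β_ (S.obj i)ᘁ (S.obj i)).hom ≫ f)
  intro h
  refine S.id_unit_ne_zero ?_
  rw [← hf, show f = z • ((β_ (S.obj i)ᘁ (S.obj i)).inv ≫ ε_ (S.obj i) (S.obj i)ᘁ) by
    rw [← Linear.comp_smul, ← hz, Iso.inv_hom_id_assoc], Linear.comp_smul, ← closedCurl, h,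
    smul_zero]

/-- A natural endomorphism that is the identity on the unit object and vanishes on the other
irreducible objects is the projection to the unit objects. -/
theorem DualBases.eq_projection (B : DualBases C) (Φ : ∀ Z : C, Z ⟶ Z)
    (hΦ : ∀ {Z W : C} (f : Z ⟶ W), Φ Z ≫ f = f ≫ Φ W) (h_one : Φ (𝟙_ C) = 𝟙 (𝟙_ C))
    (h_ne : ∀ k, k ≠ S.one → Φ (S.obj k) = 0) (Z : C) :
    Φ Z = ∑ α, B.f Z α ≫ B.e Z α := by
  refine S.hom_ext_of_simple fun k i => ?_
  -- On a unit summand naturality moves the inclusion past `Φ`, and `comp_projection` does the same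
  -- on the right; on any other summand both sides vanish.
  by_cases hk : k = S.one
  · subst hk
    rw [← cancel_epi S.unit_iso.some.inv]
    have h := B.comp_projection (S.unit_iso.some.inv ≫ i)
    have h₁ := hΦ (S.unit_iso.some.inv ≫ i)
    rw [h_one, Category.id_comp] at h₁
    rw [Category.assoc] at h h₁
    rw [h, ← h₁]
  · rw [← hΦ, h_ne k hk, zero_comp, Preadditive.comp_sum]
    exact (Finset.sum_eq_zero fun α _ => by
      rw [← Category.assoc, S.hom_unit_eq_zero hk (i ≫ B.f Z α), zero_comp]).symm

theorem closedCurl_unit : closedCurl (𝟙_ C) (𝟙_ C) = 𝟙 (𝟙_ C) := by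
  change (ρ_ (𝟙_ C)).inv ≫ (β_ (𝟙_ C) (𝟙_ C)).inv ≫ (ρ_ (𝟙_ C)).hom = _
  simp [unitors_equal]

/-- The closure of an endomorphism along an untwisted strand with one crossing. -/
def curlClosure {Z : C} (W : C) [ExactPairing Z W] (f : Z ⟶ Z) : 𝟙_ C ⟶ 𝟙_ C :=
  η_ Z W ≫ (β_ W Z).inv ≫ W ◁ f ≫ ε_ Z W

theorem curlClosure_zero (Z W : C) [ExactPairing Z W] : curlClosure W (0 : Z ⟶ Z) = 0 := by
  simp [curlClosure]

theorem curlClosure_smul_id (Z W : C) [ExactPairing Z W] (z : ℂ) :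
    curlClosure W (z • 𝟙 Z) = z • closedCurl Z W := by
  simp [curlClosure, closedCurl]

theorem curlClosure_sum (Z W : C) [ExactPairing Z W] [Fintype I] (z : I → ℂ) (f : I → (Z ⟶ Z)) :
    curlClosure W (∑ i, z i • f i) = ∑ i, z i • curlClosure W (f i) := by
  simp [curlClosure, whiskerLeft_sum, Preadditive.comp_sum, Preadditive.sum_comp]

variable [Fintype I] [DecidableEq I] (dhat : I → ℂ)

/-- The weighted sum over all colours of an annulus that encircles `Z`. -/
def weightedRing (Z : C) : Z ⟶ Z :=
  ∑ i, (dhat i * (S.twistScalar i)⁻¹) • encircle (S.obj i) (S.obj i)ᘁ Z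

/-- The same sum for the opposite direction of the annulus. -/
def weightedRing' (Z : C) : Z ⟶ Z :=
  ∑ i, (dhat i * (S.twistScalar i)⁻¹) •
    @encircle _ _ _ _ (S.obj i)ᘁ (S.obj i) Z (BraidedCategory.exactPairing_swap _ _)

/-- `closedCurl_tensor` for each colour, summed. On an irreducible `Z` it turns the unknown scalar
of the ring into a combination of entries of `S`. -/
theorem curlClosure_weightedRing (Z W : C) [ExactPairing Z W] :
    curlClosure W (weightedRing S dhat Z) = ∑ i, (dhat i * (S.twistScalar i)⁻¹) •
      closedCurl (S.obj i ⊗ Z) (W ⊗ (S.obj i)ᘁ) := by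
  rw [weightedRing, curlClosure_sum]
  simp only [closedCurl_tensor]
  rfl

theorem curlClosure_weightedRing' (Z W : C) [ExactPairing Z W] :
    curlClosure W (weightedRing' S dhat Z) = ∑ i, (dhat i * (S.twistScalar i)⁻¹) •
      @closedCurl _ _ _ _ ((S.obj i)ᘁ ⊗ Z) (W ⊗ S.obj i)
        (@ExactPairing.tensor _ _ _ _ _ _ _ (BraidedCategory.exactPairing_swap _ _) _) := by
  rw [weightedRing', curlClosure_sum]
  simp only [closedCurl_tensor]
  rfl

theorem weightedRing_naturality {Z W : C} (f : Z ⟶ W) :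
    weightedRing S dhat Z ≫ f = f ≫ weightedRing S dhat W := by
  simp only [weightedRing, Preadditive.sum_comp, Preadditive.comp_sum, Linear.smul_comp,
    Linear.comp_smul, encircle_naturality]

theorem weightedRing'_naturality {Z W : C} (f : Z ⟶ W) :
    weightedRing' S dhat Z ≫ f = f ≫ weightedRing' S dhat W := by
  simp only [weightedRing', Preadditive.sum_comp, Preadditive.comp_sum, Linear.smul_comp,
    Linear.comp_smul, encircle_naturality]

/-- Endomorphisms of the unit are scalars and its closed curl is one, so nothing is lost by taking
the closure. The inverse twists in the weights cancel those of the closed curls, and the hypothesis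
at `S.one` remains. -/
theorem weightedRing_unit
    (hdhat : ∀ i, ∑ j, dhat j * Smatrix S j i = if i = S.one then 1 else 0) : weightedRing S dhat (𝟙_ C) = 𝟙 (𝟙_ C) := by
  have h := curlClosure_weightedRing S dhat (𝟙_ C) (𝟙_ C)
  have h₁ (i : I) : closedCurl (S.obj i ⊗ 𝟙_ C) (𝟙_ C ⊗ (S.obj i)ᘁ) =
      (S.twistScalar i * Smatrix S i S.one) • 𝟙 (𝟙_ C) := by
    -- The entries of `S` refer to the representative `S.obj S.one`, which is only isomorphic to the
    -- unit object.
    rw [closedCurl_eq_of_iso (Z := S.obj i ⊗ S.obj S.one) (W := (S.obj i ⊗ S.obj S.one)ᘁ)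
      (whiskerLeftIso _ S.unit_iso.some.symm), S.closedCurl_tensor_obj, S.twistScalar_one, mul_one]
  have h₂ (i : I) : dhat i * (S.twistScalar i)⁻¹ * (S.twistScalar i * Smatrix S i S.one) =
      dhat i * Smatrix S i S.one := by
    field_simp [S.twistScalar_ne_zero i]
  rw [← S.scalar_smul_id_eq (weightedRing S dhat (𝟙_ C)), curlClosure_smul_id,
    closedCurl_unit, S.scalar_smul_id_eq] at h
  simp only [h₁, smul_smul, h₂] at h
  rw [h, ← Finset.sum_smul, hdhat, if_pos rfl, one_smul]

/-- Around the unit object an annulus is a plain closed curl. Reversing its direction swaps the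
pairing, to which the closed curl is insensitive. -/
theorem weightedRing'_unit_eq : weightedRing' S dhat (𝟙_ C) = weightedRing S dhat (𝟙_ C) := by
  have h := curlClosure_weightedRing S dhat (𝟙_ C) (𝟙_ C)
  have h' := curlClosure_weightedRing' S dhat (𝟙_ C) (𝟙_ C)
  have h₁ (i : I) : closedCurl (S.obj i ⊗ 𝟙_ C) (𝟙_ C ⊗ (S.obj i)ᘁ) =
      @closedCurl _ _ _ _ ((S.obj i)ᘁ ⊗ 𝟙_ C) (𝟙_ C ⊗ S.obj i)
        (@ExactPairing.tensor _ _ _ _ _ _ _ (BraidedCategory.exactPairing_swap _ _) _) := by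
    let _ : ExactPairing (S.obj i)ᘁ (S.obj i) := BraidedCategory.exactPairing_swap _ _
    rw [closedCurl_eq_of_iso (Z := S.obj i) (W := (S.obj i)ᘁ) (ρ_ _),
      closedCurl_eq_of_iso (Z := (S.obj i)ᘁ) (W := S.obj i) (ρ_ _)]
    exact (closedCurl_swap _ _).symm
  simp only [h₁] at h
  rw [← h', ← S.scalar_smul_id_eq (weightedRing S dhat (𝟙_ C)),
    ← S.scalar_smul_id_eq (weightedRing' S dhat (𝟙_ C)), curlClosure_smul_id,
    curlClosure_smul_id, closedCurl_unit] at h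
  simpa only [S.scalar_smul_id_eq] using h.symm

/-- An endomorphism of an irreducible object is a scalar, and its closure is that scalar times the
nonzero closed curl. -/
theorem eq_zero_of_curlClosure (B : DualBases C) {k : I} (f : S.obj k ⟶ S.obj k)
    (h : curlClosure (S.obj k)ᘁ f = 0) : f = 0 := by
  obtain ⟨z, rfl⟩ := S.end_scalar k f
  rw [curlClosure_smul_id, smul_eq_zero_iff_left (S.closedCurl_ne_zero B k)] at h
  rw [h, zero_smul]

theorem weightedRing_obj (B : DualBases C) {k : I}
    (hdhat : ∀ i, ∑ j, dhat j * Smatrix S j i = if i = S.one then 1 else 0) (hk : k ≠ S.one) : weightedRing S dhat (S.obj k) = 0 := by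
  refine eq_zero_of_curlClosure S B _ ?_
  have h₁ (i : I) : closedCurl (S.obj i ⊗ S.obj k) ((S.obj k)ᘁ ⊗ (S.obj i)ᘁ) =
      (S.twistScalar i * S.twistScalar k * Smatrix S i k) • 𝟙 (𝟙_ C) := by
    rw [closedCurl_eq_of_iso (Z := S.obj i ⊗ S.obj k) (W := (S.obj i ⊗ S.obj k)ᘁ) (Iso.refl _),
      S.closedCurl_tensor_obj]
  have h₂ (i : I) : dhat i * (S.twistScalar i)⁻¹ * (S.twistScalar i * S.twistScalar k *
      Smatrix S i k) = S.twistScalar k * (dhat i * Smatrix S i k) := by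
    field_simp [S.twistScalar_ne_zero i]
  rw [curlClosure_weightedRing]
  simp only [h₁, smul_smul, h₂]
  rw [← Finset.sum_smul, ← Finset.mul_sum, hdhat, if_neg hk, mul_zero, zero_smul]

theorem weightedRing_eq (B : DualBases C)
    (hdhat : ∀ i, ∑ j, dhat j * Smatrix S j i = if i = S.one then 1 else 0) (Z : C) : weightedRing S dhat Z = ∑ α, B.f Z α ≫ B.e Z α :=
  B.eq_projection S _ (weightedRing_naturality S dhat) (weightedRing_unit S dhat hdhat)
    (fun _ hk => weightedRing_obj S dhat B hdhat hk) Z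

/-- Swapping the pairing and braiding the factors turns the dual of `i` around `k` into `i` around
the dual of `k`. So the closure is that of the first ring at the dual of `k`; this ring is already
known to factor through morphisms from the unit to that dual, and these are zero. -/
theorem weightedRing'_obj (B : DualBases C) {k : I}
    (hdhat : ∀ i, ∑ j, dhat j * Smatrix S j i = if i = S.one then 1 else 0) (hk : k ≠ S.one) : weightedRing' S dhat (S.obj k) = 0 := by
  refine eq_zero_of_curlClosure S B _ ?_
  have h₁ (i : I) : @closedCurl _ _ _ _ ((S.obj i)ᘁ ⊗ S.obj k) ((S.obj k)ᘁ ⊗ S.obj i)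
        (@ExactPairing.tensor _ _ _ _ _ _ _ (BraidedCategory.exactPairing_swap _ _) _) =
      @closedCurl _ _ _ _ (S.obj i ⊗ (S.obj k)ᘁ) (S.obj k ⊗ (S.obj i)ᘁ)
        (@ExactPairing.tensor _ _ _ _ _ _ _ _ (BraidedCategory.exactPairing_swap _ _)) := by
    let P := @ExactPairing.tensor _ _ _ (S.obj i)ᘁ (S.obj k) (S.obj i) (S.obj k)ᘁ
      (BraidedCategory.exactPairing_swap _ _) _
    refine (@closedCurl_swap _ _ _ _ _ _ P).symm.trans ?_
    exact @closedCurl_eq_of_iso _ _ _ _ _ _ _ _ (@BraidedCategory.exactPairing_swap _ _ _ _ _ _ P)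
      (@ExactPairing.tensor _ _ _ _ _ _ _ _ (BraidedCategory.exactPairing_swap _ _)) (β_ _ _)
  rw [curlClosure_weightedRing']
  simp only [h₁]
  rw [← @curlClosure_weightedRing _ _ _ _ _ _ _ _ _ S _ _ _ _ dhat (S.obj k)ᘁ (S.obj k)
    (BraidedCategory.exactPairing_swap _ _), weightedRing_eq S dhat B hdhat,
    Finset.sum_eq_zero, curlClosure_zero]
  intro α _
  rw [S.unit_hom_dual_eq_zero hk (B.e _ α), comp_zero]

theorem weightedRing'_eq (B : DualBases C)
    (hdhat : ∀ i, ∑ j, dhat j * Smatrix S j i = if i = S.one then 1 else 0) (Z : C) : weightedRing' S dhat Z = ∑ α, B.f Z α ≫ B.e Z α :=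
  B.eq_projection S _ (weightedRing'_naturality S dhat)
    ((weightedRing'_unit_eq S dhat).trans (weightedRing_unit S dhat hdhat))
    (fun _ hk => weightedRing'_obj S dhat B hdhat hk) Z

end Encircling

end Semisimple

/-! ### Composition and widening of tangles -/

theorem IsTangle.append {s m t : List Strand} {l l' : List Layer} (h : IsTangle s l m)
    (h' : IsTangle m l' t) : IsTangle s (l ++ l') t := by
  induction l generalizing s with
  | nil => subst h; exact h'
  | cons x l ih => exact ⟨h.1, ih h.2⟩

theorem IsTangle.exists_of_append {s t : List Strand} {l l' : List Layer}
    (h : IsTangle s (l ++ l') t) : ∃ m, IsTangle s l m ∧ IsTangle m l' t := by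
  induction l generalizing s with
  | nil => exact ⟨s, rfl, h⟩
  | cons x l ih =>
    obtain ⟨m, h₁, h₂⟩ := ih h.2
    exact ⟨m, ⟨h.1, h₁⟩, h₂⟩

/-- A layer with additional straight strands on its left. -/
def Layer.addLeft (u : List Strand) (x : Layer) : Layer := ⟨u ++ x.left, x.piece, x.right⟩

theorem Layer.addLeft_src (u : List Strand) (x : Layer) : (x.addLeft u).src = u ++ x.src := by
  simp [Layer.addLeft, Layer.src]

theorem Layer.addLeft_tgt (u : List Strand) (x : Layer) : (x.addLeft u).tgt = u ++ x.tgt := by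
  simp [Layer.addLeft, Layer.tgt]

theorem IsTangle.addLeft {s t : List Strand} {l : List Layer} (h : IsTangle s l t)
    (u : List Strand) : IsTangle (u ++ s) (l.map (Layer.addLeft u)) (u ++ t) := by
  induction l generalizing s with
  | nil => exact congrArg _ h
  | cons x l ih =>
    refine ⟨by rw [h.1, Layer.addLeft_src], ?_⟩
    rw [Layer.addLeft_tgt]
    exact ih h.2

/-- Strands to the left of a picture only whisker its morphism. This equation and its analogues for
the other pictures allow them to be evaluated with no strands on the left. -/
theorem cancellation_eq (u v : List Strand) (j a : ℕ) (d : Bool) :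
    cancellation u v j a d = (cancellation [] v j a d).map (Layer.addLeft u) := by
  simp [cancellation, Layer.addLeft]

theorem negUnknot_eq (u v : List Strand) (a : ℕ) (d : Bool) :
    negUnknot u v a d = (negUnknot [] v a d).map (Layer.addLeft u) := by
  simp [negUnknot, Layer.addLeft]

theorem facingCoupons_eq (u w v : List Strand) (j : ℕ) :
    facingCoupons u w v j = (facingCoupons [] w v j).map (Layer.addLeft u) := by
  simp [facingCoupons, Layer.addLeft]

theorem passRight_append (u u' : List Strand) (x : Strand) (w v : List Strand) :
    passRight (u ++ u') x w v = (passRight u' x w v).map (Layer.addLeft u) := by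
  induction w generalizing u' with
  | nil => rfl
  | cons y w ih => simp [passRight, Layer.addLeft, ← ih]

theorem passLeft_append (u u' : List Strand) (x : Strand) (w v : List Strand) :
    passLeft (u ++ u') x w v = (passLeft u' x w v).map (Layer.addLeft u) := by
  induction w generalizing u' with
  | nil => rfl
  | cons y w ih => simp [passLeft, Layer.addLeft, ← ih]

theorem encircled_eq (u w v : List Strand) (a : ℕ) (d : Bool) :
    encircled u w v a d = (encircled [] w v a d).map (Layer.addLeft u) := by
  simp [encircled, passRight_append, passLeft_append, Layer.addLeft]

theorem isTangle_passRight (x : Strand) (w v : List Strand) :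
    IsTangle (x :: (w ++ v)) (passRight [] x w v) (w ++ x :: v) := by
  induction w with
  | nil => exact rfl
  | cons y w ih =>
    refine ⟨rfl, ?_⟩
    have := ih.addLeft [y]
    rwa [← passRight_append] at this

theorem isTangle_passLeft (x : Strand) (w v : List Strand) :
    IsTangle (w ++ x :: v) (passLeft [] x w v) (x :: (w ++ v)) := by
  induction w with
  | nil => exact rfl
  | cons y w ih =>
    have := ih.addLeft [y]
    rw [← passLeft_append] at this
    exact this.append ⟨rfl, rfl⟩

theorem isTangle_encircled (u w v : List Strand) (a : ℕ) (d : Bool) :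
    IsTangle (u ++ (w ++ v)) (encircled u w v a d) (u ++ (w ++ v)) := by
  rw [encircled_eq]
  refine IsTangle.addLeft ?_ u
  have h₁ := (isTangle_passRight (a, !d) w v).addLeft [(a, d)]
  have h₂ := (isTangle_passLeft (a, !d) w v).addLeft [(a, d)]
  rw [← passRight_append] at h₁
  rw [← passLeft_append] at h₂
  have h₀ : IsTangle (w ++ v) [⟨[], .cup a d, w ++ v⟩] ((a, d) :: (a, !d) :: (w ++ v)) := ⟨rfl, rfl⟩
  exact ((h₀.append h₁).append h₂).append ⟨rfl, rfl⟩

theorem isTangle_facingCoupons (u w v : List Strand) (j : ℕ) :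
    IsTangle (u ++ (w ++ v)) (facingCoupons u w v j) (u ++ (w ++ v)) :=
  ⟨rfl, rfl, rfl⟩

theorem isTangle_cancellation (u v : List Strand) (j a : ℕ) (d : Bool) :
    IsTangle (u ++ v) (cancellation u v j a d) (u ++ v) :=
  ⟨rfl, rfl, rfl⟩

theorem isTangle_negUnknot (u v : List Strand) (a : ℕ) (d : Bool) :
    IsTangle (u ++ v) (negUnknot u v a d) (u ++ v) := by
  rw [negUnknot_eq]
  have h : IsTangle v (negUnknot [] v a d) v := ⟨rfl, rfl, rfl, rfl, rfl, rfl⟩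
  exact h.addLeft u

/-! ### Morphisms of the local pictures. -/

section TangleHom

universe v u w

variable {C : Type u} [Category.{v} C] [MonoidalCategory C] [BraidedCategory C]
  [RightRigidCategory C] [Balancing C] [Abelian C] [Linear ℂ C]
  {I : Type w} (S : Irreducibles C I) (col : ℕ → I)

set_option linter.unusedSectionVars false

/-- A morphism of rows with additional straight strands on its left. -/
def whiskerRow {s t : List Strand} (g : rowObj S col s ⟶ rowObj S col t) :
    ∀ u : List Strand, rowObj S col (u ++ s) ⟶ rowObj S col (u ++ t)
  | [] => g
  | x :: u => strandObj S col x ◁ whiskerRow g u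

theorem whiskerRow_id (s u : List Strand) :
    whiskerRow S col (𝟙 (rowObj S col s)) u = 𝟙 _ := by
  induction u with
  | nil => rfl
  | cons x u ih => rw [whiskerRow, ih]; exact MonoidalCategory.whiskerLeft_id _ _

variable (f : ∀ c : ℕ × List Strand, rowObj S col c.2 ⟶ 𝟙_ C)
  (e : ∀ c : ℕ × List Strand, 𝟙_ C ⟶ rowObj S col c.2)

theorem tangleHom_append {s m t : List Strand} {l l' : List Layer} (h : IsTangle s l m) :
    tangleHom S col f e s (l ++ l') t = tangleHom S col f e s l m ≫ tangleHom S col f e m l' t := by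
  induction l generalizing s with
  | nil =>
    obtain rfl : s = m := h
    simp [tangleHom]
  | cons x l ih =>
    obtain ⟨rfl, h⟩ := h
    simp [tangleHom, ih h]

theorem tangleHom_cons (x : Layer) (l : List Layer) (t : List Strand) :
    tangleHom S col f e x.src (x :: l) t =
      layerHom S col f e x ≫ tangleHom S col f e x.tgt l t := by
  simp [tangleHom]

/-- Stated for arbitrary objects, so that the row isomorphisms of a layer with one more strand need
only be unfolded definitionally. -/
theorem whiskerLeft_comp_whiskerLeft (Y L : C) {A A' B B' : C} (a : A ⟶ L ⊗ B) (g : B ⟶ B')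
    (b : L ⊗ B' ⟶ A') :
    (Y ◁ a ≫ (α_ Y L B).inv) ≫ (Y ⊗ L) ◁ g ≫ (α_ Y L B').hom ≫ Y ◁ b = Y ◁ (a ≫ L ◁ g ≫ b) := by
  simp

theorem layerHom_addLeft_singleton (y : Strand) (x : Layer) :
    layerHom S col f e (x.addLeft [y]) = strandObj S col y ◁ layerHom S col f e x :=
  whiskerLeft_comp_whiskerLeft _ _ _ _ _

theorem tangleHom_addLeft_singleton (y : Strand) {s t : List Strand} {l : List Layer}
    (h : IsTangle s l t) :
    tangleHom S col f e (y :: s) (l.map (Layer.addLeft [y])) (y :: t) =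
      strandObj S col y ◁ tangleHom S col f e s l t := by
  induction l generalizing s with
  | nil =>
    obtain rfl : s = t := h
    simp only [List.map_nil, tangleHom, dif_pos, eqToHom_refl]
    exact (MonoidalCategory.whiskerLeft_id _ _).symm
  | cons x l ih =>
    obtain ⟨rfl, h⟩ := h
    refine (tangleHom_cons S col f e (x.addLeft [y]) _ _).trans ?_
    rw [tangleHom_cons, MonoidalCategory.whiskerLeft_comp, ← ih h, layerHom_addLeft_singleton]
    rfl

theorem tangleHom_addLeft {s t : List Strand} {l : List Layer} (h : IsTangle s l t)
    (u : List Strand) :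
    tangleHom S col f e (u ++ s) (l.map (Layer.addLeft u)) (u ++ t) =
      whiskerRow S col (tangleHom S col f e s l t) u := by
  induction u with
  | nil =>
    have h₁ : l.map (Layer.addLeft []) = l := List.map_id l
    rw [h₁]
    rfl
  | cons y u ih =>
    have h₁ : l.map (Layer.addLeft (y :: u)) =
        (l.map (Layer.addLeft u)).map (Layer.addLeft [y]) := by
      rw [List.map_map]; rfl
    rw [h₁, whiskerRow, ← ih]
    exact tangleHom_addLeft_singleton S col f e y (h.addLeft u)

theorem layerHom_nil (p : Piece) (v : List Strand) :
    layerHom S col f e ⟨[], p, v⟩ = (rowAppend S col p.src v).hom ≫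
      pieceHom S col f e p ▷ rowObj S col v ≫ (rowAppend S col p.tgt v).inv := by
  change (λ_ _).inv ≫ 𝟙_ C ◁ (_ ≫ _ ≫ _) ≫ (λ_ _).hom = _
  rw [id_whiskerLeft]
  simp
  rfl

theorem layerHom_cup (a : ℕ) (d : Bool) (v : List Strand) :
    layerHom S col f e ⟨[], .cup a d, v⟩ = (λ_ (rowObj S col v)).inv ≫
      cupHom S col a d ▷ rowObj S col v ≫ (α_ _ _ _).hom := by
  rw [layerHom_nil]
  simp [rowAppend, pieceHom, rowObj, Piece.src, Piece.tgt]
  rfl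

theorem layerHom_cap (a : ℕ) (d : Bool) (v : List Strand) :
    layerHom S col f e ⟨[], .cap a d, v⟩ = (α_ _ _ _).inv ≫
      capHom S col a d ▷ rowObj S col v ≫ (λ_ (rowObj S col v)).hom := by
  rw [layerHom_nil]
  simp [rowAppend, pieceHom, rowObj, Piece.src, Piece.tgt]
  rfl

theorem layerHom_cross (p : Bool) (x y : Strand) (v : List Strand) :
    layerHom S col f e ⟨[], .cross p x y, v⟩ = (α_ _ _ _).inv ≫
      crossHom (strandObj S col x) (strandObj S col y) p ▷ rowObj S col v ≫ (α_ _ _ _).hom := by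
  rw [layerHom_nil]
  simp [rowAppend, pieceHom, rowObj, Piece.src, Piece.tgt]
  rfl

/-- The inductive step for `passRight`: by the hexagon identity the crossing with `Y`, followed by
the one with the rest `W`, is the braiding with `Y ⊗ W`. -/
theorem braiding_slide_right {X Y W V T T' : C} (a : T ⟶ W ⊗ V) (b : W ⊗ (X ⊗ V) ⟶ T') :
    ((α_ X Y T).inv ≫ (β_ X Y).hom ▷ T ≫ (α_ Y X T).hom) ≫
        Y ◁ (X ◁ a ≫ (α_ X W V).inv ≫ (β_ X W).hom ▷ V ≫ (α_ W X V).hom ≫ b) =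
      X ◁ (Y ◁ a ≫ (α_ Y W V).inv) ≫ (α_ X (Y ⊗ W) V).inv ≫ (β_ X (Y ⊗ W)).hom ▷ V ≫
        (α_ (Y ⊗ W) X V).hom ≫ (α_ Y W (X ⊗ V)).hom ≫ Y ◁ b := by
  rw [BraidedCategory.braiding_tensor_right_hom]
  calc _ = 𝟙 _ ⊗≫ ((β_ X Y).hom ▷ T ≫ (Y ⊗ X) ◁ a) ⊗≫ Y ◁ (β_ X W).hom ▷ V ⊗≫ Y ◁ b := by
        monoidal
    _ = _ := by rw [← whisker_exchange]; monoidal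

theorem braiding_slide_left {X Y W V T T' : C} (a : T ⟶ W ⊗ (X ⊗ V)) (b : W ⊗ V ⟶ T') :
    Y ◁ (a ≫ (α_ W X V).inv ≫ (β_ W X).hom ▷ V ≫ (α_ X W V).hom ≫ X ◁ b) ≫
        (α_ Y X T').inv ≫ (β_ Y X).hom ▷ T' ≫ (α_ X Y T').hom =
      (Y ◁ a ≫ (α_ Y W (X ⊗ V)).inv) ≫ (α_ (Y ⊗ W) X V).inv ≫ (β_ (Y ⊗ W) X).hom ▷ V ≫
        (α_ X (Y ⊗ W) V).hom ≫ X ◁ ((α_ Y W V).hom ≫ Y ◁ b) := by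
  rw [BraidedCategory.braiding_tensor_left_hom]
  calc _ = Y ◁ a ⊗≫ Y ◁ (β_ W X).hom ▷ V ⊗≫ ((Y ⊗ X) ◁ b ≫ (β_ Y X).hom ▷ T') ⊗≫ 𝟙 _ := by
        monoidal
    _ = _ := by rw [whisker_exchange]; monoidal

theorem tangleHom_passRight (x : Strand) (w v : List Strand) :
    tangleHom S col f e (x :: (w ++ v)) (passRight [] x w v) (w ++ x :: v) =
      strandObj S col x ◁ (rowAppend S col w v).hom ≫ (α_ _ _ _).inv ≫
        (β_ (strandObj S col x) (rowObj S col w)).hom ▷ rowObj S col v ≫ (α_ _ _ _).hom ≫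
          (rowAppend S col w (x :: v)).inv := by
  induction w with
  | nil =>
    refine (show tangleHom S col f e (x :: v) [] (x :: v) = 𝟙 _ by simp [tangleHom]).trans ?_
    simp [rowAppend, rowObj]
  | cons y w ih =>
    have h := passRight_append [y] [] x w v
    rw [List.append_nil] at h
    refine (tangleHom_cons S col f e ⟨[], .cross true x y, w ++ v⟩ _ _).trans ?_
    rw [List.nil_append, h, layerHom_cross]
    refine (congrArg _ ((tangleHom_addLeft_singleton S col f e y
      (isTangle_passRight x w v)).trans (congrArg _ ih))).trans ?_
    exact braiding_slide_right _ _

theorem tangleHom_singleton (x : Layer) : tangleHom S col f e x.src [x] x.tgt =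
    layerHom S col f e x := by
  simp [tangleHom]

theorem tangleHom_passLeft (x : Strand) (w v : List Strand) :
    tangleHom S col f e (w ++ x :: v) (passLeft [] x w v) (x :: (w ++ v)) =
      (rowAppend S col w (x :: v)).hom ≫ (α_ _ _ _).inv ≫
        (β_ (rowObj S col w) (strandObj S col x)).hom ▷ rowObj S col v ≫ (α_ _ _ _).hom ≫
          strandObj S col x ◁ (rowAppend S col w v).inv := by
  induction w with
  | nil =>
    refine (show tangleHom S col f e (x :: v) [] (x :: v) = 𝟙 _ by simp [tangleHom]).trans ?_
    simp [rowAppend, rowObj]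
  | cons y w ih =>
    have h := passLeft_append [y] [] x w v
    rw [List.append_nil] at h
    rw [passLeft, List.nil_append, h]
    refine (tangleHom_append S col f e ((isTangle_passLeft x w v).addLeft [y])).trans ?_
    refine (congrArg₂ _ ((tangleHom_addLeft_singleton S col f e y
      (isTangle_passLeft x w v)).trans (congrArg _ ih))
      ((tangleHom_singleton S col f e ⟨[], .cross true y x, w ++ v⟩).trans
        (layerHom_cross S col f e true y x (w ++ v)))).trans ?_
    exact braiding_slide_left _ _

/-- An annulus with the given extrema around `Z`. -/
def loop {A X : C} (c : 𝟙_ C ⟶ A ⊗ X) (k : A ⊗ X ⟶ 𝟙_ C) (Z : C) : Z ⟶ Z :=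
  (λ_ Z).inv ≫ c ▷ Z ≫ (α_ A X Z).hom ≫ A ◁ ((β_ X Z).hom ≫ (β_ Z X).hom) ≫
    (α_ A X Z).inv ≫ k ▷ Z ≫ (λ_ Z).hom

/-- The extrema of the annulus commute with the isomorphisms `a` and `b` that separate the encircled
row from the strands on its right; `h` cancels those inserted halfway, where the ring strand turns
back. -/
theorem loop_slide {A X W V T : C} (c : 𝟙_ C ⟶ A ⊗ X) (k : A ⊗ X ⟶ 𝟙_ C) (a : T ⟶ W ⊗ V)
    (b : W ⊗ V ⟶ T) {R : C} (a' : R ⟶ W ⊗ (X ⊗ V)) (b' : W ⊗ (X ⊗ V) ⟶ R) (h : b' ≫ a' = 𝟙 _) :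
    ((λ_ T).inv ≫ c ▷ T ≫ (α_ A X T).hom) ≫
        A ◁ (X ◁ a ≫ (α_ X W V).inv ≫ (β_ X W).hom ▷ V ≫ (α_ W X V).hom ≫ b') ≫
        A ◁ (a' ≫ (α_ W X V).inv ≫ (β_ W X).hom ▷ V ≫ (α_ X W V).hom ≫ X ◁ b) ≫
        (α_ A X T).inv ≫ k ▷ T ≫ (λ_ T).hom =
      a ≫ loop c k W ▷ V ≫ b := by
  calc _ = 𝟙 _ ⊗≫ (c ▷ T ≫ (A ⊗ X) ◁ a) ⊗≫ A ◁ (β_ X W).hom ▷ V ⊗≫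
        A ◁ (b' ≫ a') ⊗≫ A ◁ (β_ W X).hom ▷ V ⊗≫ ((A ⊗ X) ◁ b ≫ k ▷ T) ⊗≫ 𝟙 _ := by
        monoidal
    _ = _ := by rw [← whisker_exchange c a, whisker_exchange k b, h, loop]; monoidal

theorem tangleHom_encircled (w v : List Strand) (a : ℕ) (d : Bool) :
    tangleHom S col f e (w ++ v) (encircled [] w v a d) (w ++ v) =
      (rowAppend S col w v).hom ≫
        loop (cupHom S col a d) (capHom S col a d) (rowObj S col w) ▷ rowObj S col v ≫
          (rowAppend S col w v).inv := by
  have h₁ := passRight_append [(a, d)] [] (a, !d) w v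
  have h₂ := passLeft_append [(a, d)] [] (a, !d) w v
  have h₃ := isTangle_passRight (a, !d) w v
  have h₄ := isTangle_passLeft (a, !d) w v
  rw [List.append_nil] at h₁ h₂
  rw [encircled, List.nil_append, h₁, h₂, List.append_assoc, List.append_assoc,
    List.singleton_append]
  refine (tangleHom_cons S col f e ⟨[], .cup a d, w ++ v⟩ _ _).trans ?_
  refine (congrArg₂ _ (layerHom_cup S col f e a d (w ++ v))
    ((tangleHom_append S col f e (h₃.addLeft [(a, d)])).trans (congrArg₂ _
      ((tangleHom_addLeft_singleton S col f e (a, d) h₃).trans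
        (congrArg _ (tangleHom_passRight S col f e (a, !d) w v)))
      ((tangleHom_append S col f e (h₄.addLeft [(a, d)])).trans (congrArg₂ _
        ((tangleHom_addLeft_singleton S col f e (a, d) h₄).trans
          (congrArg _ (tangleHom_passLeft S col f e (a, !d) w v)))
        ((tangleHom_singleton S col f e ⟨[], .cap a d, w ++ v⟩).trans
          (layerHom_cap S col f e a d (w ++ v)))))))).trans ?_
  exact loop_slide _ _ _ _ _ _ (Iso.inv_hom_id _)

/-- A curl with the given extrema. -/
def curl {A X : C} (c : 𝟙_ C ⟶ A ⊗ X) (k : A ⊗ X ⟶ 𝟙_ C) : A ⟶ A :=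
  (ρ_ A).inv ≫ A ◁ c ≫ (α_ A A X).inv ≫ (β_ A A).inv ▷ X ≫ (α_ A A X).hom ≫ A ◁ k ≫ (ρ_ A).hom

theorem curl_slide {A X V : C} (c : 𝟙_ C ⟶ A ⊗ X) (k : A ⊗ X ⟶ 𝟙_ C) :
    ((λ_ V).inv ≫ c ▷ V ≫ (α_ A X V).hom) ≫
      A ◁ ((λ_ (X ⊗ V)).inv ≫ c ▷ (X ⊗ V) ≫ (α_ A X (X ⊗ V)).hom) ≫
      ((α_ A A (X ⊗ (X ⊗ V))).inv ≫ (β_ A A).inv ▷ (X ⊗ (X ⊗ V)) ≫ (α_ A A (X ⊗ (X ⊗ V))).hom) ≫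
      A ◁ ((α_ A X (X ⊗ V)).inv ≫ k ▷ (X ⊗ V) ≫ (λ_ (X ⊗ V)).hom) ≫
      (α_ A X V).inv ≫ k ▷ V ≫ (λ_ V).hom =
    (λ_ V).inv ≫ (c ≫ curl c k ▷ X ≫ k) ▷ V ≫ (λ_ V).hom := by
  rw [curl]; monoidal

theorem tangleHom_negUnknot (v : List Strand) (a : ℕ) (d : Bool) :
    tangleHom S col f e v (negUnknot [] v a d) v =
      (λ_ (rowObj S col v)).inv ≫ (cupHom S col a d ≫
        curl (cupHom S col a d) (capHom S col a d) ▷ _ ≫ capHom S col a d) ▷ rowObj S col v ≫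
        (λ_ (rowObj S col v)).hom := by
  have h (p : Piece) (v : List Strand) : layerHom S col f e ⟨[(a, d)], p, v⟩ =
      strandObj S col (a, d) ◁ layerHom S col f e ⟨[], p, v⟩ :=
    layerHom_addLeft_singleton S col f e (a, d) ⟨[], p, v⟩
  rw [negUnknot]
  refine (tangleHom_cons S col f e ⟨[], .cup a d, v⟩ _ _).trans ?_
  refine (congrArg₂ _ (layerHom_cup S col f e a d v)
    ((tangleHom_cons S col f e ⟨[(a, d)], .cup a d, (a, !d) :: v⟩ _ _).trans (congrArg₂ _
      ((h _ _).trans (congrArg _ (layerHom_cup S col f e a d ((a, !d) :: v))))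
    ((tangleHom_cons S col f e
        ⟨[], .cross false (a, d) (a, d), (a, !d) :: (a, !d) :: v⟩ _ _).trans (congrArg₂ _
      (layerHom_cross S col f e false (a, d) (a, d) ((a, !d) :: (a, !d) :: v))
    ((tangleHom_cons S col f e ⟨[(a, d)], .cap a d, (a, !d) :: v⟩ _ _).trans (congrArg₂ _
      ((h _ _).trans (congrArg _ (layerHom_cap S col f e a d ((a, !d) :: v))))
    ((tangleHom_singleton S col f e ⟨[], .cap a d, v⟩).trans
      (layerHom_cap S col f e a d v))))))))).trans ?_
  exact curl_slide _ _

end TangleHom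

/-! ### The annulus and the unknot for irreducible colours -/

section Colours

universe v u w

variable {C : Type u} [Category.{v} C] [MonoidalCategory C] [BraidedCategory C]
  [RightRigidCategory C] [Balancing C] [Abelian C] [Linear ℂ C]
  [MonoidalPreadditive C] [MonoidalLinear ℂ C]
  {I : Type w} (S : Irreducibles C I)

set_option linter.unusedSectionVars false

theorem loop_smul_left {A X : C} (c : 𝟙_ C ⟶ A ⊗ X) (k : A ⊗ X ⟶ 𝟙_ C) (z : ℂ) (Z : C) :
    loop (z • c) k Z = z • loop c k Z := by
  simp [loop]

theorem loop_smul_right {A X : C} (c : 𝟙_ C ⟶ A ⊗ X) (k : A ⊗ X ⟶ 𝟙_ C) (z : ℂ) (Z : C) :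
    loop c (z • k) Z = z • loop c k Z := by
  simp [loop]

/-- An annulus coloured by `i` around `Z`, with direction `d`. -/
def annulus (i : I) (d : Bool) (Z : C) : Z ⟶ Z :=
  loop (cupHom S (fun _ => i) 0 d) (capHom S (fun _ => i) 0 d) Z

theorem loop_cupHom_capHom (col : ℕ → I) (a : ℕ) (d : Bool) (Z : C) :
    loop (cupHom S col a d) (capHom S col a d) Z = annulus S (col a) d Z := by
  cases d <;> rfl

theorem coev_braiding_inv (i : I) :
    (η_ (S.obj i) (S.obj i)ᘁ ≫ (β_ (S.obj i)ᘁ (S.obj i)).inv) ≫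
      (β_ (S.obj i) (S.obj i)ᘁ).inv = S.twistScalar i ^ 2 • η_ (S.obj i) (S.obj i)ᘁ := by
  rw [S.coev_braiding, Linear.smul_comp, Category.assoc, Iso.hom_inv_id, Category.comp_id]

theorem annulus_false (i : I) (Z : C) :
    annulus S i false Z = (S.twistScalar i)⁻¹ • encircle (S.obj i) (S.obj i)ᘁ Z := by
  change loop (coev' (S.obj i)) (ε_ (S.obj i) (S.obj i)ᘁ) Z = _
  rw [S.coev'_obj, loop_smul_left]
  rfl

/-- The ring of the swapped pairing has its coevaluation braided twice, which costs the square of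
the twist, while `ev'` contributes one twist. The quotient is the same inverse twist as for the
other direction. -/
theorem annulus_true (i : I) (Z : C) :
    annulus S i true Z = (S.twistScalar i)⁻¹ •
      @encircle _ _ _ _ (S.obj i)ᘁ (S.obj i) Z (BraidedCategory.exactPairing_swap _ _) := by
  change loop (η_ (S.obj i) (S.obj i)ᘁ) (ev' (S.obj i)) Z = _ • loop
    ((η_ (S.obj i) (S.obj i)ᘁ ≫ (β_ (S.obj i)ᘁ (S.obj i)).inv) ≫ (β_ (S.obj i) (S.obj i)ᘁ).inv)
    ((β_ (S.obj i) (S.obj i)ᘁ).hom ≫ ε_ (S.obj i) (S.obj i)ᘁ) Z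
  have h := S.twistScalar_ne_zero i
  rw [coev_braiding_inv, S.ev'_obj, loop_smul_left, loop_smul_right, smul_smul, sq,
    inv_mul_cancel_left₀ h]

/-- The sum over the colours of an annulus cuts the encircled strands. -/
theorem sum_annulus [Fintype I] [DecidableEq I] (B : DualBases C) (dhat : I → ℂ)
    (hdhat : ∀ i, ∑ j, dhat j * Smatrix S j i = if i = S.one then 1 else 0) (d : Bool) (Z : C) :
    ∑ i, dhat i • annulus S i d Z = ∑ α, B.f Z α ≫ B.e Z α := by
  cases d
  · rw [← weightedRing_eq S dhat B hdhat]
    simp only [annulus_false, smul_smul, weightedRing]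
  · rw [← weightedRing'_eq S dhat B hdhat]
    simp only [annulus_true, smul_smul, weightedRing']

/-- The unknot with one crossing has two cups and two caps, so each rescaling factor enters twice.
-/
theorem comp_curl_comp {A X : C} {c c' : 𝟙_ C ⟶ A ⊗ X} {k k' : A ⊗ X ⟶ 𝟙_ C} {y z m : ℂ}
    (hc : c = y • c') (hk : k = z • k') (h : curl c' k' = m • 𝟙 A) :
    c ≫ curl c k ▷ X ≫ k = (y * z * (y * z) * m) • (c' ≫ k') := by
  have h₁ : curl c k = (y * z) • curl c' k' := by
    subst hc hk; simp [curl, smul_smul, mul_comm]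
  rw [h₁, h, hc, hk]
  simp [smul_smul]
  congr 1
  ring

/-- An endomorphism of the dual is determined by its effect on the coevaluation, and there
compatibility with duals gives the scalar of the object itself. -/
theorem twist_dual_eq (i : I) :
    (Balancing.twist (S.obj i)ᘁ).hom = S.twistScalar i • 𝟙 (S.obj i)ᘁ := by
  have h (g : (S.obj i)ᘁ ⟶ (S.obj i)ᘁ) :=
    tensorLeftHomEquiv_symm_coevaluation_comp_whiskerLeft (Y := S.obj i) g
  rw [← cancel_epi (ρ_ _).hom, ← h, ← h, S.twist_dual_obj]
  simp

/-- Naturality of the balancing along the evaluation: on `Xᘁ ⊗ X` the double braiding must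
compensate the two equal twists. -/
theorem braiding_evaluation (i : I) :
    (β_ (S.obj i)ᘁ (S.obj i)).hom ≫ (β_ (S.obj i) (S.obj i)ᘁ).hom ≫ ε_ (S.obj i) (S.obj i)ᘁ =
      ((S.twistScalar i ^ 2)⁻¹ : ℂ) • ε_ (S.obj i) (S.obj i)ᘁ := by
  have h := Balancing.twist_naturality (ε_ (S.obj i) (S.obj i)ᘁ)
  rw [twist_unit, Category.comp_id, Balancing.twist_tensor, twist_dual_eq, S.twist_obj,
    MonoidalCategory.tensorHom_def] at h
  have h₁ : ε_ (S.obj i) (S.obj i)ᘁ = S.twistScalar i ^ 2 • ((β_ (S.obj i)ᘁ (S.obj i)).hom ≫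
      (β_ (S.obj i) (S.obj i)ᘁ).hom ≫ ε_ (S.obj i) (S.obj i)ᘁ) := by
    refine h.trans ?_
    simp [smul_smul, sq]
  conv_rhs => rw [h₁]
  rw [smul_smul, inv_mul_cancel₀ (pow_ne_zero 2 (S.twistScalar_ne_zero i)), one_smul]

/-- The value of an unknot with framing number `-1` and colour `i`. -/
def unknotScalar (i : I) : ℂ :=
  (S.twistScalar i ^ 2)⁻¹ * scalar (closedCurl (S.obj i) (S.obj i)ᘁ)

/-- For either direction, `curl_eq` removes the curl. The extrema differ from those of a pairing and
its swap by powers of the twist; after these are collected both directions give the same scalar. -/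
theorem cupHom_curl_capHom (col : ℕ → I) (a : ℕ) (d : Bool) :
    cupHom S col a d ≫ curl (cupHom S col a d) (capHom S col a d) ▷ _ ≫ capHom S col a d =
      unknotScalar S (col a) • 𝟙 (𝟙_ C) := by
  have h := S.twistScalar_ne_zero (col a)
  have h₁ := braiding_evaluation S (col a)
  have h₂ : scalar (closedCurl (S.obj (col a)) (S.obj (col a))ᘁ) • 𝟙 (𝟙_ C) = _ :=
    S.scalar_smul_id_eq _
  rw [unknotScalar, mul_smul, h₂, closedCurl]
  cases d
  · have hk : ε_ (S.obj (col a)) (S.obj (col a))ᘁ = S.twistScalar (col a) ^ 2 •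
        ((β_ (S.obj (col a))ᘁ (S.obj (col a))).hom ≫
          (β_ (S.obj (col a)) (S.obj (col a))ᘁ).hom ≫ ε_ (S.obj (col a)) (S.obj (col a))ᘁ) := by
      rw [h₁, smul_smul, mul_inv_cancel₀ (pow_ne_zero 2 h), one_smul]
    refine (comp_curl_comp (S.coev'_obj (col a)) hk (@curl_eq _ _ _ _ _ _ _ _ _ _
      (BraidedCategory.exactPairing_swap _ _) ((S.twistScalar (col a) ^ 2)⁻¹) ?_)).trans ?_
    · change _ ≫ _ ≫ _ ≫ _ = _ • (_ ≫ _)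
      rw [h₁, Linear.comp_smul]
    · rw [h₁, Linear.comp_smul, smul_smul]
      congr 1
      · field_simp
      · simp
  · refine (comp_curl_comp (one_smul ℂ _).symm (S.ev'_obj (col a))
      (curl_eq _ _ h₁)).trans ?_
    rw [← Category.assoc (η_ _ _) _ (ε_ _ _), ← Category.assoc (η_ _ _) _ (ε_ _ _),
      S.coev_braiding, Linear.smul_comp, smul_smul]
    congr 1
    field_simp

end Colours

/-! ### Dependence on the colouring -/

section Congruence

universe v u w

variable {C : Type u} [Category.{v} C]

/-- Rows whose ribbons have equal colours have equal objects, but not definitionally. Morphisms for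
two colourings are therefore compared by heterogeneous equality. -/
theorem comp_heq_comp {X X' Y Y' Z Z' : C} (hX : X = X') (hY : Y = Y') (hZ : Z = Z')
    {f : X ⟶ Y} {f' : X' ⟶ Y'} {g : Y ⟶ Z} {g' : Y' ⟶ Z'} (hf : HEq f f') (hg : HEq g g') :
    HEq (f ≫ g) (f' ≫ g') := by
  subst hX hY hZ; rw [eq_of_heq hf, eq_of_heq hg]

variable [MonoidalCategory C]

theorem whiskerLeft_heq {X X' Y Y' Z Z' : C} (hX : X = X') (hY : Y = Y') (hZ : Z = Z')
    {g : Y ⟶ Z} {g' : Y' ⟶ Z'} (hg : HEq g g') : HEq (X ◁ g) (X' ◁ g') := by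
  subst hX hY hZ; rw [eq_of_heq hg]

theorem whiskerRight_heq {X X' Y Y' Z Z' : C} (hX : X = X') (hY : Y = Y') (hZ : Z = Z')
    {g : Y ⟶ Z} {g' : Y' ⟶ Z'} (hg : HEq g g') : HEq (g ▷ X) (g' ▷ X') := by
  subst hX hY hZ; rw [eq_of_heq hg]

theorem rightUnitor_heq {X X' : C} (h : X = X') :
    HEq (ρ_ X).hom (ρ_ X').hom ∧ HEq (ρ_ X).inv (ρ_ X').inv := by
  subst h; exact ⟨HEq.rfl, HEq.rfl⟩

variable [BraidedCategory C] [RightRigidCategory C] [Balancing C] [Abelian C] [Linear ℂ C]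
  {I : Type w} (S : Irreducibles C I) {col col' : ℕ → I}

set_option linter.unusedSectionVars false

theorem strandObj_congr {x : Strand} (h : col x.1 = col' x.1) :
    strandObj S col x = strandObj S col' x := by
  unfold strandObj; rw [h]

theorem rowObj_congr {s : List Strand} (h : ∀ x ∈ s, col x.1 = col' x.1) :
    rowObj S col s = rowObj S col' s := by
  induction s with
  | nil => rfl
  | cons x s ih =>
    rw [rowObj, rowObj, strandObj_congr S (h x (by simp)), ih fun y hy => h y (by simp [hy])]

theorem rowAppend_heq {s t : List Strand} (hs : ∀ x ∈ s, col x.1 = col' x.1)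
    (ht : ∀ x ∈ t, col x.1 = col' x.1) :
    HEq (rowAppend S col s t).hom (rowAppend S col' s t).hom ∧
      HEq (rowAppend S col s t).inv (rowAppend S col' s t).inv := by
  have hT := rowObj_congr S ht
  induction s with
  | nil =>
    simp only [rowAppend, rowObj, List.nil_append, Iso.symm_hom, Iso.symm_inv]
    rw [hT]
    exact ⟨HEq.rfl, HEq.rfl⟩
  | cons x s ih =>
    have hs' : ∀ y ∈ s, col y.1 = col' y.1 := fun y hy => hs y (by simp [hy])
    have hS := rowObj_congr S hs'
    have hX := strandObj_congr S (hs x (by simp))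
    have hST : rowObj S col (s ++ t) = rowObj S col' (s ++ t) :=
      rowObj_congr S fun y hy => (List.mem_append.1 hy).elim (hs' y) (ht y)
    obtain ⟨h₁, h₂⟩ := ih hs'
    simp only [rowAppend, Iso.trans_hom, Iso.trans_inv, Iso.symm_hom, Iso.symm_inv,
      whiskerLeftIso_hom, whiskerLeftIso_inv, rowObj, List.cons_append]
    exact ⟨comp_heq_comp (by rw [hX, hST]) (by rw [hX, hS, hT]) (by rw [hX, hS, hT])
        (whiskerLeft_heq hX hST (by rw [hS, hT]) h₁) (by rw [hX, hS, hT]),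
      comp_heq_comp (by rw [hX, hS, hT]) (by rw [hX, hS, hT]) (by rw [hX, hST])
        (by rw [hX, hS, hT]) (whiskerLeft_heq hX (by rw [hS, hT]) hST h₂)⟩

theorem cupHom_heq {a : ℕ} (d : Bool) (h : col a = col' a) :
    HEq (cupHom S col a d) (cupHom S col' a d) := by
  cases d
  · change HEq (coev' (S.obj (col a))) (coev' (S.obj (col' a)))
    rw [h]
  · change HEq (η_ (S.obj (col a)) (S.obj (col a))ᘁ) (η_ (S.obj (col' a)) (S.obj (col' a))ᘁ)
    rw [h]

theorem capHom_heq {a : ℕ} (d : Bool) (h : col a = col' a) :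
    HEq (capHom S col a d) (capHom S col' a d) := by
  cases d
  · change HEq (ε_ (S.obj (col a)) (S.obj (col a))ᘁ) (ε_ (S.obj (col' a)) (S.obj (col' a))ᘁ)
    rw [h]
  · change HEq (ev' (S.obj (col a))) (ev' (S.obj (col' a)))
    rw [h]

variable {f : ∀ c : ℕ × List Strand, rowObj S col c.2 ⟶ 𝟙_ C}
  {e : ∀ c : ℕ × List Strand, 𝟙_ C ⟶ rowObj S col c.2}
  {f' : ∀ c : ℕ × List Strand, rowObj S col' c.2 ⟶ 𝟙_ C}
  {e' : ∀ c : ℕ × List Strand, 𝟙_ C ⟶ rowObj S col' c.2}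

theorem pieceHom_heq {p : Piece} (h₁ : ∀ x ∈ p.src, col x.1 = col' x.1)
    (h₂ : ∀ x ∈ p.tgt, col x.1 = col' x.1)
    (hf : ∀ j w, p = .couponIn j w → HEq (f (j, w)) (f' (j, w)))
    (he : ∀ j w, p = .couponOut j w → HEq (e (j, w)) (e' (j, w))) :
    HEq (pieceHom S col f e p) (pieceHom S col' f' e' p) := by
  cases p with
  | cross p x y =>
    simp only [pieceHom, Piece.src, Piece.tgt, rowObj]
    rw [strandObj_congr S (h₁ x (by simp [Piece.src])),
      strandObj_congr S (h₁ y (by simp [Piece.src]))]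
  | cup a d =>
    have ha : col a = col' a := h₂ (a, d) (by simp [Piece.tgt])
    have hx := strandObj_congr S (x := (a, d)) ha
    have hy := strandObj_congr S (x := (a, !d)) ha
    exact comp_heq_comp rfl (by rw [hx, hy]) (rowObj_congr S h₂) (cupHom_heq S d ha)
      (whiskerLeft_heq hx hy (congrArg (· ⊗ 𝟙_ C) hy) (rightUnitor_heq hy).2)
  | cap a d =>
    have ha : col a = col' a := h₁ (a, d) (by simp [Piece.src])
    have hx := strandObj_congr S (x := (a, d)) ha
    have hy := strandObj_congr S (x := (a, !d)) ha
    exact comp_heq_comp (rowObj_congr S h₁) (by rw [hx, hy]) rfl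
      (whiskerLeft_heq hx (congrArg (· ⊗ 𝟙_ C) hy) hy (rightUnitor_heq hy).1) (capHom_heq S d ha)
  | couponIn j w => exact hf j w rfl
  | couponOut j w => exact he j w rfl

theorem layerHom_heq {x : Layer} (h₁ : ∀ y ∈ x.src, col y.1 = col' y.1)
    (h₂ : ∀ y ∈ x.tgt, col y.1 = col' y.1)
    (hf : ∀ j w, x.piece = .couponIn j w → HEq (f (j, w)) (f' (j, w)))
    (he : ∀ j w, x.piece = .couponOut j w → HEq (e (j, w)) (e' (j, w))) :
    HEq (layerHom S col f e x) (layerHom S col' f' e' x) := by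
  have hl : ∀ y ∈ x.left, col y.1 = col' y.1 := fun y hy => h₁ y (by simp [Layer.src, hy])
  have hr : ∀ y ∈ x.right, col y.1 = col' y.1 := fun y hy => h₁ y (by simp [Layer.src, hy])
  have hs : ∀ y ∈ x.piece.src, col y.1 = col' y.1 := fun y hy => h₁ y (by simp [Layer.src, hy])
  have ht : ∀ y ∈ x.piece.tgt, col y.1 = col' y.1 := fun y hy => h₂ y (by simp [Layer.tgt, hy])
  have hsr : ∀ y ∈ x.piece.src ++ x.right, col y.1 = col' y.1 :=
    fun y hy => (List.mem_append.1 hy).elim (hs y) (hr y)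
  have htr : ∀ y ∈ x.piece.tgt ++ x.right, col y.1 = col' y.1 :=
    fun y hy => (List.mem_append.1 hy).elim (ht y) (hr y)
  have el := rowObj_congr S hl
  have er := rowObj_congr S hr
  have es := rowObj_congr S hs
  have et := rowObj_congr S ht
  have esr := rowObj_congr S hsr
  have etr := rowObj_congr S htr
  have es' := rowObj_congr S h₁
  have et' := rowObj_congr S h₂
  refine comp_heq_comp es' (by rw [el, esr]) et' (rowAppend_heq S hl hsr).1
    (comp_heq_comp (by rw [el, esr]) (by rw [el, etr]) et' (whiskerLeft_heq el esr etr
      (comp_heq_comp esr (by rw [es, er]) etr (rowAppend_heq S hs hr).1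
        (comp_heq_comp (by rw [es, er]) (by rw [et, er]) etr
          (whiskerRight_heq er es et (pieceHom_heq S hs ht hf he)) (rowAppend_heq S ht hr).2)))
      (rowAppend_heq S hl htr).2)

theorem eqToHom_heq_eqToHom {X X' Y Y' : C} (hX : X = X') (h : X = Y) (h' : X' = Y') :
    HEq (eqToHom h) (eqToHom h') := by
  subst hX h h'; rfl

theorem tangleHom_heq {s t : List Strand} {l : List Layer}
    (hs : ∀ y ∈ s, col y.1 = col' y.1) (ht : ∀ y ∈ t, col y.1 = col' y.1)
    (hl : ∀ x ∈ l, ∀ y ∈ x.src ++ x.tgt, col y.1 = col' y.1)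
    (hf : ∀ x ∈ l, ∀ j w, x.piece = .couponIn j w → HEq (f (j, w)) (f' (j, w)))
    (he : ∀ x ∈ l, ∀ j w, x.piece = .couponOut j w → HEq (e (j, w)) (e' (j, w))) :
    HEq (tangleHom S col f e s l t) (tangleHom S col' f' e' s l t) := by
  have es := rowObj_congr S hs
  have et := rowObj_congr S ht
  have hzero : HEq (0 : rowObj S col s ⟶ rowObj S col t)
      (0 : rowObj S col' s ⟶ rowObj S col' t) := by rw [es, et]
  induction l generalizing s with
  | nil =>
    simp only [tangleHom]
    split_ifs
    · exact eqToHom_heq_eqToHom es _ _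
    · exact hzero
  | cons x l ih =>
    simp only [tangleHom]
    split_ifs with h
    · have h₁ : ∀ y ∈ x.src, col y.1 = col' y.1 := fun y hy => hl x (by simp) y (by simp [hy])
      have h₂ : ∀ y ∈ x.tgt, col y.1 = col' y.1 := fun y hy => hl x (by simp) y (by simp [hy])
      have e₁ := rowObj_congr S h₁
      have e₂ := rowObj_congr S h₂
      refine comp_heq_comp es e₁ et (eqToHom_heq_eqToHom es _ _) (comp_heq_comp e₁ e₂ et
        (layerHom_heq S h₁ h₂ (hf x (by simp)) (he x (by simp))) (ih h₂
          (fun z hz => hl z (by simp [hz])) (fun z hz => hf z (by simp [hz]))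
          (fun z hz => he z (by simp [hz])) e₂ (by rw [e₂, et])))
    · exact hzero

theorem whiskerRow_heq {s t u : List Strand} (hs : ∀ y ∈ s, col y.1 = col' y.1)
    (ht : ∀ y ∈ t, col y.1 = col' y.1) (hu : ∀ y ∈ u, col y.1 = col' y.1)
    {g : rowObj S col s ⟶ rowObj S col t} {g' : rowObj S col' s ⟶ rowObj S col' t}
    (hg : HEq g g') : HEq (whiskerRow S col g u) (whiskerRow S col' g' u) := by
  induction u with
  | nil => exact hg
  | cons x u ih =>
    have hu' : ∀ y ∈ u, col y.1 = col' y.1 := fun y hy => hu y (by simp [hy])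
    exact whiskerLeft_heq (strandObj_congr S (hu x (by simp)))
      (rowObj_congr S fun y hy => (List.mem_append.1 hy).elim (hu' y) (hs y))
      (rowObj_congr S fun y hy => (List.mem_append.1 hy).elim (hu' y) (ht y)) (ih hu')

end Congruence

/-! ### State sums -/

section PiInsert

variable {ι : Type*} [DecidableEq ι] (T : ι → Type*) {a : ι} {s : Finset ι}

/-- A family on `insert a s` is a value at `a` and a family on `s`. -/
def piInsertEquiv (ha : a ∉ s) : (T a × ∀ c : s, T c) ≃ ∀ c : ↥(insert a s), T c where
  toFun p c := if h : c.1 = a then cast (congrArg T h.symm) p.1 else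
    p.2 ⟨c.1, (Finset.mem_insert.1 c.2).resolve_left h⟩
  invFun q := (q ⟨a, Finset.mem_insert_self a s⟩, fun c => q ⟨c.1, Finset.mem_insert_of_mem c.2⟩)
  left_inv p := by
    refine Prod.ext (by simp) (funext fun c => ?_)
    have h : c.1 ≠ a := fun h => ha (h ▸ c.2)
    simp [h]
  right_inv q := by
    funext c
    obtain ⟨c, hc⟩ := c
    by_cases h : c = a
    · subst h; simp
    · simp [h]

theorem piInsertEquiv_self (ha : a ∉ s) (p : T a × ∀ c : s, T c)
    (h : a ∈ insert a s) : piInsertEquiv T ha p ⟨a, h⟩ = p.1 := by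
  simp [piInsertEquiv]

theorem piInsertEquiv_of_mem (ha : a ∉ s) (p : T a × ∀ c : s, T c) {c : ι} (hc : c ∈ s)
    (h : c ∈ insert a s) : piInsertEquiv T ha p ⟨c, h⟩ = p.2 ⟨c, hc⟩ := by
  have h' : c ≠ a := fun h => ha (h ▸ hc)
  simp [piInsertEquiv, h']

end PiInsert

section StateSum

universe v u w

variable {C : Type u} [Category.{v} C] [MonoidalCategory C] [BraidedCategory C]
  [RightRigidCategory C] [Balancing C] [Abelian C] [Linear ℂ C]
  {I : Type w} (S : Irreducibles C I) (B : DualBases C)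

set_option linter.unusedSectionVars false

/-- The morphisms in the coupons `(j,+)` for a labelling of the coupon pairs. -/
def labelF (K : Finset (ℕ × List Strand)) (col : ℕ → I)
    (lab : ∀ c : K, B.Index (rowObj S col c.1.2)) (c : ℕ × List Strand) :
    rowObj S col c.2 ⟶ 𝟙_ C :=
  if h : c ∈ K then B.f _ (lab ⟨c, h⟩) else 0

/-- The morphisms in the coupons `(j,-)` for a labelling of the coupon pairs. -/
def labelE (K : Finset (ℕ × List Strand)) (col : ℕ → I)
    (lab : ∀ c : K, B.Index (rowObj S col c.1.2)) (c : ℕ × List Strand) :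
    𝟙_ C ⟶ rowObj S col c.2 :=
  if h : c ∈ K then B.e _ (lab ⟨c, h⟩) else 0

/-- A number that depends on a colouring and on morphisms in the coupons. -/
abbrev Valuation :=
  ∀ col : ℕ → I, (∀ c : ℕ × List Strand, rowObj S col c.2 ⟶ 𝟙_ C) →
    (∀ c : ℕ × List Strand, 𝟙_ C ⟶ rowObj S col c.2) → ℂ

/-- The valuation depends only on the colours of the ribbons in `R` and on the coupons in `K`. -/
def IsLocal (R : Finset ℕ) (K : Finset (ℕ × List Strand)) (val : Valuation S) : Prop :=
  ∀ col col' f f' e e', (∀ a ∈ R, col a = col' a) → (∀ c ∈ K, HEq (f c) (f' c)) →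
    (∀ c ∈ K, HEq (e c) (e' c)) → val col f e = val col' f' e'

/-- The sum of a valuation over all labels of the coupon pairs. -/
def stateSum (K : Finset (ℕ × List Strand)) (val : Valuation S) (col : ℕ → I) : ℂ :=
  ∑ lab : (∀ c : K, B.Index (rowObj S col c.1.2)),
    val col (labelF S B K col lab) (labelE S B K col lab)

variable {S B}

theorem basis_heq {X Y : C} (h : X = Y) (α : B.Index X) :
    HEq (B.f X α) (B.f Y (cast (congrArg B.Index h) α)) ∧
      HEq (B.e X α) (B.e Y (cast (congrArg B.Index h) α)) := by
  subst h; exact ⟨HEq.rfl, HEq.rfl⟩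

/-- Equal row objects have the same labels, so a cast matches the two index sets and carries the
basis vectors along. -/
theorem IsLocal.stateSum_congr {R : Finset ℕ} {K : Finset (ℕ × List Strand)} {val : Valuation S}
    (h : IsLocal S R K val) (hK : ∀ c ∈ K, ∀ x ∈ c.2, x.1 ∈ R) {col col' : ℕ → I}
    (hcol : ∀ a ∈ R, col a = col' a) : stateSum S B K val col = stateSum S B K val col' := by
  have hobj (c : ℕ × List Strand) (hc : c ∈ K) : rowObj S col c.2 = rowObj S col' c.2 :=
    rowObj_congr S fun x hx => hcol _ (hK c hc x hx)
  refine Fintype.sum_equiv (Equiv.piCongrRight fun c : K =>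
    Equiv.cast (congrArg B.Index (hobj c.1 c.2))) _ _ fun lab => ?_
  refine h _ _ _ _ _ _ hcol (fun c hc => ?_) fun c hc => ?_
  · rw [labelF, dif_pos hc, labelF, dif_pos hc]
    exact (basis_heq (hobj c hc) _).1
  · rw [labelE, dif_pos hc, labelE, dif_pos hc]
    exact (basis_heq (hobj c hc) _).2

theorem stateSum_insert {K : Finset (ℕ × List Strand)} {c₀ : ℕ × List Strand} (hc₀ : c₀ ∉ K)
    (val : Valuation S) (col : ℕ → I) :
    stateSum S B (insert c₀ K) val col =
      ∑ α : B.Index (rowObj S col c₀.2), ∑ lab : (∀ c : K, B.Index (rowObj S col c.1.2)),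
        val col (Function.update (labelF S B K col lab) c₀ (B.f _ α))
          (Function.update (labelE S B K col lab) c₀ (B.e _ α)) := by
  rw [← Fintype.sum_prod_type']
  refine (Fintype.sum_equiv (piInsertEquiv (fun c : ℕ × List Strand =>
    B.Index (rowObj S col c.2)) hc₀) _ _ fun p => ?_).symm
  congr 1
  · funext c
    by_cases h : c = c₀
    · subst h
      rw [Function.update_self, labelF, dif_pos (Finset.mem_insert_self c K), piInsertEquiv_self]
    · rw [Function.update_of_ne h, labelF, labelF]
      by_cases hc : c ∈ K
      · rw [dif_pos hc, dif_pos (Finset.mem_insert_of_mem hc), piInsertEquiv_of_mem _ _ _ hc]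
      · rw [dif_neg hc, dif_neg (by simp [h, hc])]
  · funext c
    by_cases h : c = c₀
    · subst h
      rw [Function.update_self, labelE, dif_pos (Finset.mem_insert_self c K), piInsertEquiv_self]
    · rw [Function.update_of_ne h, labelE, labelE]
      by_cases hc : c ∈ K
      · rw [dif_pos hc, dif_pos (Finset.mem_insert_of_mem hc), piInsertEquiv_of_mem _ _ _ hc]
      · rw [dif_neg hc, dif_neg (by simp [h, hc])]

theorem IsLocal.update {R : Finset ℕ} {K : Finset (ℕ × List Strand)} {val : Valuation S}
    (h : IsLocal S R K val) {c₀ : ℕ × List Strand} (hc₀ : c₀ ∉ K) {col : ℕ → I}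
    (f : ∀ c : ℕ × List Strand, rowObj S col c.2 ⟶ 𝟙_ C)
    (e : ∀ c : ℕ × List Strand, 𝟙_ C ⟶ rowObj S col c.2)
    (f₀ : rowObj S col c₀.2 ⟶ 𝟙_ C) (e₀ : 𝟙_ C ⟶ rowObj S col c₀.2) :
    val col (Function.update f c₀ f₀) (Function.update e c₀ e₀) = val col f e := by
  have hne (c : ℕ × List Strand) (hc : c ∈ K) : c ≠ c₀ := fun h => hc₀ (h ▸ hc)
  refine h _ _ _ _ _ _ (fun _ _ => rfl) (fun c hc => ?_) fun c hc => ?_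
  · rw [Function.update_of_ne (hne c hc)]
  · rw [Function.update_of_ne (hne c hc)]

variable (S B)

/-- A colouring of the ribbons in `R`, extended to all names. -/
def extendColour (R : Finset ℕ) (col : R → I) (a : ℕ) : I :=
  if h : a ∈ R then col ⟨a, h⟩ else S.one

/-- The weighted sum of a valuation over all colours of the ribbons in `R` and all labels of the
coupon pairs in `K`. -/
def colourSum [Fintype I] (R : Finset ℕ) (K : Finset (ℕ × List Strand)) (val : Valuation S)
    (weight : I → ℂ) : ℂ :=
  ∑ col : R → I, stateSum S B K val (extendColour S R col) * ∏ a, weight (col a)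

theorem prod_extendColour (R : Finset ℕ) (col : R → I) (weight : I → ℂ) :
    ∏ a, weight (col a) = ∏ a ∈ R, weight (extendColour S R col a) := by
  rw [← Finset.prod_coe_sort R]
  exact Finset.prod_congr rfl fun a _ => by simp [extendColour]

theorem extendColour_insert {R : Finset ℕ} {a : ℕ} (ha : a ∉ R) (p : I × (R → I)) :
    extendColour S (insert a R) (piInsertEquiv (fun _ => I) ha p) =
      Function.update (extendColour S R p.2) a p.1 := by
  funext b
  by_cases h : b = a
  · subst h
    rw [Function.update_self, extendColour, dif_pos (Finset.mem_insert_self b R),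
      piInsertEquiv_self]
  · rw [Function.update_of_ne h, extendColour, extendColour]
    by_cases hb : b ∈ R
    · rw [dif_pos hb, dif_pos (Finset.mem_insert_of_mem hb), piInsertEquiv_of_mem _ _ _ hb]
    · rw [dif_neg hb, dif_neg (by simp [h, hb])]

/-- Reduces a move to an identity for each fixed colouring of the old ribbons, in which only the
colour of the new ribbon is summed. The coupon sets may differ on the two sides, as the modification
requires. -/
theorem colourSum_insert [Fintype I] {R : Finset ℕ} {K K' : Finset (ℕ × List Strand)}
    {val val' : Valuation S} {weight : I → ℂ} {a : ℕ} (ha : a ∉ R) {z : ℂ}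
    (h : ∀ col : ℕ → I, ∑ i, weight i * stateSum S B K' val' (Function.update col a i) =
      z * stateSum S B K val col) :
    colourSum S B (insert a R) K' val' weight = z * colourSum S B R K val weight := by
  rw [colourSum, colourSum, Finset.mul_sum]
  rw [← Fintype.sum_equiv (piInsertEquiv (fun _ => I) ha) _ _ fun p => rfl,
    Fintype.sum_prod_type_right]
  refine Finset.sum_congr rfl fun col _ => ?_
  rw [← mul_assoc, ← h, Finset.sum_mul]
  refine Finset.sum_congr rfl fun i _ => ?_
  have h₁ : ∏ b ∈ R, weight (Function.update (extendColour S R col) a i b) =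
      ∏ b ∈ R, weight (extendColour S R col b) :=
    Finset.prod_congr rfl fun b hb => by
      rw [Function.update_of_ne (show b ≠ a from fun h => ha (h ▸ hb))]
  rw [prod_extendColour S (insert a R), extendColour_insert, Finset.prod_insert ha,
    Function.update_self, prod_extendColour S R, h₁]
  ring

/-- The product over the spheres of the numbers `F(L, C, ω)`. -/
def Diagram.valuation {r : ℕ} (L : Diagram r) : Valuation S :=
  fun col f e => ∏ ω, scalar (tangleHom S col f e [] (L ω) [])

theorem Diagram.bracket_eq_colourSum [Fintype I] {r : ℕ} (L : Diagram r) (dhat : I → ℂ) :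
    L.bracket S B dhat = colourSum S B L.ribbons L.coupons (L.valuation S)
      fun i => dhat i / dhat S.one := by
  rw [Diagram.bracket, colourSum]
  refine Finset.sum_congr rfl fun col _ => ?_
  rw [stateSum, Finset.sum_mul]
  rfl

/-- The layers `l` involve only ribbons in `R` and coupon pairs in `K`. -/
def SupportedOn (R : Finset ℕ) (K : Finset (ℕ × List Strand)) (l : List Layer) : Prop :=
  ∀ x ∈ l, (∀ y ∈ x.src ++ x.tgt, y.1 ∈ R) ∧
    ∀ j w, x.piece = .couponIn j w ∨ x.piece = .couponOut j w → (j, w) ∈ K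

variable {S}

theorem SupportedOn.tangleHom_heq {R : Finset ℕ} {K : Finset (ℕ × List Strand)} {l : List Layer}
    (h : SupportedOn R K l) {s t : List Strand} (hs : ∀ x ∈ s, x.1 ∈ R) (ht : ∀ x ∈ t, x.1 ∈ R)
    {col col' : ℕ → I} {f : ∀ c : ℕ × List Strand, rowObj S col c.2 ⟶ 𝟙_ C}
    {e : ∀ c : ℕ × List Strand, 𝟙_ C ⟶ rowObj S col c.2}
    {f' : ∀ c : ℕ × List Strand, rowObj S col' c.2 ⟶ 𝟙_ C}
    {e' : ∀ c : ℕ × List Strand, 𝟙_ C ⟶ rowObj S col' c.2}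
    (hcol : ∀ a ∈ R, col a = col' a) (hf : ∀ c ∈ K, HEq (f c) (f' c))
    (he : ∀ c ∈ K, HEq (e c) (e' c)) :
    HEq (tangleHom S col f e s l t) (tangleHom S col' f' e' s l t) :=
  BridgedLinks.tangleHom_heq S (fun y hy => hcol _ (hs y hy)) (fun y hy => hcol _ (ht y hy))
    (fun x hx y hy => hcol _ ((h x hx).1 y hy))
    (fun x hx j w hj => hf _ ((h x hx).2 j w (Or.inl hj)))
    (fun x hx j w hj => he _ ((h x hx).2 j w (Or.inr hj)))

theorem isLocal_prod_scalar {r : ℕ} (L : Diagram r) (s : Finset (Fin r)) {R : Finset ℕ}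
    {K : Finset (ℕ × List Strand)} (h : ∀ ω ∈ s, SupportedOn R K (L ω)) :
    IsLocal S R K fun col f e => ∏ ω ∈ s, scalar (tangleHom S col f e [] (L ω) []) :=
  fun _ _ _ _ _ _ hcol hf he => Finset.prod_congr rfl fun ω hω =>
    congrArg scalar (eq_of_heq ((h ω hω).tangleHom_heq (by simp) (by simp) hcol hf he))

end StateSum

/-! ### The effect of the moves on the tangle morphisms -/

section Moves

universe v u w

variable {C : Type u} [Category.{v} C] [MonoidalCategory C] [BraidedCategory C]
  [RightRigidCategory C] [Balancing C] [Abelian C] [Linear ℂ C]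
  [MonoidalPreadditive C] [MonoidalLinear ℂ C]
  {I : Type w} (S : Irreducibles C I)

set_option linter.unusedSectionVars false

section Tangles

variable (col : ℕ → I)

theorem whiskerRow_smul {s t : List Strand} (z : ℂ) (g : rowObj S col s ⟶ rowObj S col t)
    (u : List Strand) : whiskerRow S col (z • g) u = z • whiskerRow S col g u := by
  induction u with
  | nil => rfl
  | cons x u ih => rw [whiskerRow, ih, MonoidalLinear.whiskerLeft_smul]; rfl

theorem whiskerRow_add {s t : List Strand} (g h : rowObj S col s ⟶ rowObj S col t)
    (u : List Strand) : whiskerRow S col (g + h) u = whiskerRow S col g u + whiskerRow S col h u := by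
  induction u with
  | nil => rfl
  | cons x u ih => rw [whiskerRow, ih, MonoidalPreadditive.whiskerLeft_add]; rfl

variable (f : ∀ c : ℕ × List Strand, rowObj S col c.2 ⟶ 𝟙_ C)
  (e : ∀ c : ℕ × List Strand, 𝟙_ C ⟶ rowObj S col c.2)

theorem tangleHom_insert_of_eq {s m t : List Strand} {l₁ l l₂ : List Layer}
    (h₁ : IsTangle s l₁ m) (h : IsTangle m l m) {g : rowObj S col m ⟶ rowObj S col m}
    (hg : tangleHom S col f e m l m = g) :
    tangleHom S col f e s (l₁ ++ l ++ l₂) t =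
      tangleHom S col f e s l₁ m ≫ g ≫ tangleHom S col f e m l₂ t := by
  rw [List.append_assoc, tangleHom_append S col f e h₁, tangleHom_append S col f e h, hg]

theorem tangleHom_insert_smul {s m t : List Strand} {l₁ l l₂ : List Layer}
    (h₁ : IsTangle s l₁ m) (h : IsTangle m l m) {z : ℂ}
    (hg : tangleHom S col f e m l m = z • 𝟙 _) :
    tangleHom S col f e s (l₁ ++ l ++ l₂) t = z • tangleHom S col f e s (l₁ ++ l₂) t := by
  rw [tangleHom_insert_of_eq S col f e h₁ h hg, tangleHom_append S col f e h₁]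
  simp

theorem tangleHom_negUnknot_eq_smul (u v : List Strand) (a : ℕ) (d : Bool) :
    tangleHom S col f e (u ++ v) (negUnknot u v a d) (u ++ v) =
      unknotScalar S (col a) • 𝟙 _ := by
  have h : IsTangle v (negUnknot [] v a d) v := isTangle_negUnknot [] v a d
  rw [negUnknot_eq, tangleHom_addLeft S col f e h, tangleHom_negUnknot, cupHom_curl_capHom]
  rw [MonoidalLinear.smul_whiskerRight, Linear.smul_comp, Linear.comp_smul, whiskerRow_smul,
    id_whiskerRight, Category.id_comp, Iso.inv_hom_id, whiskerRow_id]

theorem whiskerRight_comp_of_eq_id {W X Y : C} (i : W ≅ X ⊗ Y) (e : 𝟙_ C ⟶ X) (f : X ⟶ 𝟙_ C)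
    (h : e ≫ f = 𝟙 _) :
    ((λ_ Y).inv ≫ e ▷ Y ≫ i.inv) ≫ i.hom ≫ f ▷ Y ≫ (λ_ Y).hom = 𝟙 Y := by
  simp only [Category.assoc, Iso.inv_hom_id_assoc]
  rw [← comp_whiskerRight_assoc, h]
  simp

theorem comp_unitors_comp {W X Y : C} (i : W ≅ X ⊗ Y) (f : X ⟶ 𝟙_ C) (e : 𝟙_ C ⟶ X) :
    (i.hom ≫ f ▷ Y ≫ (λ_ Y).hom) ≫ (λ_ Y).inv ≫ e ▷ Y ≫ i.inv =
      i.hom ≫ (f ≫ e) ▷ Y ≫ i.inv := by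
  simp

theorem layerHom_couponIn (j : ℕ) (w v : List Strand) :
    layerHom S col f e ⟨[], .couponIn j w, v⟩ = (rowAppend S col w v).hom ≫
      f (j, w) ▷ rowObj S col v ≫ (λ_ (rowObj S col v)).hom :=
  layerHom_nil S col f e (.couponIn j w) v

theorem layerHom_couponOut (j : ℕ) (w v : List Strand) :
    layerHom S col f e ⟨[], .couponOut j w, v⟩ = (λ_ (rowObj S col v)).inv ≫
      e (j, w) ▷ rowObj S col v ≫ (rowAppend S col w v).inv :=
  layerHom_nil S col f e (.couponOut j w) v

theorem tangleHom_cancellation (u v : List Strand) (j a : ℕ) (d : Bool)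
    (h : e (j, [(a, d)]) ≫ f (j, [(a, d)]) = 𝟙 _) :
    tangleHom S col f e (u ++ v) (cancellation u v j a d) (u ++ v) = 𝟙 _ := by
  have h₁ : IsTangle v (cancellation [] v j a d) v := isTangle_cancellation [] v j a d
  rw [cancellation_eq, tangleHom_addLeft S col f e h₁, cancellation]
  have h₂ := tangleHom_cons S col f e ⟨[], .couponOut j [(a, d)], v⟩
    [⟨[], .couponIn j [(a, d)], v⟩] v
  have h₃ := tangleHom_singleton S col f e ⟨[], .couponIn j [(a, d)], v⟩
  rw [← whiskerRow_id]
  congr 1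
  refine h₂.trans ((congrArg₂ (fun A B => A ≫ B) (layerHom_couponOut S col f e j [(a, d)] v)
    (h₃.trans (layerHom_couponIn S col f e j [(a, d)] v))).trans ?_)
  exact whiskerRight_comp_of_eq_id (rowAppend S col [(a, d)] v) _ _ h

/-- The endomorphism `g` of the row `w` between straight strands `u` and `v`. -/
def insertRow (u w v : List Strand) (g : rowObj S col w ⟶ rowObj S col w) :
    rowObj S col (u ++ (w ++ v)) ⟶ rowObj S col (u ++ (w ++ v)) :=
  whiskerRow S col ((rowAppend S col w v).hom ≫ g ▷ rowObj S col v ≫ (rowAppend S col w v).inv) u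

theorem insertRow_smul (u w v : List Strand) (z : ℂ) (g : rowObj S col w ⟶ rowObj S col w) :
    insertRow S col u w v (z • g) = z • insertRow S col u w v g := by
  rw [insertRow, MonoidalLinear.smul_whiskerRight, Linear.smul_comp, Linear.comp_smul,
    whiskerRow_smul]
  rfl

theorem insertRow_add (u w v : List Strand) (g h : rowObj S col w ⟶ rowObj S col w) :
    insertRow S col u w v (g + h) = insertRow S col u w v g + insertRow S col u w v h := by
  rw [insertRow, MonoidalPreadditive.add_whiskerRight, Preadditive.add_comp, Preadditive.comp_add,
    whiskerRow_add]
  rfl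

theorem tangleHom_facingCoupons (u w v : List Strand) (j : ℕ) :
    tangleHom S col f e (u ++ (w ++ v)) (facingCoupons u w v j) (u ++ (w ++ v)) =
      insertRow S col u w v (f (j, w) ≫ e (j, w)) := by
  have h₁ : IsTangle (w ++ v) (facingCoupons [] w v j) (w ++ v) := isTangle_facingCoupons [] w v j
  rw [facingCoupons_eq, tangleHom_addLeft S col f e h₁, facingCoupons, insertRow]
  have h₂ := tangleHom_cons S col f e ⟨[], .couponIn j w, v⟩ [⟨[], .couponOut j w, v⟩] (w ++ v)
  have h₃ := tangleHom_singleton S col f e ⟨[], .couponOut j w, v⟩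
  congr 1
  refine h₂.trans ((congrArg₂ (fun A B => A ≫ B) (layerHom_couponIn S col f e j w v)
    (h₃.trans (layerHom_couponOut S col f e j w v))).trans ?_)
  exact comp_unitors_comp (rowAppend S col w v) (f (j, w)) (e (j, w))

theorem tangleHom_encircled_eq (u w v : List Strand) (a : ℕ) (d : Bool) :
    tangleHom S col f e (u ++ (w ++ v)) (encircled u w v a d) (u ++ (w ++ v)) =
      insertRow S col u w v (annulus S (col a) d (rowObj S col w)) := by
  have h₁ : IsTangle (w ++ v) (encircled [] w v a d) (w ++ v) := isTangle_encircled [] w v a d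
  rw [encircled_eq, tangleHom_addLeft S col f e h₁, tangleHom_encircled, loop_cupHom_capHom]
  rfl

end Tangles

theorem insertRow_heq {col col' : ℕ → I} {u w v : List Strand}
    (hu : ∀ x ∈ u, col x.1 = col' x.1) (hw : ∀ x ∈ w, col x.1 = col' x.1)
    (hv : ∀ x ∈ v, col x.1 = col' x.1) {g : rowObj S col w ⟶ rowObj S col w}
    {g' : rowObj S col' w ⟶ rowObj S col' w} (hg : HEq g g') :
    HEq (insertRow S col u w v g) (insertRow S col' u w v g') := by
  have hwv : ∀ x ∈ w ++ v, col x.1 = col' x.1 :=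
    fun x hx => (List.mem_append.1 hx).elim (hw x) (hv x)
  have ew := rowObj_congr S hw
  have ev := rowObj_congr S hv
  have ewv := rowObj_congr S hwv
  exact whiskerRow_heq S hwv hwv hu (comp_heq_comp ewv (by rw [ew, ev]) ewv
    (rowAppend_heq S hw hv).1 (comp_heq_comp (by rw [ew, ev]) (by rw [ew, ev]) ewv
      (whiskerRight_heq ev ew ew hg) (rowAppend_heq S hw hv).2))

/-! ### The effect of the moves on the functional -/

variable {r : ℕ} (L : Diagram r) (ω : Fin r)

theorem Diagram.valuation_eq (l : List Layer) (hl : L ω = l) (col : ℕ → I)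
    (f : ∀ c : ℕ × List Strand, rowObj S col c.2 ⟶ 𝟙_ C)
    (e : ∀ c : ℕ × List Strand, 𝟙_ C ⟶ rowObj S col c.2) :
    L.valuation S col f e = scalar (tangleHom S col f e [] l []) *
      ∏ ω' ∈ Finset.univ.erase ω, scalar (tangleHom S col f e [] (L ω') []) := by
  subst hl
  exact (Finset.mul_prod_erase _ _ (Finset.mem_univ ω)).symm

theorem Diagram.valuation_update (l : List Layer) (col : ℕ → I)
    (f : ∀ c : ℕ × List Strand, rowObj S col c.2 ⟶ 𝟙_ C)
    (e : ∀ c : ℕ × List Strand, 𝟙_ C ⟶ rowObj S col c.2) :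
    Diagram.valuation S (Function.update L ω l) col f e = scalar (tangleHom S col f e [] l []) *
      ∏ ω' ∈ Finset.univ.erase ω, scalar (tangleHom S col f e [] (L ω') []) := by
  rw [Diagram.valuation_eq S (Function.update L ω l) ω l (Function.update_self ω l L)]
  congr 1
  exact Finset.prod_congr rfl fun ω' hω' => by
    rw [Function.update_of_ne (Finset.ne_of_mem_erase hω')]

variable [Fintype I] [DecidableEq I] (B : DualBases C) (dhat : I → ℂ)
  {L ω} {R : Finset ℕ} {K : Finset (ℕ × List Strand)}

theorem isLocal_valuation (hL : ∀ ω, SupportedOn R K (L ω)) : IsLocal S R K (L.valuation S) :=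
  isLocal_prod_scalar L Finset.univ fun ω _ => hL ω

theorem agree_update {a : ℕ} (ha : a ∉ R) (col : ℕ → I) (i : I) :
    ∀ b ∈ R, Function.update col a i b = col b :=
  fun b hb => Function.update_of_ne (show b ≠ a from fun h => ha (h ▸ hb)) _ _

theorem card_index_singleton (col : ℕ → I) (a : ℕ) (d : Bool) :
    Fintype.card (B.Index (rowObj S col [(a, d)])) = if col a = S.one then 1 else 0 := by
  cases d
  · exact B.card_index_dual_obj S (col a)
  · exact B.card_index_obj S (col a)

theorem colourSum_cancellation (hL : ∀ ω, SupportedOn R K (L ω))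
    (hK : ∀ c ∈ K, ∀ x ∈ c.2, x.1 ∈ R) {weight : I → ℂ} (h_one : weight S.one = 1)
    {T₁ T₂ : List Layer} {u v : List Strand} {j a : ℕ} {d : Bool}
    (hT : L ω = T₁ ++ T₂) (hT₁ : IsTangle [] T₁ (u ++ v)) (hj : (j, [(a, d)]) ∉ K) (ha : a ∉ R) :
    colourSum S B (insert a R) (insert (j, [(a, d)]) K)
        (Diagram.valuation S (Function.update L ω (T₁ ++ cancellation u v j a d ++ T₂))) weight =
      colourSum S B R K (L.valuation S) weight := by
  have hloc := isLocal_valuation S hL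
  refine (colourSum_insert S B ha (z := 1) fun col => ?_).trans (one_mul _)
  have h (i : I) : stateSum S B (insert (j, [(a, d)]) K)
      (Diagram.valuation S (Function.update L ω (T₁ ++ cancellation u v j a d ++ T₂)))
      (Function.update col a i) =
      (if i = S.one then 1 else 0) * stateSum S B K (L.valuation S) col := by
    rw [stateSum_insert hj, ← hloc.stateSum_congr hK (agree_update ha col i), stateSum]
    have h₁ := card_index_singleton S B (Function.update col a i) a d
    rw [Function.update_self] at h₁
    have h₂ : ((if i = S.one then 1 else 0 : ℕ) : ℂ) = if i = S.one then 1 else 0 := by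
      split_ifs <;> simp
    -- The summand does not depend on the label of the new coupons, so their sum contributes the
    -- number of labels.
    rw [← h₂, ← h₁, ← nsmul_eq_mul, ← Finset.card_univ, ← Finset.sum_const]
    refine Finset.sum_congr rfl fun α _ => Finset.sum_congr rfl fun lab _ => ?_
    rw [← hloc.update hj _ _ (B.f _ α) (B.e _ α), Diagram.valuation_update,
      Diagram.valuation_eq S L ω _ hT]
    rw [tangleHom_insert_of_eq S _ _ _ hT₁ (isTangle_cancellation u v j a d)
      (tangleHom_cancellation S _ _ _ u v j a d _), Category.id_comp, tangleHom_append _ _ _ _ hT₁]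
    rw [Function.update_self, Function.update_self]
    exact B.dual_same _ α
  simp only [h]
  -- Only the unit colour admits a label, and its weight is one.
  rw [Finset.sum_eq_single S.one]
  · rw [if_pos rfl, h_one]; ring
  · intro i _ hi; rw [if_neg hi]; ring
  · simp

theorem colourSum_negUnknot (hL : ∀ ω, SupportedOn R K (L ω))
    (hK : ∀ c ∈ K, ∀ x ∈ c.2, x.1 ∈ R) {weight : I → ℂ}
    {T₁ T₂ : List Layer} {u v : List Strand} {a : ℕ} {d : Bool}
    (hT : L ω = T₁ ++ T₂) (hT₁ : IsTangle [] T₁ (u ++ v)) (ha : a ∉ R) :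
    colourSum S B (insert a R) K
        (Diagram.valuation S (Function.update L ω (T₁ ++ negUnknot u v a d ++ T₂))) weight =
      (∑ i, weight i * unknotScalar S i) * colourSum S B R K (L.valuation S) weight := by
  have hloc := isLocal_valuation S hL
  refine colourSum_insert S B ha fun col => ?_
  rw [Finset.sum_mul]
  refine Finset.sum_congr rfl fun i _ => ?_
  rw [mul_assoc]
  refine congrArg (weight i * ·) ?_
  rw [← hloc.stateSum_congr hK (agree_update ha col i), stateSum, stateSum, Finset.mul_sum]
  refine Finset.sum_congr rfl fun lab _ => ?_
  rw [Diagram.valuation_update, Diagram.valuation_eq S L ω _ hT,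
    tangleHom_insert_smul S _ _ _ hT₁ (isTangle_negUnknot u v a d)
      (tangleHom_negUnknot_eq_smul S _ _ _ u v a d), Function.update_self]
  exact (congrArg (· * _) (S.scalar_smul _ _)).trans (mul_assoc _ _ _)

/-- The contribution of a sphere in which the endomorphism `g` is inserted at the row `w`. -/
def insertValuation (L : Diagram r) (ω : Fin r) (T₁ T₂ : List Layer) (u w v : List Strand)
    (col : ℕ → I) (f : ∀ c : ℕ × List Strand, rowObj S col c.2 ⟶ 𝟙_ C)
    (e : ∀ c : ℕ × List Strand, 𝟙_ C ⟶ rowObj S col c.2)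
    (g : rowObj S col w ⟶ rowObj S col w) : ℂ :=
  scalar (tangleHom S col f e [] T₁ (u ++ (w ++ v)) ≫ insertRow S col u w v g ≫
    tangleHom S col f e (u ++ (w ++ v)) T₂ []) *
      ∏ ω' ∈ Finset.univ.erase ω, scalar (tangleHom S col f e [] (L ω') [])

theorem comp_add_comp {W X Y Z : C} (p : W ⟶ X) (g h : X ⟶ Y) (q : Y ⟶ Z) :
    p ≫ (g + h) ≫ q = p ≫ g ≫ q + p ≫ h ≫ q := by
  rw [Preadditive.add_comp, Preadditive.comp_add]

theorem comp_smul_comp {W X Y Z : C} (z : ℂ) (p : W ⟶ X) (g : X ⟶ Y) (q : Y ⟶ Z) :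
    p ≫ (z • g) ≫ q = z • p ≫ g ≫ q := by
  rw [Linear.smul_comp, Linear.comp_smul]

/-- Insertion is linear in the inserted endomorphism. -/
def insertValuationLinear (L : Diagram r) (ω : Fin r) (T₁ T₂ : List Layer) (u w v : List Strand)
    (col : ℕ → I) (f : ∀ c : ℕ × List Strand, rowObj S col c.2 ⟶ 𝟙_ C)
    (e : ∀ c : ℕ × List Strand, 𝟙_ C ⟶ rowObj S col c.2) :
    (rowObj S col w ⟶ rowObj S col w) →ₗ[ℂ] ℂ where
  toFun := insertValuation S L ω T₁ T₂ u w v col f e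
  map_add' g h := by
    refine Eq.trans (congrArg (· * _) ?_) (add_mul _ _ _)
    rw [insertRow_add]
    exact (congrArg scalar (comp_add_comp _ _ _ _)).trans (S.scalar_add _ _)
  map_smul' z g := by
    refine Eq.trans (congrArg (· * _) ?_) (mul_assoc z _ _)
    rw [insertRow_smul]
    exact (congrArg scalar (comp_smul_comp z _ _ _)).trans (S.scalar_smul z _)

theorem isLocal_insertValuation {T₁ T₂ : List Layer} {u w v : List Strand}
    (hL : ∀ ω' ≠ ω, SupportedOn R K (L ω')) (h₁ : SupportedOn R K T₁) (h₂ : SupportedOn R K T₂)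
    (hR : ∀ x ∈ u ++ (w ++ v), x.1 ∈ R)
    {col col' : ℕ → I} {f : ∀ c : ℕ × List Strand, rowObj S col c.2 ⟶ 𝟙_ C}
    {e : ∀ c : ℕ × List Strand, 𝟙_ C ⟶ rowObj S col c.2}
    {f' : ∀ c : ℕ × List Strand, rowObj S col' c.2 ⟶ 𝟙_ C}
    {e' : ∀ c : ℕ × List Strand, 𝟙_ C ⟶ rowObj S col' c.2}
    (hcol : ∀ a ∈ R, col a = col' a) (hf : ∀ c ∈ K, HEq (f c) (f' c))
    (he : ∀ c ∈ K, HEq (e c) (e' c)) {g : rowObj S col w ⟶ rowObj S col w}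
    {g' : rowObj S col' w ⟶ rowObj S col' w} (hg : HEq g g') :
    insertValuation S L ω T₁ T₂ u w v col f e g =
      insertValuation S L ω T₁ T₂ u w v col' f' e' g' := by
  have hm : ∀ x ∈ u ++ (w ++ v), col x.1 = col' x.1 := fun x hx => hcol _ (hR x hx)
  have em := rowObj_congr S hm
  have h := isLocal_prod_scalar (S := S) L (Finset.univ.erase ω)
    (fun ω' hω' => hL ω' (Finset.ne_of_mem_erase hω')) _ _ _ _ _ _ hcol hf he
  have h' := comp_heq_comp rfl em rfl (h₁.tangleHom_heq (s := []) (by simp) hR hcol hf he)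
    (comp_heq_comp em em rfl (insertRow_heq S (fun x hx => hm x (by simp [hx]))
      (fun x hx => hm x (by simp [hx])) (fun x hx => hm x (by simp [hx])) hg)
      (h₂.tangleHom_heq (t := []) hR (by simp) hcol hf he))
  rw [insertValuation, insertValuation]
  exact congrArg₂ (· * ·) (congrArg scalar (eq_of_heq h')) h

/-- Both diagrams insert an endomorphism into the row `w`: a weighted sum of annuli on one side, the
sum of the `f_α ≫ e_α` on the other. The insertion is linear, so `sum_annulus` identifies them. -/
theorem colourSum_encircled
    {T₁ T₂ : List Layer} {u w v : List Strand} {j a : ℕ} {d : Bool}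
    (hL : ∀ ω' ≠ ω, SupportedOn R K (L ω')) (h₁ : SupportedOn R K T₁) (h₂ : SupportedOn R K T₂)
    (hR : ∀ x ∈ u ++ (w ++ v), x.1 ∈ R) (hK : ∀ c ∈ K, ∀ x ∈ c.2, x.1 ∈ R)
    (hT : L ω = T₁ ++ facingCoupons u w v j ++ T₂) (hT₁ : IsTangle [] T₁ (u ++ (w ++ v)))
    (hj : (j, w) ∉ K) (ha : a ∉ R)
    (hdhat : ∀ i, ∑ j, dhat j * Smatrix S j i = if i = S.one then 1 else 0) :
    colourSum S B (insert a R) K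
        (Diagram.valuation S (Function.update L ω (T₁ ++ encircled u w v a d ++ T₂)))
        (fun i => dhat i / dhat S.one) =
      1 / dhat S.one * colourSum S B R (insert (j, w) K) (L.valuation S)
        (fun i => dhat i / dhat S.one) := by
  refine colourSum_insert S B ha fun col => ?_
  -- With the colour of the annulus frozen to `i`, the valuation no longer reads the colour of `a`
  -- and is local to the old ribbons.
  have hloc (i : I) : IsLocal S R K fun col f e =>
      insertValuation S L ω T₁ T₂ u w v col f e (annulus S i d (rowObj S col w)) := by
    intro col col' f f' e e' hcol hf he
    refine isLocal_insertValuation S hL h₁ h₂ hR hcol hf he ?_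
    rw [rowObj_congr S fun x hx => hcol _ (hR x (by simp [hx]))]
  have h (i : I) : stateSum S B K
      (Diagram.valuation S (Function.update L ω (T₁ ++ encircled u w v a d ++ T₂)))
      (Function.update col a i) = stateSum S B K (fun col f e =>
        insertValuation S L ω T₁ T₂ u w v col f e (annulus S i d (rowObj S col w))) col := by
    rw [← (hloc i).stateSum_congr hK (agree_update ha col i), stateSum, stateSum]
    refine Finset.sum_congr rfl fun lab _ => ?_
    rw [Diagram.valuation_update, tangleHom_insert_of_eq S _ _ _ hT₁
      (isTangle_encircled u w v a d) (tangleHom_encircled_eq S _ _ _ u w v a d),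
      Function.update_self]
    rfl
  simp only [h]
  rw [stateSum_insert hj, Finset.sum_comm, Finset.mul_sum]
  simp only [stateSum, Finset.mul_sum]
  rw [Finset.sum_comm]
  refine Finset.sum_congr rfl fun lab _ => ?_
  have h₃ : ∑ α : B.Index (rowObj S col w), L.valuation S col
      (Function.update (labelF S B K col lab) (j, w) (B.f _ α))
      (Function.update (labelE S B K col lab) (j, w) (B.e _ α)) =
      ∑ i, dhat i * insertValuation S L ω T₁ T₂ u w v col (labelF S B K col lab)
        (labelE S B K col lab) (annulus S i d (rowObj S col w)) := by
    -- This functional carries the identity of endomorphisms of the row over to numbers.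
    let Λ := insertValuationLinear S L ω T₁ T₂ u w v col (labelF S B K col lab)
      (labelE S B K col lab)
    have h₄ := congrArg Λ (sum_annulus S B dhat hdhat d (rowObj S col w))
    rw [map_sum, map_sum] at h₄
    simp only [map_smul, smul_eq_mul] at h₄
    refine Eq.trans (Finset.sum_congr rfl fun α _ => ?_) h₄.symm
    rw [Diagram.valuation_eq S L ω _ hT, tangleHom_insert_of_eq S _ _ _ hT₁
      (isTangle_facingCoupons u w v j) (tangleHom_facingCoupons S _ _ _ u w v j),
      Function.update_self, Function.update_self]
    have hne (c : ℕ × List Strand) (hc : c ∈ K) : c ≠ (j, w) := fun h => hj (h ▸ hc)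
    refine isLocal_insertValuation S hL h₁ h₂ hR (fun _ _ => rfl) (fun c hc => ?_)
      (fun c hc => ?_) HEq.rfl
    · rw [Function.update_of_ne (hne c hc)]
    · rw [Function.update_of_ne (hne c hc)]
  rw [← Finset.mul_sum, h₃, Finset.mul_sum]
  exact Finset.sum_congr rfl fun i _ => by ring

end Moves

/-! ### Signatures of quadratic forms -/

section Signature

variable {V W : Type*} [AddCommGroup V] [Module ℝ V] [AddCommGroup W] [Module ℝ W]

/-- The signature of a real quadratic form. -/
def formSignature (Q : QuadraticForm ℝ V) : ℤ := (_root_.sigPos Q : ℤ) - _root_.sigNeg Q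

theorem formSignature_eq_of_equivalent {Q : QuadraticForm ℝ V} {Q' : QuadraticForm ℝ W}
    (h : QuadraticMap.Equivalent Q Q') : formSignature Q = formSignature Q' := by
  rw [formSignature, formSignature, h.sigPos_eq, h.sigNeg_eq]

theorem formSignature_eq_of_linearEquiv {Q : QuadraticForm ℝ V} {Q' : QuadraticForm ℝ W}
    (e : V ≃ₗ[ℝ] W) (h : ∀ x, Q' (e x) = Q x) : formSignature Q = formSignature Q' :=
  formSignature_eq_of_equivalent ⟨⟨e, h⟩⟩

theorem formSignature_weightedSumSquares {ι : Type*} [Fintype ι] (w : ι → ℝ) :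
    formSignature (QuadraticMap.weightedSumSquares ℝ w) =
      ({i | 0 < w i}.ncard : ℤ) - {i | w i < 0}.ncard := by
  rw [formSignature, QuadraticForm.sigPos_weightedSumSquares,
    QuadraticForm.sigNeg_weightedSumSquares]

theorem ncard_sumElim {ι κ : Type*} [Finite ι] [Finite κ] (p : ι → Prop) (q : κ → Prop) :
    {i | Sum.elim p q i}.ncard = {i | p i}.ncard + {i | q i}.ncard := by
  have h : {i | Sum.elim p q i} = Sum.inl '' {i | p i} ∪ Sum.inr '' {i | q i} := by
    ext i; cases i <;> simp
  rw [h, Set.ncard_union_eq, Set.ncard_image_of_injective _ Sum.inl_injective,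
    Set.ncard_image_of_injective _ Sum.inr_injective]
  exact Set.disjoint_left.2 (by rintro _ ⟨x, _, rfl⟩ ⟨y, _, h⟩; cases h)

/-- Diagonalize both forms. By Sylvester's law the signature counts the signs of the diagonal
entries, and the entries of the product are those of both factors together. -/
theorem formSignature_prod [FiniteDimensional ℝ V] [FiniteDimensional ℝ W]
    (Q : QuadraticForm ℝ V) (Q' : QuadraticForm ℝ W) :
    formSignature (QuadraticMap.prod Q Q') = formSignature Q + formSignature Q' := by
  obtain ⟨w, ⟨e⟩⟩ := QuadraticForm.equivalent_weightedSumSquares Q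
  obtain ⟨w', ⟨e'⟩⟩ := QuadraticForm.equivalent_weightedSumSquares Q'
  have h : QuadraticMap.Equivalent (QuadraticMap.prod Q Q')
      (QuadraticMap.weightedSumSquares ℝ (Sum.elim w w')) := by
    refine ⟨(e.prod e').trans ⟨(LinearEquiv.sumArrowLequivProdArrow _ _ ℝ ℝ).symm, ?_⟩⟩
    intro x
    simp only [QuadraticMap.prod_apply, QuadraticMap.weightedSumSquares_apply,
      Fintype.sum_sum_type]
    rfl
  rw [formSignature_eq_of_equivalent h, formSignature_eq_of_equivalent ⟨e⟩,
    formSignature_eq_of_equivalent ⟨e'⟩, formSignature_weightedSumSquares,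
    formSignature_weightedSumSquares, formSignature_weightedSumSquares]
  have h₁ := ncard_sumElim (fun i => 0 < w i) fun i => 0 < w' i
  have h₂ := ncard_sumElim (fun i => w i < 0) fun i => w' i < 0
  have h₃ : {i | Sum.elim (fun i => 0 < w i) (fun i => 0 < w' i) i} =
      {i | 0 < Sum.elim w w' i} := by ext i; cases i <;> rfl
  have h₄ : {i | Sum.elim (fun i => w i < 0) (fun i => w' i < 0) i} =
      {i | Sum.elim w w' i < 0} := by ext i; cases i <;> rfl
  rw [h₃] at h₁
  rw [h₄] at h₂
  rw [h₁, h₂]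
  push_cast
  ring

theorem formSignature_smul_sq (z : ℝ) :
    formSignature (z • QuadraticMap.sq (R := ℝ)) =
      (if 0 < z then 1 else 0) - if z < 0 then 1 else 0 := by
  rw [← formSignature_eq_of_linearEquiv
    (Q := QuadraticMap.weightedSumSquares ℝ fun _ : Unit => z)
    (LinearEquiv.funUnique Unit ℝ ℝ) fun x => ?_, formSignature_weightedSumSquares]
  · by_cases h : 0 < z <;> by_cases h' : z < 0 <;> simp [h, h']
  · simp [QuadraticMap.weightedSumSquares_apply]

/-- Adding to `q` a hyperbolic pairing of a linear form with a new coordinate has the effect of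
restricting `q` to the kernel of the linear form. -/
theorem formSignature_of_pairing [FiniteDimensional ℝ V] (q : QuadraticForm ℝ V) (l : V →ₗ[ℝ] ℝ)
    (Q : QuadraticForm ℝ (V × ℝ)) (hQ : ∀ x t, Q (x, t) = q x + t * l x) :
    formSignature Q = formSignature (q.restrict (LinearMap.ker l)) := by
  by_cases hl : l = 0
  -- For `l = 0` the new coordinate lies in the radical and contributes a zero square.
  · rw [← formSignature_eq_of_linearEquiv (Q := QuadraticMap.prod q ((0 : ℝ) • QuadraticMap.sq))
      (LinearEquiv.refl ℝ _) fun x => ?_]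
    · rw [formSignature_prod, formSignature_smul_sq,
        formSignature_eq_of_linearEquiv (Q := q.restrict (LinearMap.ker l)) (Q' := q)
          (LinearEquiv.ofTop (LinearMap.ker l) (by rw [hl, LinearMap.ker_zero])) fun x => rfl]
      simp
    · obtain ⟨x, t⟩ := x
      simp [hQ, hl]
  · obtain ⟨v, hv⟩ : ∃ v, l v = 1 := by
      obtain ⟨v, hv⟩ := DFunLike.ne_iff.1 hl
      have hv : l v ≠ 0 := hv
      exact ⟨(l v)⁻¹ • v, by simp [hv]⟩
    let B : V → ℝ := fun x => QuadraticMap.polar q x v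
    -- The first component splits `V` along `v`. The second is chosen to cancel both the multiple of
    -- `q v` and the cross term with `v`, so that beyond `q` on the kernel only `(s - t) * (s + t) =
    -- s² - t²` remains.
    let e : (LinearMap.ker l × (ℝ × ℝ)) ≃ₗ[ℝ] V × ℝ :=
      { toFun := fun p => (p.1.1 + (p.2.1 + p.2.2) • v,
          p.2.1 - p.2.2 - (p.2.1 + p.2.2) * q v - B p.1.1)
        invFun := fun p =>
          (⟨p.1 - l p.1 • v, by simp [hv]⟩,
            ((l p.1 + (p.2 + l p.1 * q v + B (p.1 - l p.1 • v))) / 2,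
              (l p.1 - (p.2 + l p.1 * q v + B (p.1 - l p.1 • v))) / 2))
        map_add' := fun p p' => by
          refine Prod.ext ?_ ?_
          · simp only [Prod.fst_add, Prod.snd_add, Submodule.coe_add]
            module
          · simp only [B, Prod.fst_add, Prod.snd_add, Submodule.coe_add,
              QuadraticMap.polar_add_left]
            ring
        map_smul' := fun z p => by
          refine Prod.ext ?_ ?_
          · simp only [Prod.smul_fst, Prod.smul_snd, Submodule.coe_smul, RingHom.id_apply,
              smul_eq_mul]
            module
          · simp only [B, Prod.smul_fst, Prod.smul_snd, Submodule.coe_smul, RingHom.id_apply,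
              smul_eq_mul, QuadraticMap.polar_smul_left]
            ring
        left_inv := fun p => by
          obtain ⟨⟨x, hx⟩, s, t⟩ := p
          have hx' : l x = 0 := hx
          have h : l (x + (s + t) • v) = s + t := by simp [hx', hv]
          have h' : x + (s + t) • v - (s + t) • v = x := by module
          refine Prod.ext (Subtype.ext ?_) (Prod.ext ?_ ?_)
          · simp only [h, h']
          · simp only [h, h']; ring
          · simp only [h, h']; ring
        right_inv := fun p => by
          obtain ⟨x, t⟩ := p
          refine Prod.ext ?_ ?_
          · simp only []
            module
          · simp only []
            ring }
    rw [← formSignature_eq_of_linearEquiv (Q := QuadraticMap.prod (q.restrict (LinearMap.ker l))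
      (QuadraticMap.prod ((1 : ℝ) • QuadraticMap.sq) ((-1 : ℝ) • QuadraticMap.sq))) e fun p => ?_]
    · rw [formSignature_prod, formSignature_prod, formSignature_smul_sq, formSignature_smul_sq]
      norm_num
    · obtain ⟨⟨x, hx⟩, s, t⟩ := p
      have hx' : l x = 0 := hx
      have h : q (x + (s + t) • v) = q x + (s + t) * (s + t) * q v + (s + t) * B x := by
        have h₁ := QuadraticMap.polar_smul_right q (s + t) x v
        rw [QuadraticMap.polar, QuadraticMap.map_smul] at h₁
        simp only [smul_eq_mul] at h₁
        simp only [B]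
        linarith
      change Q (x + (s + t) • v, s - t - (s + t) * q v - B x) = _
      rw [hQ, h]
      simp [hx', hv]
      ring

end Signature

/-! ### Linking forms on families indexed by names of ribbons -/

section LinkingForm

/-- The families on `R` that are annihilated by the passages through the coupon pairs `K`. -/
def cyclesOn (R : Finset ℕ) (K : Finset (ℕ × List Strand)) : Submodule ℝ (R → ℝ) where
  carrier := {x | ∀ c ∈ K, ∑ a : R, (passages c.2 a.1 : ℝ) * x a = 0}
  add_mem' := by
    intro x y hx hy c hc
    simp only [Pi.add_apply, mul_add, Finset.sum_add_distrib]
    rw [hx c hc, hy c hc, add_zero]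
  zero_mem' := by intro c _; simp
  smul_mem' := by
    intro z x hx c hc
    simp only [Pi.smul_apply, smul_eq_mul, mul_left_comm _ z, ← Finset.mul_sum]
    rw [hx c hc, mul_zero]

/-- The quadratic form with matrix `m` on the cycles. -/
def formOn (R : Finset ℕ) (K : Finset (ℕ × List Strand)) (m : ℕ → ℕ → ℝ) :
    QuadraticForm ℝ (cyclesOn R K) :=
  QuadraticMap.restrict (Matrix.of fun a b : R => m a b).toQuadraticForm' (cyclesOn R K)

theorem Diagram.signature_eq {r : ℕ} (L : Diagram r) : L.signature =
    formSignature (formOn L.ribbons L.coupons fun a b => (L.layers.map fun x => x.linking a b).sum) :=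
  rfl

/-- A family on `R`, extended by zero. -/
def extendZero (R : Finset ℕ) (x : R → ℝ) (a : ℕ) : ℝ := if h : a ∈ R then x ⟨a, h⟩ else 0

theorem sum_mul_extendZero (R : Finset ℕ) (x : R → ℝ) (F : ℕ → ℝ) :
    ∑ a : R, F a * x a = ∑ a ∈ R, F a * extendZero R x a := by
  rw [← Finset.sum_coe_sort R]
  exact Finset.sum_congr rfl fun a _ => by simp [extendZero]

theorem mem_cyclesOn {R : Finset ℕ} {K : Finset (ℕ × List Strand)} {x : R → ℝ} :
    x ∈ cyclesOn R K ↔ ∀ c ∈ K, ∑ a ∈ R, (passages c.2 a : ℝ) * extendZero R x a = 0 :=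
  forall₂_congr fun c _ => by rw [← sum_mul_extendZero R x fun a => (passages c.2 a : ℝ)]

theorem formOn_apply (R : Finset ℕ) (K : Finset (ℕ × List Strand)) (m : ℕ → ℕ → ℝ)
    (x : cyclesOn R K) : formOn R K m x =
      ∑ a ∈ R, ∑ b ∈ R, m a b * extendZero R x.1 a * extendZero R x.1 b := by
  have h : formOn R K m x = ∑ a : R, (∑ b : R, m a b * x.1 b) * x.1 a := by
    rw [formOn, QuadraticMap.restrict_apply, Matrix.toQuadraticForm',
      LinearMap.BilinMap.toQuadraticMap_apply, Matrix.toLinearMap₂'_apply']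
    simp only [dotProduct, Matrix.mulVec, Matrix.of_apply]
    exact Finset.sum_congr rfl fun a _ => mul_comm _ _
  rw [h]
  have h' (a : ℕ) : ∑ b : R, m a b * x.1 b = ∑ b ∈ R, m a b * extendZero R x.1 b :=
    sum_mul_extendZero R x.1 fun b => m a b
  simp only [h']
  rw [sum_mul_extendZero R x.1 fun a => ∑ b ∈ R, m a b * extendZero R x.1 b]
  refine Finset.sum_congr rfl fun a _ => ?_
  rw [Finset.sum_mul]
  exact Finset.sum_congr rfl fun b _ => by ring

theorem extendZero_insert {R : Finset ℕ} {a : ℕ} (ha : a ∉ R) (p : ℝ × (R → ℝ)) :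
    extendZero (insert a R) (piInsertEquiv (fun _ => ℝ) ha p) =
      Function.update (extendZero R p.2) a p.1 := by
  funext b
  by_cases h : b = a
  · subst h
    rw [Function.update_self, extendZero, dif_pos (Finset.mem_insert_self b R),
      piInsertEquiv_self]
  · rw [Function.update_of_ne h, extendZero, extendZero]
    by_cases hb : b ∈ R
    · rw [dif_pos hb, dif_pos (Finset.mem_insert_of_mem hb), piInsertEquiv_of_mem _ _ _ hb]
    · rw [dif_neg hb, dif_neg (by simp [h, hb])]

/-- Families on `insert a R`, split into the value at `a` and a family on `R`. -/
def piInsertLinearEquiv {R : Finset ℕ} {a : ℕ} (ha : a ∉ R) :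
    (ℝ × (R → ℝ)) ≃ₗ[ℝ] (↥(insert a R) → ℝ) where
  __ := piInsertEquiv (fun _ => ℝ) ha
  map_add' p q := by
    funext c
    change piInsertEquiv (fun _ => ℝ) ha (p + q) c =
      piInsertEquiv (fun _ => ℝ) ha p c + piInsertEquiv (fun _ => ℝ) ha q c
    simp only [piInsertEquiv, Equiv.coe_fn_mk, cast_eq]
    split_ifs <;> rfl
  map_smul' z p := by
    funext c
    change piInsertEquiv (fun _ => ℝ) ha (z • p) c = z * piInsertEquiv (fun _ => ℝ) ha p c
    simp only [piInsertEquiv, Equiv.coe_fn_mk, cast_eq]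
    split_ifs <;> rfl

variable {R : Finset ℕ} {K : Finset (ℕ × List Strand)} {a : ℕ}

theorem sum_insert_mul_extendZero (ha : a ∉ R) (p : ℝ × (R → ℝ)) (F : ℕ → ℝ) :
    ∑ b ∈ insert a R, F b * extendZero (insert a R) (piInsertLinearEquiv ha p) b =
      F a * p.1 + ∑ b ∈ R, F b * extendZero R p.2 b := by
  change ∑ b ∈ insert a R, F b * extendZero (insert a R) (piInsertEquiv (fun _ => ℝ) ha p) b = _
  rw [extendZero_insert, Finset.sum_insert ha, Function.update_self]
  congr 1
  exact Finset.sum_congr rfl fun b hb => by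
    rw [Function.update_of_ne (show b ≠ a from fun h => ha (h ▸ hb))]

theorem sum_sum_insert_mul_extendZero (ha : a ∉ R) (p : ℝ × (R → ℝ)) (m : ℕ → ℕ → ℝ) :
    ∑ b ∈ insert a R, ∑ c ∈ insert a R, m b c *
        extendZero (insert a R) (piInsertLinearEquiv ha p) b *
          extendZero (insert a R) (piInsertLinearEquiv ha p) c =
      m a a * p.1 * p.1 + p.1 * ∑ b ∈ R, (m a b + m b a) * extendZero R p.2 b +
        ∑ b ∈ R, ∑ c ∈ R, m b c * extendZero R p.2 b * extendZero R p.2 c := by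
  simp only [sum_insert_mul_extendZero ha p fun c => m _ c *
    extendZero (insert a R) (piInsertLinearEquiv ha p) _]
  have h : extendZero (insert a R) (piInsertLinearEquiv ha p) =
      Function.update (extendZero R p.2) a p.1 := extendZero_insert ha p
  rw [h, Finset.sum_insert ha, Function.update_self]
  have h' : ∑ b ∈ R, (m b a * Function.update (extendZero R p.2) a p.1 b * p.1 +
      ∑ c ∈ R, m b c * Function.update (extendZero R p.2) a p.1 b * extendZero R p.2 c) =
      ∑ b ∈ R, (m b a * extendZero R p.2 b * p.1 +
        ∑ c ∈ R, m b c * extendZero R p.2 b * extendZero R p.2 c) :=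
    Finset.sum_congr rfl fun b hb => by
      rw [Function.update_of_ne (show b ≠ a from fun h => ha (h ▸ hb))]
  rw [h', Finset.sum_add_distrib, Finset.mul_sum]
  have h'' : ∑ b ∈ R, p.1 * ((m a b + m b a) * extendZero R p.2 b) =
      ∑ b ∈ R, m a b * p.1 * extendZero R p.2 b + ∑ b ∈ R, m b a * extendZero R p.2 b * p.1 := by
    rw [← Finset.sum_add_distrib]
    exact Finset.sum_congr rfl fun b _ => by ring
  rw [h'']
  ring

theorem passages_eq_zero {w : List Strand} (h : ∀ x ∈ w, x.1 ≠ a) : passages w a = 0 := by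
  induction w with
  | nil => rfl
  | cons x w ih =>
    have h₁ := ih fun y hy => h y (List.mem_cons_of_mem _ hy)
    rw [passages] at h₁ ⊢
    rw [List.map_cons, List.sum_cons, h₁, if_neg (h x List.mem_cons_self), add_zero]

theorem passages_eq_zero_of_notMem (ha : a ∉ R) (hK : ∀ c ∈ K, ∀ x ∈ c.2, x.1 ∈ R)
    {c : ℕ × List Strand} (hc : c ∈ K) : passages c.2 a = 0 :=
  passages_eq_zero fun x hx h => ha (h ▸ hK c hc x hx)

/-- If the ribbon `a` passes through no coupons, then the cycles get one free coordinate. -/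
def cyclesInsertEquiv (ha : a ∉ R) (hK : ∀ c ∈ K, ∀ x ∈ c.2, x.1 ∈ R) :
    (cyclesOn R K × ℝ) ≃ₗ[ℝ] cyclesOn (insert a R) K where
  toFun p := ⟨piInsertLinearEquiv ha (p.2, p.1.1), mem_cyclesOn.2 fun c hc => by
    rw [sum_insert_mul_extendZero ha _ fun b => (passages c.2 b : ℝ),
      passages_eq_zero_of_notMem ha hK hc, mem_cyclesOn.1 p.1.2 c hc]
    simp⟩
  invFun x := (⟨((piInsertLinearEquiv ha).symm x.1).2, mem_cyclesOn.2 fun c hc => by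
    have h := mem_cyclesOn.1 x.2 c hc
    rw [← (piInsertLinearEquiv ha).apply_symm_apply x.1,
      sum_insert_mul_extendZero ha _ fun b => (passages c.2 b : ℝ),
      passages_eq_zero_of_notMem ha hK hc] at h
    simpa using h⟩, ((piInsertLinearEquiv ha).symm x.1).1)
  map_add' p q := Subtype.ext ((piInsertLinearEquiv ha).map_add (p.2, p.1.1) (q.2, q.1.1))
  map_smul' z p := Subtype.ext ((piInsertLinearEquiv ha).map_smul z (p.2, p.1.1))
  left_inv p := by
    have h := (piInsertLinearEquiv ha).symm_apply_apply (p.2, p.1.1)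
    exact Prod.ext (Subtype.ext (congrArg Prod.snd h)) (congrArg Prod.fst h)
  right_inv x := Subtype.ext ((piInsertLinearEquiv ha).apply_symm_apply x.1)

theorem formOn_cyclesInsertEquiv (ha : a ∉ R) (hK : ∀ c ∈ K, ∀ x ∈ c.2, x.1 ∈ R)
    (m : ℕ → ℕ → ℝ) (x : cyclesOn R K) (t : ℝ) :
    formOn (insert a R) K m (cyclesInsertEquiv ha hK (x, t)) =
      m a a * t * t + t * ∑ b ∈ R, (m a b + m b a) * extendZero R x.1 b + formOn R K m x := by
  rw [formOn_apply, formOn_apply]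
  exact sum_sum_insert_mul_extendZero ha (t, x.1) m

theorem formOn_congr {m m' : ℕ → ℕ → ℝ} (h : ∀ b ∈ R, ∀ c ∈ R, m b c = m' b c) :
    formOn R K m = formOn R K m' := by
  refine QuadraticMap.ext fun x => ?_
  rw [formOn_apply, formOn_apply]
  exact Finset.sum_congr rfl fun b hb => Finset.sum_congr rfl fun c hc => by rw [h b hb c hc]

/-- An additional ribbon that is not linked with the others and has framing number `-1`. -/
theorem formSignature_insert_neg_one (ha : a ∉ R) (hK : ∀ c ∈ K, ∀ x ∈ c.2, x.1 ∈ R)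
    {m m' : ℕ → ℕ → ℝ} (h : ∀ b ∈ R, ∀ c ∈ R, m' b c = m b c) (haa : m' a a = -1)
    (hab : ∀ b ∈ R, m' a b + m' b a = 0) :
    formSignature (formOn (insert a R) K m') = formSignature (formOn R K m) - 1 := by
  rw [← formSignature_eq_of_linearEquiv
    (Q := QuadraticMap.prod (formOn R K m) ((-1 : ℝ) • QuadraticMap.sq))
    (cyclesInsertEquiv ha hK) fun p => ?_]
  · rw [formSignature_prod, formSignature_smul_sq]
    norm_num
    rfl
  · obtain ⟨x, t⟩ := p
    rw [formOn_cyclesInsertEquiv, formOn_congr h, haa,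
      Finset.sum_eq_zero fun b hb => by rw [hab b hb, zero_mul]]
    simp
    ring

/-- An additional ribbon of framing number zero that encircles the strands `w`, and the coupons in
their place. -/
theorem formSignature_insert_pairing (ha : a ∉ R) (hK : ∀ c ∈ K, ∀ x ∈ c.2, x.1 ∈ R)
    {m m' : ℕ → ℕ → ℝ} (h : ∀ b ∈ R, ∀ c ∈ R, m' b c = m b c) (haa : m' a a = 0)
    {c₀ : ℕ × List Strand} {z : ℝ} (hz : z ≠ 0)
    (hab : ∀ b ∈ R, m' a b + m' b a = z * passages c₀.2 b) :
    formSignature (formOn (insert a R) K m') = formSignature (formOn R (insert c₀ K) m) := by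
  -- A nonzero multiple of the boundary component of the coupon pair `c₀`, so that its kernel is the
  -- cycle condition that `c₀` imposes.
  let l : cyclesOn R K →ₗ[ℝ] ℝ :=
    { toFun := fun x => z * ∑ b : R, (passages c₀.2 b.1 : ℝ) * x.1 b
      map_add' := fun x y => by
        simp only [Submodule.coe_add, Pi.add_apply, mul_add, Finset.sum_add_distrib]
      map_smul' := fun t x => by
        simp only [Submodule.coe_smul, Pi.smul_apply, smul_eq_mul, RingHom.id_apply,
          mul_left_comm _ t, ← Finset.mul_sum] }
  have hl (x : cyclesOn R K) : l x = z * ∑ b ∈ R, (passages c₀.2 b : ℝ) * extendZero R x.1 b :=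
    congrArg (z * ·) (sum_mul_extendZero R x.1 fun a => (passages c₀.2 a : ℝ))
  rw [← formSignature_eq_of_linearEquiv
    (Q := (formOn (insert a R) K m').comp (cyclesInsertEquiv ha hK).toLinearMap)
    (cyclesInsertEquiv ha hK) fun p => rfl, formSignature_of_pairing (formOn R K m) l]
  · let e : cyclesOn R (insert c₀ K) ≃ₗ[ℝ] LinearMap.ker l :=
      { toFun := fun x => ⟨⟨x.1, fun c hc => x.2 c (Finset.mem_insert_of_mem hc)⟩,
          (congrArg (z * ·) (x.2 c₀ (Finset.mem_insert_self _ _))).trans (mul_zero z)⟩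
        invFun := fun x => ⟨x.1.1, fun c hc => by
          rcases Finset.mem_insert.1 hc with rfl | hc
          · exact (mul_eq_zero.1 x.2).resolve_left hz
          · exact x.1.2 c hc⟩
        map_add' := fun _ _ => rfl
        map_smul' := fun _ _ => rfl
        left_inv := fun _ => rfl
        right_inv := fun _ => rfl }
    exact (formSignature_eq_of_linearEquiv e fun _ => rfl).symm
  · intro x t
    refine (formOn_cyclesInsertEquiv ha hK m' x t).trans ?_
    have h' : ∑ b ∈ R, (m' a b + m' b a) * extendZero R x.1 b =
        z * ∑ b ∈ R, (passages c₀.2 b : ℝ) * extendZero R x.1 b := by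
      rw [Finset.mul_sum]
      exact Finset.sum_congr rfl fun b hb => by rw [hab b hb, mul_assoc]
    rw [formOn_congr h, haa, hl, h']
    ring

/-- An additional ribbon that passes once through one additional pair of coupons. -/
theorem formSignature_insert_coupon (ha : a ∉ R)
    {m m' : ℕ → ℕ → ℝ} (h : ∀ b ∈ R, ∀ c ∈ R, m' b c = m b c) (j : ℕ) (d : Bool) :
    formSignature (formOn (insert a R) (insert (j, [(a, d)]) K) m') =
      formSignature (formOn R K m) := by
  have hd : ((passages [(a, d)] a : ℤ) : ℝ) ≠ 0 := by cases d <;> simp [passages]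
  have hR : ∀ b ∈ R, passages [(a, d)] b = 0 := fun b hb =>
    passages_eq_zero fun x hx h => ha (by rw [List.mem_singleton.1 hx] at h; exact (show a = b from h) ▸ hb)
  -- Only `a` passes through the new coupons, with coefficient `1` or `-1`, so their cycle condition
  -- kills the coordinate of `a`.
  have hx (x : cyclesOn (insert a R) (insert (j, [(a, d)]) K)) :
      ((piInsertLinearEquiv ha).symm x.1).1 = 0 := by
    have h := mem_cyclesOn.1 x.2 (j, [(a, d)]) (Finset.mem_insert_self _ _)
    rw [← (piInsertLinearEquiv ha).apply_symm_apply x.1,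
      sum_insert_mul_extendZero ha _ fun b => (passages [(a, d)] b : ℝ),
      Finset.sum_eq_zero fun b hb => by rw [hR b hb, Int.cast_zero, zero_mul], add_zero] at h
    exact (mul_eq_zero.1 h).resolve_left hd
  have hto (x : cyclesOn R K) :
      piInsertLinearEquiv ha (0, x.1) ∈ cyclesOn (insert a R) (insert (j, [(a, d)]) K) := by
    refine mem_cyclesOn.2 fun c hc => ?_
    rw [sum_insert_mul_extendZero ha _ fun b => (passages c.2 b : ℝ), mul_zero, zero_add]
    rcases Finset.mem_insert.1 hc with rfl | hc
    · exact Finset.sum_eq_zero fun b hb => by rw [hR b hb, Int.cast_zero, zero_mul]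
    · exact mem_cyclesOn.1 x.2 c hc
  have hinv (x : cyclesOn (insert a R) (insert (j, [(a, d)]) K)) :
      ((piInsertLinearEquiv ha).symm x.1).2 ∈ cyclesOn R K := by
    refine mem_cyclesOn.2 fun c hc => ?_
    have h := mem_cyclesOn.1 x.2 c (Finset.mem_insert_of_mem hc)
    rw [← (piInsertLinearEquiv ha).apply_symm_apply x.1,
      sum_insert_mul_extendZero ha _ fun b => (passages c.2 b : ℝ), hx, mul_zero, zero_add] at h
    exact h
  let e : cyclesOn R K ≃ₗ[ℝ] cyclesOn (insert a R) (insert (j, [(a, d)]) K) :=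
    { toFun := fun x => ⟨piInsertLinearEquiv ha (0, x.1), hto x⟩
      invFun := fun x => ⟨((piInsertLinearEquiv ha).symm x.1).2, hinv x⟩
      map_add' := fun x y => by
        refine Subtype.ext (Eq.trans ?_ ((piInsertLinearEquiv ha).map_add (0, x.1) (0, y.1)))
        rw [Prod.mk_add_mk, add_zero]
        rfl
      map_smul' := fun z x => by
        refine Subtype.ext (Eq.trans ?_ ((piInsertLinearEquiv ha).map_smul z (0, x.1)))
        rw [Prod.smul_mk, smul_zero]
        rfl
      left_inv := fun x => Subtype.ext
        (congrArg Prod.snd ((piInsertLinearEquiv ha).symm_apply_apply (0, x.1)))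
      right_inv := fun x => Subtype.ext (Eq.trans (congrArg (piInsertLinearEquiv ha) (Prod.ext (hx x).symm rfl))
        ((piInsertLinearEquiv ha).apply_symm_apply x.1)) }
  refine (formSignature_eq_of_linearEquiv e fun x => ?_).symm
  rw [formOn_apply, ← formOn_congr h, formOn_apply]
  refine (sum_sum_insert_mul_extendZero ha (0, x.1) m').trans ?_
  simp

end LinkingForm

/-! ### Local changes of a diagram -/

section Layers

/-- The names of the ribbons that occur in the layers `l`. -/
def names (l : List Layer) : Finset ℕ :=
  (l.flatMap fun x => (x.src ++ x.tgt).map Prod.fst).toFinset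

/-- The coupons `(j,+)` in the layers `l`. -/
def inCoupons (l : List Layer) : List (ℕ × List Strand) :=
  l.filterMap fun x => match x.piece with
    | .couponIn j w => some (j, w)
    | _ => none

/-- The coupons `(j,-)` in the layers `l`. -/
def outCoupons (l : List Layer) : List (ℕ × List Strand) :=
  l.filterMap fun x => match x.piece with
    | .couponOut j w => some (j, w)
    | _ => none

/-- The contribution of the layers `l` to the linking number of `a` and `b`. -/
def linkSum (l : List Layer) (a b : ℕ) : ℝ := (l.map fun x => x.linking a b).sum

theorem mem_names {l : List Layer} {a : ℕ} :
    a ∈ names l ↔ ∃ x ∈ l, ∃ y ∈ x.src ++ x.tgt, y.1 = a := by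
  rw [names, List.mem_toFinset, List.mem_flatMap]
  simp only [List.mem_map]

theorem mem_inCoupons {l : List Layer} {j : ℕ} {w : List Strand} :
    (j, w) ∈ inCoupons l ↔ ∃ x ∈ l, x.piece = .couponIn j w := by
  rw [inCoupons, List.mem_filterMap]
  refine exists_congr fun x => and_congr_right fun _ => ?_
  cases x.piece <;> simp

theorem mem_outCoupons {l : List Layer} {j : ℕ} {w : List Strand} :
    (j, w) ∈ outCoupons l ↔ ∃ x ∈ l, x.piece = .couponOut j w := by
  rw [outCoupons, List.mem_filterMap]
  refine exists_congr fun x => and_congr_right fun _ => ?_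
  cases x.piece <;> simp

theorem names_append (l l' : List Layer) : names (l ++ l') = names l ∪ names l' := by
  rw [names, List.flatMap_append, List.toFinset_append]
  rfl

theorem names_perm {l l' : List Layer} (h : l.Perm l') : names l = names l' :=
  List.toFinset_eq_of_perm _ _ (h.flatMap_right _)

theorem linkSum_append (l l' : List Layer) (a b : ℕ) :
    linkSum (l ++ l') a b = linkSum l a b + linkSum l' a b := by
  rw [linkSum, List.map_append, List.sum_append]
  rfl

theorem linkSum_perm {l l' : List Layer} (h : l.Perm l') (a b : ℕ) :
    linkSum l a b = linkSum l' a b :=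
  (h.map _).sum_eq

theorem Layer.linking_comm (x : Layer) (a b : ℕ) : x.linking a b = x.linking b a := by
  rw [Layer.linking, Layer.linking]
  cases x.piece <;> simp only [add_comm]

theorem linkSum_comm (l : List Layer) (a b : ℕ) : linkSum l a b = linkSum l b a := by
  simp only [linkSum, Layer.linking_comm _ a b]

theorem Layer.linking_eq_zero {x : Layer} {a b : ℕ} (h : ∀ y ∈ x.src ++ x.tgt, y.1 ≠ a) :
    x.linking a b = 0 := by
  obtain ⟨u, p, v⟩ := x
  cases p with
  | cross p y z =>
    have hy : y.1 ≠ a := h y (by simp [Layer.src, Piece.src])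
    have hz : z.1 ≠ a := h z (by simp [Layer.src, Piece.src])
    simp [Layer.linking, hy, hz]
  | _ => rfl

theorem linkSum_eq_zero {l : List Layer} {a : ℕ} (h : a ∉ names l) (b : ℕ) : linkSum l a b = 0 := by
  refine List.sum_eq_zero fun z hz => ?_
  obtain ⟨x, hx, rfl⟩ := List.mem_map.1 hz
  exact Layer.linking_eq_zero fun y hy hya => h (mem_names.2 ⟨x, hx, y, hy, hya⟩)

variable {R : Finset ℕ} {K : Finset (ℕ × List Strand)}

theorem supportedOn_of_subset {l : List Layer} (h : names l ⊆ R) (h_in : ∀ c ∈ inCoupons l, c ∈ K)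
    (h_out : ∀ c ∈ outCoupons l, c ∈ K) : SupportedOn R K l := by
  refine fun x hx => ⟨fun y hy => h (mem_names.2 ⟨x, hx, y, hy, rfl⟩), fun j w hj => ?_⟩
  rcases hj with hj | hj
  · exact h_in _ (mem_inCoupons.2 ⟨x, hx, hj⟩)
  · exact h_out _ (mem_outCoupons.2 ⟨x, hx, hj⟩)

theorem SupportedOn.mono {l l' : List Layer} (h : SupportedOn R K l) (hl : ∀ x ∈ l', x ∈ l) :
    SupportedOn R K l' :=
  fun x hx => h x (hl x hx)

theorem fst_mem_names_of_mem_inCoupons {l : List Layer} {c : ℕ × List Strand}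
    (hc : c ∈ inCoupons l) {x : Strand} (hx : x ∈ c.2) : x.1 ∈ names l := by
  obtain ⟨⟨u, p, v⟩, hy, rfl⟩ := mem_inCoupons.1 hc
  exact mem_names.2 ⟨_, hy, x, by simp [Layer.src, Piece.src, hx], rfl⟩

theorem IsTangle.fst_mem_names {s t : List Strand} {l : List Layer} (h : IsTangle s l t)
    {y : Strand} (hy : y ∈ t) : y ∈ s ∨ y.1 ∈ names l := by
  induction l generalizing s with
  | nil => exact Or.inl ((show s = t from h) ▸ hy)
  | cons x l ih =>
    refine Or.inr ?_
    rcases ih h.2 with h' | h'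
    · exact mem_names.2 ⟨x, List.mem_cons_self, y, List.mem_append_right _ h', rfl⟩
    · obtain ⟨z, hz, h''⟩ := mem_names.1 h'
      exact mem_names.2 ⟨z, List.mem_cons_of_mem _ hz, h''⟩

theorem mem_of_mem_passRight {u : List Strand} {s : Strand} {w v : List Strand} {x : Layer}
    (hx : x ∈ passRight u s w v) :
    (∃ y, x.piece = .cross true s y) ∧ ∀ y ∈ x.src ++ x.tgt, y ∈ u ++ s :: (w ++ v) := by
  induction w generalizing u with
  | nil => simp [passRight] at hx
  | cons z w ih =>
    rcases List.mem_cons.1 hx with rfl | hx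
    · refine ⟨⟨z, rfl⟩, fun y hy => ?_⟩
      simp only [Layer.src, Layer.tgt, Piece.src, Piece.tgt, List.mem_append, List.mem_cons,
        List.not_mem_nil, or_false] at hy ⊢
      tauto
    · refine ⟨(ih hx).1, fun y hy => ?_⟩
      have := (ih hx).2 y hy
      simp only [List.mem_append, List.mem_cons, List.not_mem_nil, or_false] at this ⊢
      tauto

theorem mem_of_mem_passLeft {u : List Strand} {s : Strand} {w v : List Strand} {x : Layer}
    (hx : x ∈ passLeft u s w v) :
    (∃ y, x.piece = .cross true y s) ∧ ∀ y ∈ x.src ++ x.tgt, y ∈ u ++ s :: (w ++ v) := by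
  induction w generalizing u with
  | nil => simp [passLeft] at hx
  | cons z w ih =>
    rcases List.mem_append.1 hx with hx | hx
    · refine ⟨(ih hx).1, fun y hy => ?_⟩
      have := (ih hx).2 y hy
      simp only [List.mem_append, List.mem_cons, List.not_mem_nil, or_false] at this ⊢
      tauto
    · obtain rfl := List.mem_singleton.1 hx
      refine ⟨⟨z, rfl⟩, fun y hy => ?_⟩
      simp only [Layer.src, Layer.tgt, Piece.src, Piece.tgt, List.mem_append, List.mem_cons,
        List.not_mem_nil, or_false] at hy ⊢
      tauto

theorem piece_of_mem_encircled {u w v : List Strand} {a : ℕ} {d : Bool} {x : Layer}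
    (hx : x ∈ encircled u w v a d) :
    ∀ j s, x.piece ≠ .couponIn j s ∧ x.piece ≠ .couponOut j s := by
  simp only [encircled, List.mem_append, List.mem_singleton] at hx
  rcases hx with ((rfl | hx) | hx) | rfl
  · simp
  · obtain ⟨y, hy⟩ := (mem_of_mem_passRight hx).1
    simp [hy]
  · obtain ⟨y, hy⟩ := (mem_of_mem_passLeft hx).1
    simp [hy]
  · simp

theorem inCoupons_encircled (u w v : List Strand) (a : ℕ) (d : Bool) :
    inCoupons (encircled u w v a d) = [] :=
  List.eq_nil_iff_forall_not_mem.2 fun c hc => by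
    obtain ⟨x, hx, hc⟩ := mem_inCoupons.1 hc
    exact (piece_of_mem_encircled hx _ _).1 hc

theorem mem_names_encircled {u w v : List Strand} {a : ℕ} {d : Bool} {b : ℕ} :
    b ∈ names (encircled u w v a d) ↔ b = a ∨ ∃ y ∈ u ++ (w ++ v), y.1 = b := by
  constructor
  · rintro hb
    obtain ⟨x, hx, y, hy, rfl⟩ := mem_names.1 hb
    have key (h : y ∈ (u ++ [(a, d)]) ++ (a, !d) :: (w ++ v)) :
        y.1 = a ∨ ∃ z ∈ u ++ (w ++ v), z.1 = y.1 := by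
      simp only [List.mem_append, List.mem_cons, List.not_mem_nil, or_false] at h
      rcases h with (h | rfl) | rfl | h
      · exact Or.inr ⟨y, by simp [h], rfl⟩
      · exact Or.inl rfl
      · exact Or.inl rfl
      · exact Or.inr ⟨y, by simp [h], rfl⟩
    simp only [encircled, List.mem_append, List.mem_singleton] at hx
    rcases hx with ((rfl | hx) | hx) | rfl
    · refine key ?_
      simp only [Layer.src, Layer.tgt, Piece.src, Piece.tgt, List.mem_append, List.mem_cons,
        List.not_mem_nil, or_false, false_or] at hy ⊢
      tauto
    · exact key ((mem_of_mem_passRight hx).2 y hy)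
    · exact key ((mem_of_mem_passLeft hx).2 y hy)
    · refine key ?_
      simp only [Layer.src, Layer.tgt, Piece.src, Piece.tgt, List.mem_append, List.mem_cons,
        List.not_mem_nil, or_false, false_or] at hy ⊢
      tauto
  · intro h
    refine mem_names.2 ⟨⟨u, .cup a d, w ++ v⟩, by simp [encircled], ?_⟩
    rcases h with rfl | ⟨y, hy, rfl⟩
    · exact ⟨(b, d), by simp [Layer.tgt, Piece.tgt], rfl⟩
    · exact ⟨y, List.mem_append_left _ hy, rfl⟩

theorem mem_names_facingCoupons {u w v : List Strand} {j b : ℕ} :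
    b ∈ names (facingCoupons u w v j) ↔ ∃ y ∈ u ++ (w ++ v), y.1 = b := by
  constructor
  · rintro hb
    obtain ⟨x, hx, y, hy, rfl⟩ := mem_names.1 hb
    refine ⟨y, ?_, rfl⟩
    simp only [facingCoupons, List.mem_cons, List.not_mem_nil, or_false] at hx
    rcases hx with rfl | rfl <;>
    · simp only [Layer.src, Layer.tgt, Piece.src, Piece.tgt, List.mem_append,
        List.not_mem_nil, false_or] at hy ⊢
      tauto
  · rintro ⟨y, hy, rfl⟩
    exact mem_names.2 ⟨⟨u, .couponIn j w, v⟩, by simp [facingCoupons], y,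
      List.mem_append_left _ hy, rfl⟩

theorem mem_names_cancellation {u v : List Strand} {j a : ℕ} {d : Bool} {b : ℕ} :
    b ∈ names (cancellation u v j a d) ↔ b = a ∨ ∃ y ∈ u ++ v, y.1 = b := by
  constructor
  · rintro hb
    obtain ⟨x, hx, y, hy, rfl⟩ := mem_names.1 hb
    simp only [cancellation, List.mem_cons, List.not_mem_nil, or_false] at hx
    rcases hx with rfl | rfl <;>
    · simp only [Layer.src, Layer.tgt, Piece.src, Piece.tgt, List.mem_append, List.mem_cons,
        List.not_mem_nil, or_false, false_or] at hy
      by_cases h : y = (a, d)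
      · exact Or.inl (by rw [h])
      · exact Or.inr ⟨y, by simp only [List.mem_append]; tauto, rfl⟩
  · intro h
    refine mem_names.2 ⟨⟨u, .couponOut j [(a, d)], v⟩, by simp [cancellation], ?_⟩
    rcases h with rfl | ⟨y, hy, rfl⟩
    · exact ⟨(b, d), by simp [Layer.tgt, Piece.tgt], rfl⟩
    · exact ⟨y, List.mem_append_left _ hy, rfl⟩

theorem mem_names_negUnknot {u v : List Strand} {a : ℕ} {d : Bool} {b : ℕ} :
    b ∈ names (negUnknot u v a d) ↔ b = a ∨ ∃ y ∈ u ++ v, y.1 = b := by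
  constructor
  · rintro hb
    obtain ⟨x, hx, y, hy, rfl⟩ := mem_names.1 hb
    simp only [negUnknot, List.mem_cons, List.not_mem_nil, or_false] at hx
    by_cases h : y = (a, d) ∨ y = (a, !d)
    · rcases h with rfl | rfl <;> exact Or.inl rfl
    refine Or.inr ⟨y, ?_, rfl⟩
    simp only [List.mem_append]
    rcases hx with rfl | rfl | rfl | rfl | rfl <;>
    · simp only [Layer.src, Layer.tgt, Piece.src, Piece.tgt, List.mem_append, List.mem_cons,
        List.not_mem_nil, or_false, false_or] at hy
      tauto
  · intro h
    refine mem_names.2 ⟨⟨u, .cup a d, v⟩, by simp [negUnknot], ?_⟩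
    rcases h with rfl | ⟨y, hy, rfl⟩
    · exact ⟨(b, d), by simp [Layer.tgt, Piece.tgt], rfl⟩
    · exact ⟨y, List.mem_append_left _ hy, rfl⟩

theorem linkSum_passRight_self {u : List Strand} {s : Strand} {w v : List Strand}
    (h : ∀ y ∈ w, y.1 ≠ s.1) : linkSum (passRight u s w v) s.1 s.1 = 0 := by
  induction w generalizing u with
  | nil => rfl
  | cons y w ih =>
    have hy := h y List.mem_cons_self
    have := ih (u := u ++ [y]) fun z hz => h z (List.mem_cons_of_mem _ hz)
    rw [linkSum] at this ⊢
    rw [passRight, List.map_cons, List.sum_cons, this]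
    simp [Layer.linking, hy]

theorem linkSum_passLeft_self {u : List Strand} {s : Strand} {w v : List Strand}
    (h : ∀ y ∈ w, y.1 ≠ s.1) : linkSum (passLeft u s w v) s.1 s.1 = 0 := by
  induction w generalizing u with
  | nil => rfl
  | cons y w ih =>
    have hy := h y List.mem_cons_self
    rw [passLeft, linkSum_append, ih fun z hz => h z (List.mem_cons_of_mem _ hz)]
    simp [linkSum, Layer.linking, hy]

theorem passages_cons (y : Strand) (w : List Strand) (b : ℕ) : passages (y :: w) b =
    (if y.1 = b then (if y.2 then 1 else -1) else 0) + passages w b := by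
  rw [passages, List.map_cons, List.sum_cons]
  rfl

/-- Each strand of `w` is crossed once, with half the product of the two directions as its
contribution. The way back contributes the same amount. -/
theorem linkSum_passRight {u : List Strand} {s : Strand} {w v : List Strand} {b : ℕ}
    (hb : b ≠ s.1) : linkSum (passRight u s w v) s.1 b =
      (if s.2 then 1 else -1) * passages w b / 2 := by
  induction w generalizing u with
  | nil => simp [passRight, linkSum, passages]
  | cons y w ih =>
    have := ih (u := u ++ [y])
    rw [linkSum] at this ⊢
    rw [passRight, List.map_cons, List.sum_cons, this, passages_cons]
    obtain ⟨y, d⟩ := y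
    obtain ⟨s, d'⟩ := s
    have hb' : s ≠ b := hb.symm
    by_cases hy : y = b <;> cases d <;> cases d' <;> simp [Layer.linking, hb', hy] <;> ring

theorem linkSum_passLeft {u : List Strand} {s : Strand} {w v : List Strand} {b : ℕ}
    (hb : b ≠ s.1) : linkSum (passLeft u s w v) s.1 b =
      (if s.2 then 1 else -1) * passages w b / 2 := by
  induction w generalizing u with
  | nil => simp [passLeft, linkSum, passages]
  | cons y w ih =>
    rw [passLeft, linkSum_append, ih, passages_cons]
    obtain ⟨y, d⟩ := y
    obtain ⟨s, d'⟩ := s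
    have hb' : s ≠ b := hb.symm
    by_cases hy : y = b <;> cases d <;> cases d' <;> simp [linkSum, Layer.linking, hb', hy] <;> ring

theorem linkSum_passRight_of_ne {u : List Strand} {s : Strand} {w v : List Strand} {b c : ℕ}
    (hb : b ≠ s.1) (hc : c ≠ s.1) : linkSum (passRight u s w v) b c = 0 := by
  refine List.sum_eq_zero fun z hz => ?_
  obtain ⟨x, hx, rfl⟩ := List.mem_map.1 hz
  obtain ⟨y, hy⟩ := (mem_of_mem_passRight hx).1
  simp [Layer.linking, hy, hb.symm, hc.symm]

theorem linkSum_passLeft_of_ne {u : List Strand} {s : Strand} {w v : List Strand} {b c : ℕ}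
    (hb : b ≠ s.1) (hc : c ≠ s.1) : linkSum (passLeft u s w v) b c = 0 := by
  refine List.sum_eq_zero fun z hz => ?_
  obtain ⟨x, hx, rfl⟩ := List.mem_map.1 hz
  obtain ⟨y, hy⟩ := (mem_of_mem_passLeft hx).1
  simp [Layer.linking, hy, hb.symm, hc.symm]

theorem linkSum_encircled (u w v : List Strand) (a : ℕ) (d : Bool) (b c : ℕ) :
    linkSum (encircled u w v a d) b c = linkSum (passRight (u ++ [(a, d)]) (a, !d) w v) b c +
      linkSum (passLeft (u ++ [(a, d)]) (a, !d) w v) b c := by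
  rw [encircled, linkSum_append, linkSum_append, linkSum_append]
  simp [linkSum, Layer.linking]

theorem linkSum_negUnknot (u v : List Strand) (a : ℕ) (d : Bool) (b c : ℕ) :
    linkSum (negUnknot u v a d) b c = if b = a ∧ c = a then -1 else 0 := by
  have hb : a = b ↔ b = a := eq_comm
  have hc : a = c ↔ c = a := eq_comm
  by_cases hb' : b = a <;> by_cases hc' : c = a <;>
    simp [linkSum, negUnknot, Layer.linking, hb, hc, hb', hc']

end Layers

/-! ### Diagrams changed in one sphere. -/

section Update

variable {r : ℕ} (L : Diagram r) (ω : Fin r)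

/-- Ribbons, coupons and linking sums do not depend on the order of the layers. The same `rest`,
made of the other spheres, serves for every `l`; this makes the diagrams before and after a move
comparable. -/
theorem Diagram.exists_layers_update_perm : ∃ rest, ∀ l : List Layer,
    (Diagram.layers (Function.update L ω l)).Perm (l ++ rest) := by
  refine ⟨((List.ofFn L).take ω).flatten ++ ((List.ofFn L).drop (ω + 1)).flatten, fun l => ?_⟩
  have h : List.ofFn (Function.update L ω l) = (List.ofFn L).set ω l := by
    refine List.ext_getElem (by simp) fun i h₁ h₂ => ?_
    rw [List.getElem_ofFn, List.getElem_set]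
    by_cases hi : ω.1 = i
    · subst hi; simp
    · rw [if_neg hi, List.getElem_ofFn, Function.update_of_ne fun h => hi (by rw [← h])]
  rw [Diagram.layers, h, List.set_eq_take_append_cons_drop, if_pos (by simp), List.flatten_append,
    List.flatten_cons, ← List.append_assoc, ← List.append_assoc]
  exact List.perm_append_comm.append_right _

theorem Diagram.layers_update_perm (l₁ l l₂ : List Layer) :
    (Diagram.layers (Function.update L ω (l₁ ++ l ++ l₂))).Perm
      (l ++ Diagram.layers (Function.update L ω (l₁ ++ l₂))) := by
  obtain ⟨rest, h⟩ := L.exists_layers_update_perm ω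
  refine (h _).trans (List.Perm.trans ?_ ((h (l₁ ++ l₂)).symm.append_left l))
  rw [← List.append_assoc, ← List.append_assoc]
  exact (List.perm_append_comm.append_right l₂).append_right rest

variable {L ω}

theorem Diagram.mem_layers {x : Layer} : x ∈ L.layers ↔ ∃ ω, x ∈ L ω := by
  simp [Diagram.layers, List.mem_flatten, List.mem_ofFn]

variable {L' : Diagram r} {l : List Layer}

theorem Diagram.ribbons_of_perm (h : L'.layers.Perm (l ++ L.layers)) :
    L'.ribbons = names l ∪ L.ribbons :=
  (names_perm h).trans (names_append _ _)

theorem Diagram.couponsIn_of_perm (h : L'.layers.Perm (l ++ L.layers)) :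
    L'.couponsIn.Perm (inCoupons l ++ L.couponsIn) := by
  have := h.filterMap (fun x => match x.piece with
    | .couponIn j w => some (j, w)
    | _ => none)
  rwa [List.filterMap_append] at this

theorem Diagram.couponsOut_of_perm (h : L'.layers.Perm (l ++ L.layers)) :
    L'.couponsOut.Perm (outCoupons l ++ L.couponsOut) := by
  have := h.filterMap (fun x => match x.piece with
    | .couponOut j w => some (j, w)
    | _ => none)
  rwa [List.filterMap_append] at this

theorem Diagram.coupons_of_perm (h : L'.layers.Perm (l ++ L.layers)) :
    L'.coupons = (inCoupons l).toFinset ∪ L.coupons :=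
  (List.toFinset_eq_of_perm _ _ (Diagram.couponsIn_of_perm h)).trans List.toFinset_append

theorem Diagram.linkSum_of_perm (h : L'.layers.Perm (l ++ L.layers)) (a b : ℕ) :
    linkSum L'.layers a b = linkSum l a b + linkSum L.layers a b :=
  (linkSum_perm h a b).trans (linkSum_append _ _ a b)

theorem Diagram.supportedOn_layers (h : L.couponsIn.Perm L.couponsOut) :
    SupportedOn L.ribbons L.coupons L.layers :=
  supportedOn_of_subset (Finset.Subset.refl _) (fun _ hc => List.mem_toFinset.2 hc)
    fun _ hc => List.mem_toFinset.2 (h.mem_iff.2 hc)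

theorem Diagram.fst_mem_ribbons {c : ℕ × List Strand} (hc : c ∈ L.coupons) :
    ∀ x ∈ c.2, x.1 ∈ L.ribbons :=
  fun _ hx => fst_mem_names_of_mem_inCoupons (List.mem_toFinset.1 hc) hx

end Update

/-! ### Invariance under the moves -/

section Invariance

universe v u w

variable {C : Type u} [Category.{v} C] [MonoidalCategory C] [BraidedCategory C]
  [RightRigidCategory C] [Balancing C] [Abelian C] [Linear ℂ C]
  [MonoidalPreadditive C] [MonoidalLinear ℂ C]
  {I : Type w} [Fintype I] [DecidableEq I] (S : Irreducibles C I) (B : DualBases C)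
  (dhat : I → ℂ)

set_option linter.unusedSectionVars false

theorem Diagram.IsBridgedLink.supportedOn {r : ℕ} {L : Diagram r} (hL : L.IsBridgedLink)
    (ω : Fin r) : SupportedOn L.ribbons L.coupons (L ω) :=
  (Diagram.supportedOn_layers hL.paired).mono fun _ hx => Diagram.mem_layers.2 ⟨ω, hx⟩

/-- The layers `T₁` start from the empty row, so each strand at their end already occurs in them.
Straight strands beside an inserted picture thus bring no new ribbons. -/
theorem Diagram.fst_mem_ribbons_of_isTangle {r : ℕ} {L : Diagram r} {ω : Fin r}
    {T₁ T₂ : List Layer} {m : List Strand} (hT : L ω = T₁ ++ T₂) (hT₁ : IsTangle [] T₁ m)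
    {y : Strand} (hy : y ∈ m) : y.1 ∈ L.ribbons := by
  obtain ⟨x, hx, h⟩ := mem_names.1 ((hT₁.fst_mem_names hy).resolve_left List.not_mem_nil)
  exact mem_names.2 ⟨x, Diagram.mem_layers.2 ⟨ω, by rw [hT]; exact List.mem_append_left _ hx⟩, h⟩

theorem Diagram.layers_insert_perm {r : ℕ} {L : Diagram r} {ω : Fin r} {T₁ T₂ : List Layer}
    (hT : L ω = T₁ ++ T₂) (l : List Layer) :
    (Diagram.layers (Function.update L ω (T₁ ++ l ++ T₂))).Perm (l ++ L.layers) := by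
  have h := L.layers_update_perm ω T₁ l T₂
  rwa [← hT, Function.update_eq_self] at h

variable {dhat} {r : ℕ} {L : Diagram r} {ω : Fin r} {T₁ T₂ : List Layer} {u w v : List Strand}
  {j a : ℕ} {d : Bool}

theorem invariants_cancellation (hdhat_one : dhat S.one ≠ 0) (hL : L.IsBridgedLink)
    (hT : L ω = T₁ ++ T₂) (hT₁ : IsTangle [] T₁ (u ++ v)) (hj : ∀ w, (j, w) ∉ L.coupons)
    (ha : a ∉ L.ribbons) {L' : Diagram r}
    (hL' : L' = Function.update L ω (T₁ ++ cancellation u v j a d ++ T₂)) :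
    L'.bracket S B dhat = L.bracket S B dhat ∧ L'.eulerNumber = L.eulerNumber ∧
      L'.signature = L.signature := by
  have hperm : L'.layers.Perm (cancellation u v j a d ++ L.layers) :=
    hL' ▸ Diagram.layers_insert_perm hT _
  have hR : L'.ribbons = insert a L.ribbons := by
    rw [Diagram.ribbons_of_perm hperm]
    ext b
    rw [Finset.mem_union, Finset.mem_insert, mem_names_cancellation, or_assoc]
    refine or_congr_right (or_iff_right_of_imp ?_)
    rintro ⟨y, hy, rfl⟩
    exact Diagram.fst_mem_ribbons_of_isTangle hT hT₁ hy
  have hK : L'.coupons = insert (j, [(a, d)]) L.coupons := Diagram.coupons_of_perm hperm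
  refine ⟨?_, ?_, ?_⟩
  · rw [Diagram.bracket_eq_colourSum, Diagram.bracket_eq_colourSum, hR, hK, hL']
    exact colourSum_cancellation S B hL.supportedOn (fun _ => Diagram.fst_mem_ribbons)
      (div_self hdhat_one) hT hT₁ (hj _) ha
  · rw [Diagram.eulerNumber, Diagram.eulerNumber, hR, hK, Finset.card_insert_of_notMem ha,
      Finset.card_insert_of_notMem (hj _)]
    push_cast
    ring
  · rw [Diagram.signature_eq, Diagram.signature_eq, hR, hK]
    refine formSignature_insert_coupon ha (fun b _ c _ => ?_) j d
    exact (Diagram.linkSum_of_perm hperm b c).trans (by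
      simp [cancellation, linkSum, Layer.linking])

theorem invariants_encircled
    (hdhat : ∀ i, ∑ j, dhat j * Smatrix S j i = if i = S.one then 1 else 0)
    (hL : L.IsBridgedLink) (hT : L ω = T₁ ++ facingCoupons u w v j ++ T₂) (ha : a ∉ L.ribbons)
    {L' : Diagram r} (hL' : L' = Function.update L ω (T₁ ++ encircled u w v a d ++ T₂)) :
    L'.bracket S B dhat = 1 / dhat S.one * L.bracket S B dhat ∧
      L'.eulerNumber = L.eulerNumber + 2 ∧ L'.signature = L.signature := by
  obtain ⟨m, hm, -⟩ := IsTangle.exists_of_append (hT ▸ hL.closed ω)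
  obtain ⟨m', hT₁, hm'⟩ := IsTangle.exists_of_append hm
  obtain rfl : m' = u ++ (w ++ v) := hm'.1
  -- `L` with the two facing coupons cut out: the layers common to the diagrams before and after the
  -- modification.
  let L₀ : Diagram r := Function.update L ω (T₁ ++ T₂)
  have hperm : L.layers.Perm (facingCoupons u w v j ++ L₀.layers) := by
    have h := L.layers_update_perm ω T₁ (facingCoupons u w v j) T₂
    rwa [← hT, Function.update_eq_self] at h
  have hperm' : L'.layers.Perm (encircled u w v a d ++ L₀.layers) :=
    hL' ▸ L.layers_update_perm ω T₁ _ T₂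
  have h_in : L.couponsIn.Perm ((j, w) :: L₀.couponsIn) := Diagram.couponsIn_of_perm hperm
  have h_out : L.couponsOut.Perm ((j, w) :: L₀.couponsOut) := Diagram.couponsOut_of_perm hperm
  have hpaired : L₀.couponsIn.Perm L₀.couponsOut :=
    ((h_in.symm.trans hL.paired).trans h_out).cons_inv
  -- The coupon pairs of `L` have distinct names, so the removed pair does not occur a second time.
  have hj : (j, w) ∉ L₀.coupons := fun h => by
    have h' := ((h_in.map Prod.fst).nodup_iff.1 hL.distinct)
    exact (List.nodup_cons.1 h').1 (List.mem_map_of_mem (f := Prod.fst) (List.mem_toFinset.1 h))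
  have hR₀ : L.ribbons = names (facingCoupons u w v j) ∪ L₀.ribbons :=
    Diagram.ribbons_of_perm hperm
  have hsub : L₀.ribbons ⊆ L.ribbons := hR₀ ▸ Finset.subset_union_right
  have hR : L'.ribbons = insert a L.ribbons := by
    rw [Diagram.ribbons_of_perm hperm', hR₀]
    ext b
    rw [Finset.mem_union, Finset.mem_insert, Finset.mem_union, mem_names_encircled,
      mem_names_facingCoupons, or_assoc]
  have hK : L.coupons = insert (j, w) L₀.coupons := Diagram.coupons_of_perm hperm
  have hK' : L'.coupons = L₀.coupons := by
    rw [Diagram.coupons_of_perm hperm', inCoupons_encircled]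
    rfl
  have hsup : SupportedOn L.ribbons L₀.coupons L₀.layers :=
    fun x hx => ⟨fun y hy => hsub ((Diagram.supportedOn_layers hpaired x hx).1 y hy),
      (Diagram.supportedOn_layers hpaired x hx).2⟩
  have hmem {x : Layer} (hx : x ∈ T₁ ++ T₂) : x ∈ L₀.layers :=
    Diagram.mem_layers.2 ⟨ω, by
      change x ∈ Function.update L ω (T₁ ++ T₂) ω
      rwa [Function.update_self]⟩
  have hnames : ∀ c ∈ L₀.coupons, ∀ x ∈ c.2, x.1 ∈ L.ribbons :=
    fun c hc x hx => hsub (Diagram.fst_mem_ribbons hc x hx)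
  refine ⟨?_, ?_, ?_⟩
  · rw [Diagram.bracket_eq_colourSum, Diagram.bracket_eq_colourSum, hR, hK, hK', hL']
    refine colourSum_encircled S B dhat (fun ω' hω' => hsup.mono fun x hx => ?_)
      (hsup.mono fun x hx => hmem (List.mem_append_left _ hx))
      (hsup.mono fun x hx => hmem (List.mem_append_right _ hx)) (fun y hy => ?_) hnames hT hT₁ hj ha
      hdhat
    · refine Diagram.mem_layers.2 ⟨ω', ?_⟩
      change x ∈ Function.update L ω (T₁ ++ T₂) ω'
      rwa [Function.update_of_ne hω']
    · exact Diagram.fst_mem_ribbons_of_isTangle (hT.trans (List.append_assoc _ _ _)) hT₁ hy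
  · rw [Diagram.eulerNumber, Diagram.eulerNumber, hR, hK, hK', Finset.card_insert_of_notMem ha,
      Finset.card_insert_of_notMem hj]
    push_cast
    ring
  · have ha₀ : a ∉ names L₀.layers := fun h => ha (hsub h)
    have hw : ∀ y ∈ w, y.1 ≠ a := fun y hy h => ha (h ▸ hR₀ ▸ Finset.mem_union_left _
      (mem_names_facingCoupons.2 ⟨y, by simp [hy], rfl⟩))
    rw [Diagram.signature_eq, Diagram.signature_eq, hR, hK, hK']
    -- Only the strand `(a, !d)` of the annulus crosses `w`, once in each pass. The two halves give
    -- linking numbers `±passages`, with the sign of the direction `!d`, and the two symmetric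
    -- matrix entries double this to `∓2` or `±2` times a passage count.
    refine formSignature_insert_pairing ha hnames (c₀ := (j, w)) (z := if d then -2 else 2)
      (fun b hb c hc => ?_) ?_ (by cases d <;> simp) fun b hb => ?_
    · have hb' : b ≠ a := fun h => ha (h ▸ hb)
      have hc' : c ≠ a := fun h => ha (h ▸ hc)
      refine (Diagram.linkSum_of_perm hperm' b c).trans (Eq.trans ?_
        (Diagram.linkSum_of_perm hperm b c).symm)
      rw [linkSum_encircled, linkSum_passRight_of_ne hb' hc', linkSum_passLeft_of_ne hb' hc']
      simp [facingCoupons, linkSum, Layer.linking]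
    · refine (Diagram.linkSum_of_perm hperm' a a).trans ?_
      rw [linkSum_eq_zero ha₀, linkSum_encircled]
      have h₁ := linkSum_passRight_self (u := u ++ [(a, d)]) (s := (a, !d)) (v := v) hw
      have h₂ := linkSum_passLeft_self (u := u ++ [(a, d)]) (s := (a, !d)) (v := v) hw
      rw [h₁, h₂]
      simp
    · have hb' : b ≠ a := fun h => ha (h ▸ hb)
      have h₁ := linkSum_passRight (u := u ++ [(a, d)]) (s := (a, !d)) (w := w) (v := v) hb'
      have h₂ := linkSum_passLeft (u := u ++ [(a, d)]) (s := (a, !d)) (w := w) (v := v) hb'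
      have h₃ := Diagram.linkSum_of_perm hperm' a b
      rw [linkSum_eq_zero ha₀, linkSum_encircled, h₁, h₂] at h₃
      change linkSum L'.layers a b + linkSum L'.layers b a = _
      rw [linkSum_comm _ b a, h₃]
      cases d <;> simp <;> ring

theorem colourSum_empty {weight : I → ℂ} :
    colourSum S B ∅ ∅ (Diagram.valuation S fun _ : Fin 1 => []) weight = 1 := by
  have h : scalar (𝟙 (𝟙_ C)) = 1 := by
    rw [← one_smul ℂ (𝟙 (𝟙_ C)), S.scalar_smul_id]
  simp [colourSum, stateSum, Diagram.valuation, tangleHom]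
  exact h

/-- The isolated unknot arises by the same move from the empty diagram in one sphere, whose value is
one. Hence its value is exactly the factor produced in any other place, independent of the name and
direction of the ribbon. -/
theorem bracket_negUnknot (b : ℕ) (d : Bool) :
    Diagram.bracket S B dhat (fun _ : Fin 1 => negUnknot [] [] b d) =
      ∑ i, dhat i / dhat S.one * unknotScalar S i := by
  have h : (fun _ : Fin 1 => negUnknot [] [] b d) =
      Function.update (fun _ : Fin 1 => ([] : List Layer)) 0 ([] ++ negUnknot [] [] b d ++ []) := by
    funext i
    rw [Subsingleton.elim i 0, Function.update_self, List.append_nil, List.nil_append]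
  have hperm : Diagram.layers (fun _ : Fin 1 => negUnknot [] [] b d) = negUnknot [] [] b d := by
    simp [Diagram.layers]
  have hR : Diagram.ribbons (fun _ : Fin 1 => negUnknot [] [] b d) = insert b ∅ := by
    ext c
    rw [Diagram.ribbons, hperm]
    exact mem_names_negUnknot.trans (by simp)
  have hK : Diagram.coupons (fun _ : Fin 1 => negUnknot [] [] b d) = ∅ := by
    rw [Diagram.coupons, Diagram.couponsIn, hperm]
    rfl
  rw [Diagram.bracket_eq_colourSum, hR, hK, h]
  refine (colourSum_negUnknot S B (fun _ x hx => absurd hx List.not_mem_nil) (by simp) (T₁ := [])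
    (T₂ := []) (u := []) (v := []) rfl rfl
    (Finset.notMem_empty b)).trans ?_
  rw [colourSum_empty, mul_one]

theorem invariants_negUnknot (hL : L.IsBridgedLink) (hT : L ω = T₁ ++ T₂)
    (hT₁ : IsTangle [] T₁ (u ++ v)) (ha : a ∉ L.ribbons) (b : ℕ) (d' : Bool) {L' : Diagram r}
    (hL' : L' = Function.update L ω (T₁ ++ negUnknot u v a d ++ T₂)) :
    L'.bracket S B dhat =
        L.bracket S B dhat * Diagram.bracket S B dhat (fun _ : Fin 1 => negUnknot [] [] b d') ∧
      L'.eulerNumber = L.eulerNumber + 1 ∧ L'.signature = L.signature - 1 := by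
  have hperm : L'.layers.Perm (negUnknot u v a d ++ L.layers) :=
    hL' ▸ Diagram.layers_insert_perm hT _
  have hR : L'.ribbons = insert a L.ribbons := by
    rw [Diagram.ribbons_of_perm hperm]
    ext b
    rw [Finset.mem_union, Finset.mem_insert, mem_names_negUnknot, or_assoc]
    refine or_congr_right (or_iff_right_of_imp ?_)
    rintro ⟨y, hy, rfl⟩
    exact Diagram.fst_mem_ribbons_of_isTangle hT hT₁ hy
  have hK : L'.coupons = L.coupons :=
    (Diagram.coupons_of_perm hperm).trans (Finset.empty_union _)
  refine ⟨?_, ?_, ?_⟩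
  · rw [bracket_negUnknot, Diagram.bracket_eq_colourSum, Diagram.bracket_eq_colourSum, hR, hK, hL',
      mul_comm]
    exact colourSum_negUnknot S B hL.supportedOn (fun _ => Diagram.fst_mem_ribbons) hT hT₁ ha
  · rw [Diagram.eulerNumber, Diagram.eulerNumber, hR, hK, Finset.card_insert_of_notMem ha]
    push_cast
    ring
  · have h (c e : ℕ) := Diagram.linkSum_of_perm hperm c e
    rw [Diagram.signature_eq, Diagram.signature_eq, hR, hK]
    refine formSignature_insert_neg_one ha (fun _ => Diagram.fst_mem_ribbons)
      (fun c hc e he => ?_) ?_ fun c hc => ?_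
    · refine (h c e).trans ?_
      rw [linkSum_negUnknot, if_neg fun h : c = a ∧ e = a => ha (h.1 ▸ hc), zero_add]
      rfl
    · refine (h a a).trans ?_
      rw [linkSum_negUnknot, if_pos ⟨rfl, rfl⟩, linkSum_eq_zero ha, add_zero]
    · change linkSum L'.layers a c + linkSum L'.layers c a = _
      rw [linkSum_comm _ c a, h, linkSum_negUnknot, if_neg fun h : a = a ∧ c = a => ha (h.2 ▸ hc),
        linkSum_eq_zero ha]
      simp

end Invariance

end BridgedLinks

end

theorem mainTheorem4 {C : Type*} [Category C] [MonoidalCategory C] [BraidedCategory C]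
    [RightRigidCategory C] [Balancing C] [Abelian C] [MonoidalPreadditive C] [Linear ℂ C]
    [MonoidalLinear ℂ C]
    {I : Type*} [Fintype I] [DecidableEq I] (S : Irreducibles C I) (B : DualBases C)
    (dhat : I → ℂ)
    (hdhat : ∀ i, ∑ j, dhat j * Smatrix S j i = if i = S.one then 1 else 0)
    (hdhat_one : dhat S.one ≠ 0)
    {r : ℕ} (L : Diagram r) (hL : L.IsBridgedLink) (ω : Fin r) :
    -- isolated cancellation diagram
    (∀ (T₁ T₂ : List Layer) (u v : List Strand) (j a : ℕ) (d : Bool),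
      L ω = T₁ ++ T₂ → IsTangle [] T₁ (u ++ v) →
      (∀ w, (j, w) ∉ L.coupons) → a ∉ L.ribbons →
      ∀ L' : Diagram r, L' = Function.update L ω (T₁ ++ cancellation u v j a d ++ T₂) →
        L'.bracket S B dhat = L.bracket S B dhat ∧
        L'.eulerNumber = L.eulerNumber ∧
        L'.signature = L.signature) ∧
    -- modification
    (∀ (T₁ T₂ : List Layer) (u w v : List Strand) (j a : ℕ) (d : Bool),
      L ω = T₁ ++ facingCoupons u w v j ++ T₂ → a ∉ L.ribbons →
      ∀ L' : Diagram r, L' = Function.update L ω (T₁ ++ encircled u w v a d ++ T₂) →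
        L'.bracket S B dhat = 1 / dhat S.one * L.bracket S B dhat ∧
        L'.eulerNumber = L.eulerNumber + 2 ∧
        L'.signature = L.signature) ∧
    -- isolated unknot with framing number `-1`
    (∀ (T₁ T₂ : List Layer) (u v : List Strand) (a b : ℕ) (d d' : Bool),
      L ω = T₁ ++ T₂ → IsTangle [] T₁ (u ++ v) → a ∉ L.ribbons →
      ∀ L' : Diagram r, L' = Function.update L ω (T₁ ++ negUnknot u v a d ++ T₂) →
        L'.bracket S B dhat =
          L.bracket S B dhat * Diagram.bracket S B dhat (fun _ : Fin 1 => negUnknot [] [] b d') ∧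
        L'.eulerNumber = L.eulerNumber + 1 ∧
        L'.signature = L.signature - 1) :=
  ⟨fun _ _ _ _ _ _ _ hT hT₁ hj ha _ hL' =>
      invariants_cancellation S B hdhat_one hL hT hT₁ hj ha hL',
    fun _ _ _ _ _ _ _ _ hT ha _ hL' => invariants_encircled S B hdhat hL hT ha hL',
    fun _ _ _ _ _ b _ d' hT hT₁ ha _ hL' => invariants_negUnknot S B hL hT hT₁ ha b d' hL'⟩
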